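/- Let $\varepsilon,a,b,\beta,L,T$ be positive constants, $\Omega_T=\{(x,t): 0\le x\le L,\ 0<t\le T\}$ and $D=\{(x,t,u,p):(x,t)\in\Omega_T,\ u,p\in\mathbb R\}$. Let $F:D\to\mathbb R$ satisfy Hypotheses A: (i) $F$ is continuous and bounded on $D$; (ii) for every $k>0$ and every compact $S\subset\Omega_T$ there is a constant $C$ such that $|F(x,t,u,p)-F(x',t',u,p)|\le C(|x-x'|+|t-t'|)$ for all $(x,t),(x',t')\in S$ and all $|u|,|p|<k$; (iii) there is a constant $\beta_F$ such that $|F(x,t,u_1,p_1)-F(x,t,u_2,p_2)|\le\beta_F\{|u_1-u_2|+|p_1-p_2|\}$ for all $(x,t)\in\Omega_T$ and all real $u_1,u_2,p_1,p_2$. Let $u_0:[0,L]\to\mathbb R$ and $g_1,g_2:[0,T]\to\mathbb R$ be continuous. Then the nonlinear Dirichlet problem $$u_t-\varepsilon u_{xx}+au+b\int_0^t e^{-\beta(t-\tau)}u(x,\tau)\,d\tau=F(x,t,u,u_x)\quad(0<x<L,\ 0<t\le T),$$ $$u(x,0)=u_0(x)\ (0\le x\le L),\qquad u(0,t)=g_1(t),\quad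 u(L,t)=g_2(t)\ (0<t\le T)$$ has exactly one regular solution on $[0,L]\times[0,T]$. Here a regular solution is a bounded function $u$ on $[0,L]\times[0,T]$ that satisfies the equation and the conditions above, has continuous derivatives $u_x,u_{xx},u_t$ on $0<x<L$, $0<t\le T$ ($u_t$ being one-sided at $t=T$), is continuous on $[0,L]\times[0,T]$ except possibly at the corners $(0,0)$ and $(L,0)$, and is continuous at $(0,0)$ if $u_0(0)=g_1(0)$ and at $(L,0)$ if $u_0(L)=g_2(0)$. -/

import Mathlib

open Set

/-- The assumptions on the source `F (x, t, u, p)` on the domain `D` of all `(x, t, u, p)` with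
`0 ≤ x ≤ L`, `0 < t ≤ T` and arbitrary real `u`, `p`. -/
structure HypothesesA (L T : ℝ) (F : ℝ → ℝ → ℝ → ℝ → ℝ) : Prop where
  /-- `F` is continuous on `D`. -/
  continuousOn :
    ContinuousOn (fun q : ℝ × ℝ × ℝ × ℝ => F q.1 q.2.1 q.2.2.1 q.2.2.2)
      {q | q.1 ∈ Icc 0 L ∧ q.2.1 ∈ Ioc 0 T}
  /-- `F` is bounded on `D`. -/
  bounded : ∃ M : ℝ, ∀ x ∈ Icc 0 L, ∀ t ∈ Ioc 0 T, ∀ u p : ℝ, |F x t u p| ≤ M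
  /-- For `|u|, |p| < k`, `F` is Lipschitz in `(x, t)` on compact sets; a compact set of pairs
  `(x, t)` stays away from `t = 0`. -/
  lipschitz_xt : ∀ k : ℝ, 0 < k → ∀ S : Set (ℝ × ℝ), IsCompact S → S ⊆ Icc 0 L ×ˢ Ioc 0 T →
    ∃ C : ℝ, ∀ z ∈ S, ∀ z' ∈ S, ∀ u p : ℝ, |u| < k → |p| < k →
      |F z.1 z.2 u p - F z'.1 z'.2 u p| ≤ C * (|z.1 - z'.1| + |z.2 - z'.2|)
  /-- `F` is globally Lipschitz in `(u, p)`. -/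
  lipschitz_up : ∃ βF : ℝ, ∀ x ∈ Icc 0 L, ∀ t ∈ Ioc 0 T, ∀ u₁ p₁ u₂ p₂ : ℝ,
    |F x t u₁ p₁ - F x t u₂ p₂| ≤ βF * (|u₁ - u₂| + |p₁ - p₂|)

/-- `u` is a regular (classical, bounded) solution of the initial-boundary value problem
`u_t - ε u_xx + a u + b ∫₀ᵗ e^{-β (t - τ)} u(x, τ) dτ = F(x, t, u, u_x)`,
`u(x, 0) = u₀(x)`, `u(0, t) = g₁(t)`, `u(L, t) = g₂(t)`.
The values of `u` outside `[0, L] × [0, T]` play no role. -/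
structure IsRegularSolution (ε a b β L T : ℝ) (F : ℝ → ℝ → ℝ → ℝ → ℝ) (u₀ g₁ g₂ : ℝ → ℝ)
    (u : ℝ → ℝ → ℝ) : Prop where
  bounded : ∃ M : ℝ, ∀ x ∈ Icc 0 L, ∀ t ∈ Ioc 0 T, |u x t| ≤ M
  /-- `u` is continuous on the closed rectangle, the two corners at `t = 0` possibly excepted. -/
  continuousOn : ContinuousOn (fun z : ℝ × ℝ => u z.1 z.2)
    ((Icc 0 L ×ˢ Icc 0 T) \ {((0 : ℝ), (0 : ℝ)), (L, (0 : ℝ))})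
  /-- `u` is continuous also at a corner where the initial and boundary data agree. -/
  corner_left : u₀ 0 = g₁ 0 →
    ContinuousWithinAt (fun z : ℝ × ℝ => u z.1 z.2) (Icc 0 L ×ˢ Icc 0 T) (0, 0)
  corner_right : u₀ L = g₂ 0 →
    ContinuousWithinAt (fun z : ℝ × ℝ => u z.1 z.2) (Icc 0 L ×ˢ Icc 0 T) (L, 0)
  initial : ∀ x ∈ Icc 0 L, u x 0 = u₀ x
  boundary_left : ∀ t ∈ Ioc 0 T, u 0 t = g₁ t
  boundary_right : ∀ t ∈ Ioc 0 T, u L t = g₂ t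
  /-- On `0 < x < L`, `0 < t ≤ T` the derivatives `u_x`, `u_xx`, `u_t` (the last one one-sided at
  `t = T`) exist and are continuous, and the equation holds. -/
  equation : ∃ ux uxx ut : ℝ → ℝ → ℝ,
    ContinuousOn (fun z : ℝ × ℝ => ux z.1 z.2) (Ioo 0 L ×ˢ Ioc 0 T) ∧
    ContinuousOn (fun z : ℝ × ℝ => uxx z.1 z.2) (Ioo 0 L ×ˢ Ioc 0 T) ∧
    ContinuousOn (fun z : ℝ × ℝ => ut z.1 z.2) (Ioo 0 L ×ˢ Ioc 0 T) ∧
    ∀ x ∈ Ioo 0 L, ∀ t ∈ Ioc 0 T,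
      HasDerivAt (fun y => u y t) (ux x t) x ∧
      HasDerivAt (fun y => ux y t) (uxx x t) x ∧
      HasDerivWithinAt (fun s => u x s) (ut x t) (Icc 0 T) t ∧
      ut x t - ε * uxx x t + a * u x t
          + b * (∫ τ in (0 : ℝ)..t, Real.exp (-β * (t - τ)) * u x τ)
        = F x t (u x t) (ux x t)

open Filter Topology MeasureTheory BoundedContinuousFunction

/-! ### Comparison principle and uniqueness -/

/-! Uniqueness is a comparison argument. The difference `w` of two solutions satisfies `|w_t - ε
w_xx + a w + b ∫ e^{-β(t-τ)} w| ≤ B (|w| + |w_x|)`, vanishes initially and on the sides, and near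
the two corners is only known to be bounded. Let `z > 0` be a strict supersolution that dominates
`w` near the corners. At a first time with `|w| = z` one of `±w` touches `z` from below: the
gradients agree, the second space derivatives and the time derivatives are ordered, and the memory
term is at most `∫ z` because `|w| < z` earlier. This contradicts strictness (`no_first_touch`,
`abs_lt_of_strict_supersolution`). The choice is `z = e^{λt} (θ + A (H(x,t) + H(L-x,t)))` with `H`
the square root of a heat kernel started at time `-θ` and normalised at the origin. It is bounded
below on the boxes `x² ≤ θ`, `t ≤ θ`, which handles the corners, and it tends to `0` as `θ → 0` for
every fixed `t > 0`; hence `w = 0`.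

For existence write `u = U + v`. The function `U` solves the linear heat equation with the given
data: a Gaussian average of the extended initial values plus one double layer potential from each
side (`exists_isHeatSolution`). The two densities solve a coupled system that is a contraction,
since over the time `T` only a fraction `κ < 1` of the Gaussian mass of a layer reaches the opposite
side (`abs_dblLayer_le_mul`).

The correction `v` is the volume potential of a source `f` on the whole line, odd about `0` and
about `L`, so that `v` vanishes on both sides. On the strip `f` must equal `F(x,t,u,u_x) - a u - b ∫
e^{-β(t-τ)} u`. This is a fixed point problem for the pair `(v, v_x)`. The potentials producing `v`
and `v_x` have the integrable singularities `r^0` and `r^{-1/2}`, so in the norm weighted by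
`e^{-λt}` with `λ` large the map contracts on all of `(0, T]` (`abs_volPot_le_of_exp`,
`exists_mild_solution`). Boundedness of `F` keeps `f` bounded without any bound on `U_x` up to the
boundary.

It remains to see that `v` is a classical solution. A bounded source already makes `v_x` Hölder
continuous of exponent `1/2` in space (`abs_volPot_one_sub_le`). With the interior smoothness of `U`
and the Lipschitz hypotheses on `F`, the source is then locally Hölder in space
(`sourceTerm_holder`). Subtracting the value of the source at the centre reduces the singularity of
the second derivative of the kernel from `r^{-1}` to `r^{-3/4}`, so `v_xx` exists and is continuous.
The equation for `v_t` follows from a time-integrated identity obtained by Fubini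
(`volPot_sub_eq_integral`). -/

lemma IsLocalMax.second_deriv_nonpos {f f' : ℝ → ℝ} {x c : ℝ} (hmax : IsLocalMax f x)
    (h1 : ∀ᶠ y in 𝓝 x, HasDerivAt f (f' y) y) (h2 : HasDerivAt f' c x) : c ≤ 0 := by
  by_contra! hc
  have hd : deriv f =ᶠ[𝓝 x] f' := h1.mono fun y hy => hy.deriv
  have h0 : deriv f x = 0 := hmax.deriv_eq_zero
  have hdd : deriv (deriv f) x = c := by rw [hd.deriv_eq, h2.deriv]
  -- If `c > 0`, the second derivative test makes `x` a local minimum too. Then `f` is locally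
  -- constant and its second derivative is `0`.
  have hmin : IsLocalMin f x :=
    isLocalMin_of_deriv_deriv_pos (by rw [hdd]; exact hc) h0 h1.self_of_nhds.continuousAt
  have hconst : f =ᶠ[𝓝 x] fun _ => f x := by
    filter_upwards [hmax, hmin] with y h3 h4 using le_antisymm h3 h4
  have : deriv f =ᶠ[𝓝 x] fun _ => 0 := by
    have := hconst.deriv
    simpa using this
  have h5 : deriv (deriv f) x = 0 := by rw [this.deriv_eq]; simp
  linarith

/-- A subsolution cannot touch a strict supersolution from below for the first time. -/
lemma no_first_touch {ε a b β B T x t wx wxx wt zx zxx zt : ℝ} {w wx' z zx' : ℝ → ℝ → ℝ}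
    (hε : 0 < ε) (ha : 0 < a) (hb : 0 < b) (hβ : 0 < β) (ht : t ∈ Ioc 0 T)
    (hwx : ∀ᶠ y in 𝓝 x, HasDerivAt (fun y => w y t) (wx' y t) y) (hwx0 : wx' x t = wx)
    (hwxx : HasDerivAt (fun y => wx' y t) wxx x)
    (hwt : HasDerivWithinAt (fun s => w x s) wt (Icc 0 T) t)
    (hzx : ∀ y, HasDerivAt (fun y => z y t) (zx' y t) y) (hzx0 : zx' x t = zx)
    (hzxx : HasDerivAt (fun y => zx' y t) zxx x)
    (hzt : HasDerivWithinAt (fun s => z x s) zt (Icc 0 T) t)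
    (hzc : ContinuousOn (fun s => z x s) (Icc 0 t))
    (hz : 0 < z x t) (htouch : w x t = z x t)
    (hle : ∀ᶠ y in 𝓝 x, w y t ≤ z y t) (hlt : ∀ s ∈ Ico 0 t, |w x s| < z x s)
    (hw : |wt - ε * wxx + a * w x t + b * ∫ τ in (0 : ℝ)..t, Real.exp (-β * (t - τ)) * w x τ|
      ≤ B * (|w x t| + |wx|))
    (hstrict : B * (z x t + |zx|) + b * (∫ τ in (0 : ℝ)..t, z x τ) < zt - ε * zxx) : False := by
  have hmax : IsLocalMax (fun y => w y t - z y t) x := by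
    filter_upwards [hle] with y hy
    simp only [htouch]; linarith
  have hd : ∀ᶠ y in 𝓝 x, HasDerivAt (fun y => w y t - z y t) (wx' y t - zx' y t) y := by
    filter_upwards [hwx] with y hy using hy.sub (hzx y)
  have h1 : wx = zx := by
    have := hmax.hasDerivAt_eq_zero hd.self_of_nhds
    rw [hwx0, hzx0] at this; linarith
  have h2 : wxx - zxx ≤ 0 := hmax.second_deriv_nonpos hd (hwxx.sub hzxx)
  -- Only difference quotients from the left enter, so the one-sided derivative at `t = T` is
  -- enough.
  have h3 : zt ≤ wt := by
    have hdt : HasDerivWithinAt (fun s => w x s - z x s) (wt - zt) (Iio t) t := by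
      refine ((hwt.sub hzt).mono_of_mem_nhdsWithin ?_)
      have : Ioo 0 t ∈ 𝓝[<] t := Ioo_mem_nhdsLT ht.1
      filter_upwards [this] with s hs
      exact ⟨hs.1.le, hs.2.le.trans ht.2⟩
    rw [hasDerivWithinAt_iff_tendsto_slope' (by simp)] at hdt
    have : 0 ≤ wt - zt := by
      refine ge_of_tendsto hdt ?_
      filter_upwards [Ioo_mem_nhdsLT ht.1] with s hs
      rw [slope_def_field, htouch]
      have h4 := hlt s ⟨hs.1.le, hs.2⟩
      have h5 := le_abs_self (w x s)
      have h6 := hs.2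
      apply div_nonneg_of_nonpos <;> linarith
    linarith
  have h4 : |∫ τ in (0 : ℝ)..t, Real.exp (-β * (t - τ)) * w x τ| ≤ ∫ τ in (0 : ℝ)..t, z x τ := by
    rw [← Real.norm_eq_abs]
    refine intervalIntegral.norm_integral_le_of_norm_le ht.1.le ?_ ?_
    -- The strict inequality is available only before `t`; the endpoint `τ = t` is a null set.
    · filter_upwards [compl_mem_ae_iff.mpr (measure_singleton t)] with τ hτ hτ'
      have h5 := hlt τ ⟨hτ'.1.le, lt_of_le_of_ne hτ'.2 hτ⟩
      rw [norm_mul, Real.norm_eq_abs, Real.norm_eq_abs, Real.abs_exp]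
      have : Real.exp (-β * (t - τ)) ≤ 1 := by
        rw [Real.exp_le_one_iff]
        have := hτ'.2
        have : 0 ≤ β * (t - τ) := by apply mul_nonneg <;> linarith
        linarith
      calc _ ≤ 1 * |w x τ| := by gcongr
        _ ≤ _ := by linarith
    · exact (hzc.intervalIntegrable_of_Icc ht.1.le)
  rw [htouch, abs_of_pos hz, h1] at hw
  have h5 := (abs_le.mp hw).2
  have h6 := (abs_le.mp h4).1
  have h7 : b * (-∫ τ in (0 : ℝ)..t, z x τ) ≤
    b * ∫ τ in (0 : ℝ)..t, Real.exp (-β * (t - τ)) * w x τ := by gcongr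
  have h8 : ε * wxx ≤ ε * zxx := by gcongr; linarith
  have h9 : 0 < a * z x t := by positivity
  linarith

/-- Comparison with a strict supersolution `z` on a rectangle from which small neighbourhoods of
the corners have been removed. -/
lemma abs_lt_of_strict_supersolution {ε a b β B L T : ℝ} {w wx wxx wt z zx zxx zt : ℝ → ℝ → ℝ}
    {Q : Set (ℝ × ℝ)} (hε : 0 < ε) (ha : 0 < a) (hb : 0 < b) (hβ : 0 < β)
    (hQ : IsCompact Q) (hQs : Q ⊆ Icc 0 L ×ˢ Icc 0 T)
    (hwQ : ContinuousOn (fun q : ℝ × ℝ => w q.1 q.2) Q)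
    (hwd : ∀ x ∈ Ioo 0 L, ∀ t ∈ Ioc 0 T, HasDerivAt (fun y => w y t) (wx x t) x ∧
      HasDerivAt (fun y => wx y t) (wxx x t) x ∧
      HasDerivWithinAt (fun s => w x s) (wt x t) (Icc 0 T) t ∧
      |wt x t - ε * wxx x t + a * w x t
        + b * ∫ τ in (0 : ℝ)..t, Real.exp (-β * (t - τ)) * w x τ| ≤ B * (|w x t| + |wx x t|))
    (hzc : ContinuousOn (fun q : ℝ × ℝ => z q.1 q.2) (Icc 0 L ×ˢ Icc 0 T))
    (hzx : ∀ x t, 0 ≤ t → HasDerivAt (fun y => z y t) (zx x t) x)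
    (hzxx : ∀ x t, 0 ≤ t → HasDerivAt (fun y => zx y t) (zxx x t) x)
    (hzt : ∀ x t, 0 ≤ t → HasDerivAt (fun s => z x s) (zt x t) t)
    (hzpos : ∀ x t, 0 ≤ t → 0 < z x t)
    (hstrict : ∀ x t, 0 ≤ t → t ≤ T → B * (z x t + |zx x t|) + b * (∫ τ in (0 : ℝ)..t, z x τ)
      < zt x t - ε * zxx x t)
    (hout : ∀ x ∈ Icc 0 L, ∀ t ∈ Icc 0 T, (x, t) ∉ Q → |w x t| < z x t)
    (hbd : ∀ x ∈ Icc 0 L, ∀ t ∈ Icc 0 T, t = 0 ∨ x = 0 ∨ x = L → |w x t| < z x t) :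
    ∀ x ∈ Icc 0 L, ∀ t ∈ Icc 0 T, |w x t| < z x t := by
  by_contra! hcon
  obtain ⟨x₀, hx₀, t₀, ht₀, h0⟩ := hcon
  set S : Set (ℝ × ℝ) := {q | q ∈ Q ∧ (0:ℝ) ≤ |w q.1 q.2| - z q.1 q.2} with hS
  have hSc : IsCompact S := by
    have hcl : IsClosed S := by
      have hc : ContinuousOn (fun q : ℝ × ℝ => |w q.1 q.2| - z q.1 q.2) Q :=
        hwQ.abs.sub (hzc.mono hQs)
      exact hc.preimage_isClosed_of_isClosed hQ.isClosed isClosed_Ici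
    exact hQ.of_isClosed_subset hcl fun q hq => hq.1
  have hSne : S.Nonempty := by
    refine ⟨(x₀, t₀), ?_, by simpa using h0⟩
    by_contra hq
    exact absurd (hout x₀ hx₀ t₀ ht₀ hq) (not_lt.mpr h0)
  obtain ⟨⟨x, t⟩, hqS, hmin⟩ := hSc.exists_isMinOn hSne continuous_snd.continuousOn
  have hxt := hQs hqS.1
  have hx : x ∈ Icc 0 L := hxt.1
  have ht : t ∈ Icc 0 T := hxt.2
  have hge : z x t ≤ |w x t| := by have := hqS.2; simp only at this; linarith
  have hbefore : ∀ y ∈ Icc 0 L, ∀ s ∈ Icc 0 T, s < t → |w y s| < z y s := by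
    intro y hy s hs hst
    by_contra! hc
    by_cases hq : (y, s) ∈ Q
    · have : (y, s) ∈ S := ⟨hq, by simpa using hc⟩
      have := hmin this
      simp only [mem_ofPred_eq] at this
      linarith
    · exact absurd (hout y hy s hs hq) (not_lt.mpr hc)
  have hnb : ¬(t = 0 ∨ x = 0 ∨ x = L) := fun h => absurd (hbd x hx t ht h) (not_lt.mpr hge)
  push Not at hnb
  have hxI : x ∈ Ioo 0 L :=
    ⟨lt_of_le_of_ne hx.1 (Ne.symm hnb.2.1), lt_of_le_of_ne hx.2 hnb.2.2⟩
  have htI : t ∈ Ioc 0 T := ⟨lt_of_le_of_ne ht.1 (Ne.symm hnb.1), ht.2⟩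
  -- Pass to the limit `s ↑ t` in the strict inequality. Differentiability in time supplies the
  -- continuity, since points `(y, t)` need not lie in `Q`.
  have hle : ∀ y ∈ Ioo 0 L, |w y t| ≤ z y t := by
    intro y hy
    have h1 : Tendsto (fun s => |w y s|) (𝓝[<] t) (𝓝 |w y t|) := by
      have := (hwd y hy t htI).2.2.1.continuousWithinAt.abs
      refine this.tendsto.mono_left ?_
      refine nhdsWithin_le_of_mem ?_
      filter_upwards [Ioo_mem_nhdsLT htI.1] with s hs using ⟨hs.1.le, hs.2.le.trans ht.2⟩
    have h2 : Tendsto (fun s => z y s) (𝓝[<] t) (𝓝 (z y t)) :=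
      (hzt y t ht.1).continuousAt.tendsto.mono_left nhdsWithin_le_nhds
    refine le_of_tendsto_of_tendsto h1 h2 ?_
    filter_upwards [Ioo_mem_nhdsLT htI.1] with s hs
    exact (hbefore y ⟨hy.1.le, hy.2.le⟩ s ⟨hs.1.le, hs.2.le.trans ht.2⟩ hs.2).le
  have heq : |w x t| = z x t := le_antisymm (hle x hxI) hge
  have hnear : ∀ᶠ y in 𝓝 x, y ∈ Ioo 0 L := Ioo_mem_nhds hxI.1 hxI.2
  have hbx : ∀ s ∈ Ico 0 t, |w x s| < z x s := fun s hs =>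
    hbefore x hx s ⟨hs.1, hs.2.le.trans ht.2⟩ hs.2
  have hzcx : ContinuousOn (fun s => z x s) (Icc 0 t) := fun s hs =>
    (hzt x s hs.1).continuousAt.continuousWithinAt
  obtain ⟨e1, e2, e3, e4⟩ := hwd x hxI t htI
  rcases abs_choice (w x t) with hc | hc
  · refine no_first_touch (wx' := wx) (z := z) (zx' := zx) hε ha hb hβ htI
      (hnear.mono fun y hy => (hwd y hy t htI).1) rfl e2 e3 (fun y => hzx y t ht.1) rfl
      (hzxx x t ht.1) (hzt x t ht.1).hasDerivWithinAt hzcx (hzpos x t ht.1) (hc ▸ heq)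
      (hnear.mono fun y hy => (le_abs_self _).trans (hle y hy)) hbx e4 (hstrict x t ht.1 ht.2)
  -- The differential inequality is symmetric in sign, so contact of `w` with `-z` is contact of
  -- `-w` with `z`.
  · refine no_first_touch (w := fun x t => -w x t) (wx' := fun x t => - wx x t) (z := z)
      (zx' := zx) hε ha hb hβ htI
      (hnear.mono fun y hy => (hwd y hy t htI).1.neg) rfl e2.neg e3.neg (fun y => hzx y t ht.1) rfl
      (hzxx x t ht.1) (hzt x t ht.1).hasDerivWithinAt hzcx (hzpos x t ht.1) (hc ▸ heq)
      (hnear.mono fun y hy => (neg_le_abs _).trans (hle y hy)) (by simpa using hbx) ?_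
      (hstrict x t ht.1 ht.2)
    have : ∀ A I : ℝ, -(wt x t) - ε * -(wxx x t) + a * -(w x t) + b * (-I)
        = -(wt x t - ε * wxx x t + a * w x t + b * I) := by intros; ring
    simp only [mul_neg, intervalIntegral.integral_neg, abs_neg]
    convert e4 using 1
    rw [← abs_neg]
    congr 1
    ring

/-- A supersolution concentrated near the corner `(0, 0)` at the scale `√θ`. -/
noncomputable def cornerBarrier (ε θ x t : ℝ) : ℝ :=
  (θ / (t + θ)) ^ (1 / 4 : ℝ) * Real.exp (-(x ^ 2 / (8 * ε * (t + θ))))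

lemma cornerBarrier_pos {ε θ : ℝ} (hθ : 0 < θ) (x : ℝ) {t : ℝ} (ht : 0 ≤ t) :
    0 < cornerBarrier ε θ x t := by
  unfold cornerBarrier; positivity

lemma hasDerivAt_cornerBarrier_space {ε θ : ℝ} (x t : ℝ) :
    HasDerivAt (fun y => cornerBarrier ε θ y t)
      (-(x / (4 * ε * (t + θ))) * cornerBarrier ε θ x t) x := by
  unfold cornerBarrier
  have h := (((((hasDerivAt_id x).pow 2).div_const (8 * ε * (t + θ))).neg).exp).const_mul
    ((θ / (t + θ)) ^ (1 / 4 : ℝ))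
  refine h.congr_deriv ?_
  simp only [id, Nat.cast_ofNat, Pi.neg_apply, Pi.pow_apply]
  have : 2 * x ^ (2 - 1) * 1 / (8 * ε * (t + θ)) = x / (4 * ε * (t + θ)) := by
    rw [show 2 * x ^ (2 - 1) * 1 = 2 * x by norm_num,
      show 8 * ε * (t + θ) = 2 * (4 * ε * (t + θ)) by ring, mul_div_mul_left _ _ two_ne_zero]
  rw [this]
  ring

lemma hasDerivAt_cornerBarrier_space_space {ε θ : ℝ} (x t : ℝ) :
    HasDerivAt (fun y => -(y / (4 * ε * (t + θ))) * cornerBarrier ε θ y t)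
      (((x / (4 * ε * (t + θ))) ^ 2 - 1 / (4 * ε * (t + θ))) * cornerBarrier ε θ x t) x := by
  have h := (((hasDerivAt_id x).div_const (4 * ε * (t + θ))).neg).mul
    (hasDerivAt_cornerBarrier_space (ε := ε) (θ := θ) x t)
  refine h.congr_deriv ?_
  simp only [id, Pi.neg_apply]
  ring

lemma hasDerivAt_cornerBarrier_time {ε θ : ℝ} (hε : 0 < ε) (hθ : 0 < θ) (x : ℝ) {t : ℝ}
    (ht : 0 ≤ t) :
    HasDerivAt (fun s => cornerBarrier ε θ x s)
      ((-(1 / (4 * (t + θ))) + x ^ 2 / (8 * ε * (t + θ) ^ 2)) * cornerBarrier ε θ x t) t := by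
  have hs : 0 < t + θ := by linarith
  have h1 : HasDerivAt (fun s => s + θ) 1 t := (hasDerivAt_id t).add_const θ
  have h2 : HasDerivAt (fun s => θ / (s + θ)) (-θ / (t + θ) ^ 2) t := by
    have := (hasDerivAt_const t θ).div h1 hs.ne'
    exact this.congr_deriv (by ring)
  have h3 := h2.rpow_const (p := (1 / 4 : ℝ)) (Or.inl (by positivity))
  have h4 : HasDerivAt (fun s => -(x ^ 2 / (8 * ε * (s + θ)))) (x ^ 2 / (8 * ε * (t + θ) ^ 2)) t := by
    have := ((hasDerivAt_const t (x ^ 2)).div (h1.const_mul (8 * ε)) (by positivity)).neg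
    refine this.congr_deriv ?_
    field_simp; ring
  have h5 := h3.mul h4.exp
  unfold cornerBarrier
  refine h5.congr_deriv ?_
  rw [Real.rpow_sub_one (by positivity)]
  field_simp

/-- The right side, as a function of time, has derivative `H` plus a nonnegative term: `(s +
θ)^{-1/4}` integrates to `(4/3)(s + θ)^{3/4}`, and the exponential factor increases with time. The
memory of the barrier is thus a multiple of its current value. -/
lemma integral_cornerBarrier_le {ε θ : ℝ} (hε : 0 < ε) (hθ : 0 < θ) (x : ℝ) {t : ℝ}
    (ht : 0 ≤ t) :
    ∫ τ in (0 : ℝ)..t, cornerBarrier ε θ x τ ≤ 4 / 3 * (t + θ) * cornerBarrier ε θ x t := by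
  have hder : ∀ s ∈ uIcc 0 t, HasDerivAt (fun s => 4 / 3 * (s + θ) * cornerBarrier ε θ x s)
      (cornerBarrier ε θ x s + 4 / 3 * (x ^ 2 / (8 * ε * (s + θ))) * cornerBarrier ε θ x s) s := by
    intro s hs
    rw [uIcc_of_le ht] at hs
    have hs' : 0 < s + θ := by linarith [hs.1]
    have := ((((hasDerivAt_id s).add_const θ).const_mul (4 / 3 : ℝ))).mul
      (hasDerivAt_cornerBarrier_time hε hθ x hs.1)
    refine this.congr_deriv ?_
    simp only [id]
    field_simp
    ring
  have hc0 : ContinuousOn (fun s => cornerBarrier ε θ x s) (Icc 0 t) := fun s hs =>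
    (hasDerivAt_cornerBarrier_time hε hθ x hs.1).continuousAt.continuousWithinAt
  have hc1 : ContinuousOn (fun s => cornerBarrier ε θ x s
      + 4 / 3 * (x ^ 2 / (8 * ε * (s + θ))) * cornerBarrier ε θ x s) (Icc 0 t) := by
    refine hc0.add (ContinuousOn.mul ?_ hc0)
    refine ContinuousOn.mul continuousOn_const (ContinuousOn.div continuousOn_const (by fun_prop) ?_)
    intro s hs
    have hs' : 0 < s + θ := by linarith [hs.1]
    positivity
  have hI := intervalIntegral.integral_eq_sub_of_hasDerivAt hder
    (hc1.intervalIntegrable_of_Icc ht)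
  have h0 := cornerBarrier_pos (ε := ε) hθ x le_rfl
  calc ∫ τ in (0 : ℝ)..t, cornerBarrier ε θ x τ
      ≤ ∫ s in (0 : ℝ)..t, (cornerBarrier ε θ x s
        + 4 / 3 * (x ^ 2 / (8 * ε * (s + θ))) * cornerBarrier ε θ x s) := by
        refine intervalIntegral.integral_mono_on ht (hc0.intervalIntegrable_of_Icc ht)
          (hc1.intervalIntegrable_of_Icc ht) fun s hs => ?_
        have hs' : 0 < s + θ := by linarith [hs.1]
        have := cornerBarrier_pos (ε := ε) hθ x hs.1
        have : 0 ≤ 4 / 3 * (x ^ 2 / (8 * ε * (s + θ))) * cornerBarrier ε θ x s := by positivity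
        linarith
    _ = _ := hI
    _ ≤ _ := by
        have : 0 ≤ 4 / 3 * (0 + θ) * cornerBarrier ε θ x 0 := by positivity
        linarith

/-- As the square root of a solution of the heat equation, `H` satisfies `H_t - ε H_xx = ε H_x² /
H`. This surplus absorbs the gradient term through `B |H_x| ≤ ε H_x² / H + B² / (4 ε) H`; the
deficit is the square displayed in the proof. -/
lemma cornerBarrier_supersolution {ε θ B b T : ℝ} (hε : 0 < ε) (hθ : 0 < θ) (hθ1 : θ ≤ 1)
    (hb : 0 < b) (x : ℝ) {t : ℝ} (ht : 0 ≤ t) (htT : t ≤ T) :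
    B * |(-(x / (4 * ε * (t + θ))) * cornerBarrier ε θ x t)|
      + b * ∫ τ in (0 : ℝ)..t, cornerBarrier ε θ x τ ≤
    (B ^ 2 / (4 * ε) + 4 / 3 * b * (T + 1)) * cornerBarrier ε θ x t
      + (-(1 / (4 * (t + θ))) + x ^ 2 / (8 * ε * (t + θ) ^ 2)) * cornerBarrier ε θ x t
      - ε * (((x / (4 * ε * (t + θ))) ^ 2 - 1 / (4 * ε * (t + θ))) * cornerBarrier ε θ x t) := by
  have hs : 0 < t + θ := by linarith
  have hH := cornerBarrier_pos (ε := ε) hθ x ht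
  have hI := integral_cornerBarrier_le hε hθ x ht
  set H := cornerBarrier ε θ x t
  have h1 : b * ∫ τ in (0 : ℝ)..t, cornerBarrier ε θ x τ ≤ 4 / 3 * b * (T + 1) * H := by
    calc _ ≤ b * (4 / 3 * (t + θ) * H) := by gcongr
      _ = 4 / 3 * b * (t + θ) * H := by ring
      _ ≤ _ := by gcongr
  have h2 : B * |(-(x / (4 * ε * (t + θ))) * H)| = B * |x| / (4 * ε * (t + θ)) * H := by
    rw [abs_mul, abs_neg, abs_div, abs_of_pos hH, abs_of_pos (by positivity : 0 < 4 * ε * (t + θ))]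
    ring
  have h3 : B * |x| / (4 * ε * (t + θ)) ≤ B ^ 2 / (4 * ε) + -(1 / (4 * (t + θ)))
      + x ^ 2 / (8 * ε * (t + θ) ^ 2)
      - ε * ((x / (4 * ε * (t + θ))) ^ 2 - 1 / (4 * ε * (t + θ))) := by
    have : B ^ 2 / (4 * ε) + -(1 / (4 * (t + θ))) + x ^ 2 / (8 * ε * (t + θ) ^ 2)
      - ε * ((x / (4 * ε * (t + θ))) ^ 2 - 1 / (4 * ε * (t + θ))) - B * |x| / (4 * ε * (t + θ))
      = (|x| / (t + θ) - 2 * B) ^ 2 / (16 * ε) := by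
      field_simp
      rw [← sq_abs x]
      ring
    have h4 : 0 ≤ (|x| / (t + θ) - 2 * B) ^ 2 / (16 * ε) := by positivity
    linarith
  rw [h2]
  have h5 := mul_le_mul_of_nonneg_right h3 hH.le
  linarith

/-- On this box both `t / θ` and `x² / θ` are at most `1`, so the bound depends on `ε` only and not
on the scale `θ`. This lets the amplitude `A` stay fixed while `θ → 0`. -/
lemma cornerBarrier_lower_bound {ε θ x t : ℝ} (hε : 0 < ε) (hθ : 0 < θ) (ht : 0 ≤ t)
    (htθ : t ≤ θ) (hx : x ^ 2 ≤ θ) :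
    1 ≤ 2 * Real.exp (1 / (8 * ε)) * cornerBarrier ε θ x t := by
  have hs : 0 < t + θ := by linarith
  have h1 : (1 / 2 : ℝ) ≤ (θ / (t + θ)) ^ (1 / 4 : ℝ) := by
    have h2 : (1 / 2 : ℝ) ≤ θ / (t + θ) := by rw [le_div_iff₀ hs]; linarith
    calc (1 / 2 : ℝ) = (1 / 2 : ℝ) ^ (1 : ℝ) := by simp
      _ ≤ (1 / 2 : ℝ) ^ (1 / 4 : ℝ) :=
        Real.rpow_le_rpow_of_exponent_ge (by norm_num) (by norm_num) (by norm_num)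
      _ ≤ _ := Real.rpow_le_rpow (by norm_num) h2 (by norm_num)
  have h2 : 1 ≤ Real.exp (1 / (8 * ε)) * Real.exp (-(x ^ 2 / (8 * ε * (t + θ)))) := by
    rw [← Real.exp_add, Real.one_le_exp_iff]
    have : x ^ 2 / (8 * ε * (t + θ)) ≤ 1 / (8 * ε) := by
      rw [div_le_div_iff₀ (by positivity) (by positivity)]
      have : x ^ 2 ≤ t + θ := by linarith
      nlinarith
    linarith
  unfold cornerBarrier
  calc (1 : ℝ) = 2 * (1 / 2) * 1 := by norm_num
    _ ≤ 2 * (θ / (t + θ)) ^ (1 / 4 : ℝ)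
      * (Real.exp (1 / (8 * ε)) * Real.exp (-(x ^ 2 / (8 * ε * (t + θ))))) := by gcongr
    _ = _ := by ring

/-- The global strict supersolution used for uniqueness. -/
noncomputable def barrier (ε L A lam θ x t : ℝ) : ℝ :=
  Real.exp (lam * t) * (θ + A * (cornerBarrier ε θ x t + cornerBarrier ε θ (L - x) t))

/-- The factor `(θ / (t + θ))^{1/4}` decays in `θ` at fixed positive time, although the barrier
keeps a fixed size near the corners. -/
lemma tendsto_barrier_zero {ε L A lam x t : ℝ} (hε : 0 < ε) (hA : 0 ≤ A) (ht : 0 < t) :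
    Tendsto (fun θ => barrier ε L A lam θ x t) (𝓝[>] 0) (𝓝 0) := by
  have hb : ∀ y, Tendsto (fun θ => cornerBarrier ε θ y t) (𝓝[>] 0) (𝓝 0) := by
    intro y
    have h1 : Tendsto (fun θ : ℝ => (θ / t) ^ (1 / 4 : ℝ)) (𝓝[>] 0) (𝓝 0) := by
      have : ContinuousAt (fun θ : ℝ => (θ / t) ^ (1 / 4 : ℝ)) 0 :=
        (continuousAt_id.div_const t).rpow_const (Or.inr (by norm_num))
      have h2 := this.tendsto
      simp only [zero_div] at h2
      rw [Real.zero_rpow (by norm_num)] at h2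
      exact h2.mono_left nhdsWithin_le_nhds
    refine squeeze_zero' ?_ ?_ h1
    · filter_upwards [self_mem_nhdsWithin] with θ hθ
      exact (cornerBarrier_pos hθ y ht.le).le
    · filter_upwards [self_mem_nhdsWithin] with θ hθ
      have hθ' : 0 < θ := hθ
      unfold cornerBarrier
      have h3 : Real.exp (-(y ^ 2 / (8 * ε * (t + θ)))) ≤ 1 := by
        rw [Real.exp_le_one_iff]
        have : 0 ≤ y ^ 2 / (8 * ε * (t + θ)) := by positivity
        linarith
      calc (θ / (t + θ)) ^ (1 / 4 : ℝ) * Real.exp (-(y ^ 2 / (8 * ε * (t + θ))))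
          ≤ (θ / t) ^ (1 / 4 : ℝ) * 1 := by
            gcongr
            linarith
        _ = _ := mul_one _
  have h0 : Tendsto (fun θ : ℝ => θ) (𝓝[>] 0) (𝓝 0) := nhdsWithin_le_nhds
  have := (h0.add (((hb x).add (hb (L - x))).const_mul A)).const_mul (Real.exp (lam * t))
  simpa [barrier] using this

/-- In the lower bound for `lam`, `B² / (4 ε) + 4/3 b (T + 1)` pays for the gradient and memory of
the corner barriers, `B` for the zero-order term, `b T` for the memory of the constant `θ`, and `1`
makes the inequality strict. -/
lemma barrier_strict_supersolution {ε b L A lam θ B T : ℝ} (hε : 0 < ε) (hθ : 0 < θ)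
    (hθ1 : θ ≤ 1) (hB : 0 ≤ B) (hb : 0 < b) (hA : 0 ≤ A)
    (hlam : B ^ 2 / (4 * ε) + 4 / 3 * b * (T + 1) + B + b * T + 1 ≤ lam) :
    ∃ zx zxx zt : ℝ → ℝ → ℝ,
    (∀ x t, 0 ≤ t → HasDerivAt (fun y => barrier ε L A lam θ y t) (zx x t) x) ∧
    (∀ x t, 0 ≤ t → HasDerivAt (fun y => zx y t) (zxx x t) x) ∧
    (∀ x t, 0 ≤ t → HasDerivAt (fun s => barrier ε L A lam θ x s) (zt x t) t) ∧
    (∀ x t, 0 ≤ t → t ≤ T → B * (barrier ε L A lam θ x t + |zx x t|)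
      + b * (∫ τ in (0 : ℝ)..t, barrier ε L A lam θ x τ) < zt x t - ε * zxx x t) := by
  set H := cornerBarrier ε θ with hH
  set H1 : ℝ → ℝ → ℝ := fun x t => -(x / (4 * ε * (t + θ))) * H x t with hH1
  set H2 : ℝ → ℝ → ℝ :=
    fun x t => ((x / (4 * ε * (t + θ))) ^ 2 - 1 / (4 * ε * (t + θ))) * H x t with hH2
  set Ht : ℝ → ℝ → ℝ :=
    fun x t => (-(1 / (4 * (t + θ))) + x ^ 2 / (8 * ε * (t + θ) ^ 2)) * H x t with hHt
  have d1 : ∀ x t, HasDerivAt (fun y => H y t) (H1 x t) x := fun x t =>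
    hasDerivAt_cornerBarrier_space x t
  have d2 : ∀ x t, HasDerivAt (fun y => H1 y t) (H2 x t) x := fun x t =>
    hasDerivAt_cornerBarrier_space_space x t
  have dt : ∀ x t, 0 ≤ t → HasDerivAt (fun s => H x s) (Ht x t) t := fun x t ht =>
    hasDerivAt_cornerBarrier_time hε hθ x ht
  have hrefl : ∀ x : ℝ, HasDerivAt (fun y => L - y) (-1) x := fun x => by
    simpa using (hasDerivAt_id x).const_sub L
  have d1' : ∀ x t, HasDerivAt (fun y => H (L - y) t) (-H1 (L - x) t) x := fun x t =>
    ((d1 (L - x) t).comp x (hrefl x)).congr_deriv (by ring)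
  have d2' : ∀ x t, HasDerivAt (fun y => H1 (L - y) t) (-H2 (L - x) t) x := fun x t =>
    ((d2 (L - x) t).comp x (hrefl x)).congr_deriv (by ring)
  refine ⟨fun x t => Real.exp (lam * t) * (A * (H1 x t - H1 (L - x) t)),
    fun x t => Real.exp (lam * t) * (A * (H2 x t + H2 (L - x) t)),
    fun x t => lam * barrier ε L A lam θ x t
      + Real.exp (lam * t) * (A * (Ht x t + Ht (L - x) t)), ?_, ?_, ?_, ?_⟩
  · intro x t _
    have := (((((d1 x t).add (d1' x t)).const_mul A).const_add θ)).const_mul (Real.exp (lam * t))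
    exact this.congr_deriv (by ring)
  · intro x t _
    have := (((d2 x t).sub (d2' x t)).const_mul A).const_mul (Real.exp (lam * t))
    exact this.congr_deriv (by ring)
  · intro x t ht
    have he : HasDerivAt (fun s => Real.exp (lam * s)) (Real.exp (lam * t) * lam) t := by
      simpa using ((hasDerivAt_id t).const_mul lam).exp
    have := he.mul ((((dt x t ht).add (dt (L - x) t ht)).const_mul A).const_add θ)
    refine this.congr_deriv ?_
    simp only [barrier, Pi.add_apply]
    ring
  · intro x t ht htT
    have hc : ∀ y, ContinuousOn (fun s => H y s) (Icc 0 t) := fun y s hs =>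
      (dt y s hs.1).continuousAt.continuousWithinAt
    have hlam0 : 0 ≤ lam := by
      have : 0 ≤ T := ht.trans htT
      have : 0 ≤ B ^ 2 / (4 * ε) + 4 / 3 * b * (T + 1) + B + b * T + 1 := by positivity
      linarith
    have i1 := (hc x).intervalIntegrable_of_Icc (μ := volume) ht
    have i2 := (hc (L - x)).intervalIntegrable_of_Icc (μ := volume) ht
    -- The exponential weight is frozen at its largest value `e^{lam t}`, which reduces the memory
    -- of the barrier to that of the bare `H`.
    have hint : ∫ τ in (0 : ℝ)..t, barrier ε L A lam θ x τ ≤ Real.exp (lam * t) * (t * θ +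
        A * ((∫ τ in (0 : ℝ)..t, H x τ) + ∫ τ in (0 : ℝ)..t, H (L - x) τ)) := by
      have e1 : Real.exp (lam * t) * (t * θ +
        A * ((∫ τ in (0 : ℝ)..t, H x τ) + ∫ τ in (0 : ℝ)..t, H (L - x) τ)) =
        ∫ τ in (0 : ℝ)..t, Real.exp (lam * t) * (θ + A * (H x τ + H (L - x) τ)) := by
        have i0 : IntervalIntegrable (fun _ => θ) volume 0 t := intervalIntegrable_const
        rw [intervalIntegral.integral_const_mul, intervalIntegral.integral_add i0
          ((i1.add i2).const_mul A), intervalIntegral.integral_const_mul,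
          intervalIntegral.integral_add i1 i2]
        simp
      rw [e1]
      have hcz : ContinuousOn (fun s => θ + A * (H x s + H (L - x) s)) (Icc 0 t) :=
        continuousOn_const.add (continuousOn_const.mul ((hc x).add (hc (L - x))))
      refine intervalIntegral.integral_mono_on ht
        ((ContinuousOn.mul (by fun_prop) hcz).intervalIntegrable_of_Icc ht)
        ((ContinuousOn.mul (by fun_prop) hcz).intervalIntegrable_of_Icc ht) fun s hs => ?_
      have p1 := cornerBarrier_pos (ε := ε) hθ x hs.1
      have p2 := cornerBarrier_pos (ε := ε) hθ (L - x) hs.1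
      have := hs.2
      unfold barrier
      gcongr
    have s1 := cornerBarrier_supersolution hε hθ hθ1 hb x ht htT (B := B)
    have s2 := cornerBarrier_supersolution hε hθ hθ1 hb (L - x) ht htT (B := B)
    rw [← hH] at s1 s2
    set E := Real.exp (lam * t) with hE
    have hEpos : 0 < E := Real.exp_pos _
    have p1 : 0 < H x t := cornerBarrier_pos hθ x ht
    have p2 : 0 < H (L - x) t := cornerBarrier_pos hθ (L - x) ht
    set I1 := ∫ τ in (0 : ℝ)..t, H x τ
    set I2 := ∫ τ in (0 : ℝ)..t, H (L - x) τ
    have s1' : B * |H1 x t| + b * I1 ≤ (B ^ 2 / (4 * ε) + 4 / 3 * b * (T + 1)) * H x t + Ht x t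
      - ε * H2 x t := s1
    have s2' : B * |H1 (L - x) t| + b * I2 ≤ (B ^ 2 / (4 * ε) + 4 / 3 * b * (T + 1)) * H (L - x) t
      + Ht (L - x) t - ε * H2 (L - x) t := s2
    have habs : |E * (A * (H1 x t - H1 (L - x) t))| ≤ E * (A * (|H1 x t| + |H1 (L - x) t|)) := by
      rw [abs_mul, abs_mul, abs_of_pos hEpos, abs_of_nonneg hA]
      gcongr
      exact abs_sub _ _
    have hz : barrier ε L A lam θ x t = E * (θ + A * (H x t + H (L - x) t)) := rfl
    have q1 : B * (barrier ε L A lam θ x t + |E * (A * (H1 x t - H1 (L - x) t))|)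
      + b * (∫ τ in (0 : ℝ)..t, barrier ε L A lam θ x τ) ≤
      B * (E * (θ + A * (H x t + H (L - x) t)) + E * (A * (|H1 x t| + |H1 (L - x) t|)))
      + b * (E * (t * θ + A * (I1 + I2))) := by
      rw [hz]
      gcongr
    refine q1.trans_lt ?_
    have q2 : E * (A * ((B * |H1 x t| + b * I1) + (B * |H1 (L - x) t| + b * I2))) ≤
       E * (A * (((B ^ 2 / (4 * ε) + 4 / 3 * b * (T + 1)) * H x t + Ht x t
      - ε * H2 x t) + ((B ^ 2 / (4 * ε) + 4 / 3 * b * (T + 1)) * H (L - x) t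
      + Ht (L - x) t - ε * H2 (L - x) t))) := by
      gcongr
    have hT0 : 0 ≤ T := ht.trans htT
    have q3 : 0 ≤ (lam - (B ^ 2 / (4 * ε) + 4 / 3 * b * (T + 1)) - B)
      * (E * (A * (H x t + H (L - x) t))) := by
      refine mul_nonneg ?_ (by positivity)
      have : 0 ≤ b * T := by positivity
      linarith
    have q4 : 0 < (lam - B - b * t) * (E * θ) := by
      refine mul_pos ?_ (by positivity)
      have : b * t ≤ b * T := by gcongr
      have : 0 ≤ B ^ 2 / (4 * ε) + 4 / 3 * b * (T + 1) := by positivity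
      linarith
    beta_reduce
    rw [hz]
    linarith

theorem IsRegularSolution.eq {ε a b β L T : ℝ} (hε : 0 < ε) (ha : 0 < a) (hb : 0 < b)
    (hβ : 0 < β) (hL : 0 < L) (hT : 0 < T) {F : ℝ → ℝ → ℝ → ℝ → ℝ} (hF : HypothesesA L T F)
    {u₀ g₁ g₂ : ℝ → ℝ} {u v : ℝ → ℝ → ℝ} (hu : IsRegularSolution ε a b β L T F u₀ g₁ g₂ u)
    (hv : IsRegularSolution ε a b β L T F u₀ g₁ g₂ v) :
    ∀ x ∈ Icc 0 L, ∀ t ∈ Icc 0 T, v x t = u x t := by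
  obtain ⟨βF, hβF⟩ := hF.lipschitz_up
  obtain ⟨ux, uxx, ut, -, -, -, hude⟩ := hu.equation
  obtain ⟨vx, vxx, vt, -, -, -, hvde⟩ := hv.equation
  obtain ⟨Mu, hMu⟩ := hu.bounded
  obtain ⟨Mv, hMv⟩ := hv.bounded
  set B := |βF| with hBdef
  set lam := B ^ 2 / (4 * ε) + 4 / 3 * b * (T + 1) + B + b * T + 1 with hlam
  have hMu0 : 0 ≤ Mu := (abs_nonneg _).trans (hMu 0 ⟨le_rfl, hL.le⟩ T ⟨hT, le_rfl⟩)
  have hMv0 : 0 ≤ Mv := (abs_nonneg _).trans (hMv 0 ⟨le_rfl, hL.le⟩ T ⟨hT, le_rfl⟩)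
  -- Chosen so that `A` times a corner barrier exceeds the a priori bound for `|w|` on the box of
  -- `cornerBarrier_lower_bound`.
  set A := (Mu + Mv) * (2 * Real.exp (1 / (8 * ε))) with hAdef
  have hA : 0 ≤ A := by positivity
  set w : ℝ → ℝ → ℝ := fun x t => v x t - u x t with hw
  have hw0 : ∀ x ∈ Icc 0 L, w x 0 = 0 := fun x hx => by
    simp [hw, hu.initial x hx, hv.initial x hx]
  have hMw : ∀ x ∈ Icc 0 L, ∀ t ∈ Icc 0 T, |w x t| ≤ Mu + Mv := by
    intro x hx t ht
    rcases ht.1.eq_or_lt with h | h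
    · rw [← h, hw0 x hx, abs_zero]; positivity
    · have h1 := hMu x hx t ⟨h, ht.2⟩
      have h2 := hMv x hx t ⟨h, ht.2⟩
      have := abs_sub (v x t) (u x t)
      simp only [hw]
      linarith
  have key : ∀ θ : ℝ, 0 < θ → θ ≤ 1 → ∀ x ∈ Icc 0 L, ∀ t ∈ Icc 0 T,
      |w x t| < barrier ε L A lam θ x t := by
    intro θ hθ hθ1
    obtain ⟨zx, zxx, zt, hzx, hzxx, hzt, hstrict⟩ :=
      barrier_strict_supersolution (L := L) (T := T) hε hθ hθ1 (abs_nonneg βF) hb hA hlam.ge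
    have hzpos : ∀ x t, 0 ≤ t → 0 < barrier ε L A lam θ x t := by
      intro x t ht
      have p1 := cornerBarrier_pos (ε := ε) hθ x ht
      have p2 := cornerBarrier_pos (ε := ε) hθ (L - x) ht
      unfold barrier; positivity
    -- The rectangle without the boxes `x² < θ`, `t < θ` at the two corners: compact, and free of
    -- the points where `w` may be discontinuous.
    set Q : Set (ℝ × ℝ) := (Icc 0 L ×ˢ Icc 0 T) ∩ ({q | θ ≤ q.1 ^ 2} ∪ {q | θ ≤ q.2})
      ∩ ({q | θ ≤ (L - q.1) ^ 2} ∪ {q | θ ≤ q.2}) with hQdef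
    have hQc : IsCompact Q := by
      have c1 : IsClosed {q : ℝ × ℝ | θ ≤ q.1 ^ 2} := isClosed_le (by fun_prop) (by fun_prop)
      have c2 : IsClosed {q : ℝ × ℝ | θ ≤ q.2} := isClosed_le (by fun_prop) (by fun_prop)
      have c3 : IsClosed {q : ℝ × ℝ | θ ≤ (L - q.1) ^ 2} := isClosed_le (by fun_prop) (by fun_prop)
      exact ((isCompact_Icc.prod isCompact_Icc).inter_right (c1.union c2)).inter_right
        (c3.union c2)
    have hQs : Q ⊆ Icc 0 L ×ˢ Icc 0 T := fun q hq => hq.1.1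
    have hQcorner : Q ⊆ (Icc 0 L ×ˢ Icc 0 T) \ {((0 : ℝ), (0 : ℝ)), (L, (0 : ℝ))} := by
      intro q hq
      refine ⟨hq.1.1, ?_⟩
      rintro (rfl | h)
      · rcases hq.1.2 with h | h <;> simp at h <;> linarith
      · rw [mem_singleton_iff] at h
        subst h
        rcases hq.2 with h | h <;> simp at h <;> linarith
    refine abs_lt_of_strict_supersolution (B := B) (wx := fun x t => vx x t - ux x t)
      (wxx := fun x t => vxx x t - uxx x t) (wt := fun x t => vt x t - ut x t) hε ha hb hβ hQc
      hQs ((hv.continuousOn.sub hu.continuousOn).mono hQcorner) ?_ ?_ hzx hzxx hzt hzpos hstrict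
      ?_ ?_
    · intro x hx t ht
      obtain ⟨u1, u2, u3, u4⟩ := hude x hx t ht
      obtain ⟨v1, v2, v3, v4⟩ := hvde x hx t ht
      refine ⟨v1.sub u1, v2.sub u2, v3.sub u3, ?_⟩
      have hcont : ∀ f : ℝ → ℝ → ℝ, ContinuousOn (fun z : ℝ × ℝ => f z.1 z.2)
          ((Icc 0 L ×ˢ Icc 0 T) \ {((0 : ℝ), (0 : ℝ)), (L, (0 : ℝ))}) → IntervalIntegrable
          (fun τ => Real.exp (-β * (t - τ)) * f x τ) volume 0 t := by
        intro f hf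
        refine ContinuousOn.intervalIntegrable_of_Icc ht.1.le (ContinuousOn.mul (by fun_prop) ?_)
        refine hf.comp (f := fun τ => (x, τ)) (by fun_prop) fun τ hτ => ?_
        refine ⟨⟨⟨hx.1.le, hx.2.le⟩, hτ.1, hτ.2.trans ht.2⟩, ?_⟩
        rintro (h | h)
        · exact hx.1.ne' (congrArg Prod.fst h)
        · exact hx.2.ne (congrArg Prod.fst h)
      have hsub : ∫ τ in (0 : ℝ)..t, Real.exp (-β * (t - τ)) * (v x τ - u x τ) =
          (∫ τ in (0 : ℝ)..t, Real.exp (-β * (t - τ)) * v x τ)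
          - ∫ τ in (0 : ℝ)..t, Real.exp (-β * (t - τ)) * u x τ := by
        rw [← intervalIntegral.integral_sub (hcont v hv.continuousOn) (hcont u hu.continuousOn)]
        simp only [mul_sub]
      simp only [hw]
      rw [hsub]
      have e : vt x t - ut x t - ε * (vxx x t - uxx x t) + a * (v x t - u x t) +
          b * ((∫ τ in (0 : ℝ)..t, Real.exp (-β * (t - τ)) * v x τ)
          - ∫ τ in (0 : ℝ)..t, Real.exp (-β * (t - τ)) * u x τ) =
          F x t (v x t) (vx x t) - F x t (u x t) (ux x t) := by
        rw [← u4, ← v4]; ring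
      rw [e]
      refine (hβF x ⟨hx.1.le, hx.2.le⟩ t ht _ _ _ _).trans ?_
      gcongr
      exact le_abs_self _
    · intro q hq
      have c : ContinuousAt (fun q : ℝ × ℝ => barrier ε L A lam θ q.1 q.2) q := by
        have hs : q.2 + θ ≠ 0 := by have := hq.2.1; linarith
        have hs' : θ / (q.2 + θ) ≠ 0 := div_ne_zero hθ.ne' hs
        have hs2 : 8 * ε * (q.2 + θ) ≠ 0 := by positivity
        unfold barrier cornerBarrier
        have cr : ContinuousAt (fun q : ℝ × ℝ => (θ / (q.2 + θ)) ^ (1 / 4 : ℝ)) q :=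
          ContinuousAt.rpow_const (ContinuousAt.div₀ (by fun_prop) (by fun_prop) hs) (Or.inl hs')
        have ce : ∀ f : ℝ × ℝ → ℝ, Continuous f →
          ContinuousAt (fun q : ℝ × ℝ => Real.exp (-(f q ^ 2 / (8 * ε * (q.2 + θ))))) q :=
          fun f hf => by
            have h1 : ContinuousAt (fun q : ℝ × ℝ => f q ^ 2) q := (hf.pow 2).continuousAt
            have h2 : ContinuousAt (fun q : ℝ × ℝ => 8 * ε * (q.2 + θ)) q := by fun_prop
            exact (h1.div₀ h2 hs2).neg.rexp
        exact ContinuousAt.mul (by fun_prop) (continuousAt_const.add (continuousAt_const.mul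
          ((cr.mul (ce _ continuous_fst)).add (cr.mul (ce (fun q => L - q.1) (by fun_prop))))))
      exact c.continuousWithinAt
    · intro x hx t ht hq
      have hbig : ∀ C : ℝ, 1 ≤ 2 * Real.exp (1 / (8 * ε)) * C →
          ∀ D : ℝ, 0 < D → |w x t| < Real.exp (lam * t) * (θ + A * (C + D)) := by
        intro C hC D hD
        have h1 : 1 ≤ Real.exp (lam * t) := by
          rw [Real.one_le_exp_iff]
          have := ht.1
          positivity
        have h2 : Mu + Mv ≤ A * C := by
          calc Mu + Mv = (Mu + Mv) * 1 := (mul_one _).symm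
            _ ≤ (Mu + Mv) * (2 * Real.exp (1 / (8 * ε)) * C) := by gcongr
            _ = A * C := by rw [hAdef]; ring
        have h3 := hMw x hx t ht
        have h4 : 0 ≤ A * D := by positivity
        have h5 : 0 < θ + A * (C + D) := by rw [mul_add]; linarith
        calc |w x t| < θ + A * (C + D) := by rw [mul_add]; linarith
          _ ≤ _ := le_mul_of_one_le_left h5.le h1
      have p1 := cornerBarrier_pos (ε := ε) hθ x ht.1
      have p2 := cornerBarrier_pos (ε := ε) hθ (L - x) ht.1
      by_cases h1 : θ ≤ t
      · exact absurd ⟨⟨⟨hx, ht⟩, Or.inr h1⟩, Or.inr h1⟩ hq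
      push Not at h1
      by_cases h2 : θ ≤ x ^ 2
      · by_cases h3 : θ ≤ (L - x) ^ 2
        · exact absurd ⟨⟨⟨hx, ht⟩, Or.inl h2⟩, Or.inl h3⟩ hq
        · push Not at h3
          have := hbig _ (cornerBarrier_lower_bound hε hθ ht.1 h1.le h3.le) _ p1
          rwa [add_comm (cornerBarrier ε θ (L - x) t)] at this
      · push Not at h2
        exact hbig _ (cornerBarrier_lower_bound hε hθ ht.1 h1.le h2.le) _ p2
    · intro x hx t ht h
      have hz := hzpos x t ht.1
      have h0 : w x t = 0 := by
        by_cases ht0 : t = 0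
        · rw [ht0]; exact hw0 x hx
        have htI : t ∈ Ioc 0 T := ⟨lt_of_le_of_ne ht.1 (Ne.symm ht0), ht.2⟩
        rcases h with h | rfl | rfl
        · exact absurd h ht0
        · simp [hw, hu.boundary_left t htI, hv.boundary_left t htI]
        · simp [hw, hu.boundary_right t htI, hv.boundary_right t htI]
      rw [h0, abs_zero]; exact hz
  intro x hx t ht
  rcases ht.1.eq_or_lt with h | h
  · have := hw0 x hx
    rw [← h]; simp only [hw] at this; linarith
  · have hle : |w x t| ≤ 0 := by
      refine ge_of_tendsto (tendsto_barrier_zero (L := L) (lam := lam) (x := x) hε hA h) ?_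
      filter_upwards [Ioo_mem_nhdsGT (zero_lt_one' ℝ)] with θ hθ
      exact (key θ hθ.1 hθ.2.le x hx t ht).le
    have := abs_nonpos_iff.mp hle
    simp only [hw] at this; linarith

/-! ### The heat kernel and its derivatives -/

/-- The `j`-th spatial derivative of the heat kernel of `∂_t - ε ∂_x²`, extended by `0` to
`r ≤ 0`. -/
noncomputable def heatK (ε : ℝ) : ℕ → ℝ → ℝ → ℝ
  | 0, x, r => (√(4 * Real.pi * ε * r))⁻¹ * Real.exp (-(x ^ 2 / (4 * ε * r)))
  | 1, x, r => -(x / (2 * ε * r)) * heatK ε 0 x r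
  | j + 2, x, r => -(x / (2 * ε * r)) * heatK ε (j + 1) x r - (j + 1) / (2 * ε * r) * heatK ε j x r

section heatK

variable {ε : ℝ}

lemma heatK_zero (x r : ℝ) :
    heatK ε 0 x r = (√(4 * Real.pi * ε * r))⁻¹ * Real.exp (-(x ^ 2 / (4 * ε * r))) := by
  rw [heatK]

lemma heatK_one (x r : ℝ) : heatK ε 1 x r = -(x / (2 * ε * r)) * heatK ε 0 x r :=
  rfl

lemma heatK_add_two (j : ℕ) (x r : ℝ) : heatK ε (j + 2) x r =
    -(x / (2 * ε * r)) * heatK ε (j + 1) x r - (j + 1) / (2 * ε * r) * heatK ε j x r := by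
  rw [heatK]

lemma heatK_induction {P : ℕ → Prop} (h0 : P 0) (h1 : P 1)
    (h : ∀ j, P j → P (j + 1) → P (j + 2)) (j : ℕ) : P j :=
  Nat.twoStepInduction h0 h1 h j

/-- The square root of a nonpositive number and the inverse of `0` are `0` by convention, so the
prefactor vanishes. This lets causal time integrals be written over the whole line. -/
lemma heatK_of_nonpos (hε : 0 < ε) (j : ℕ) (x : ℝ) {r : ℝ} (hr : r ≤ 0) : heatK ε j x r = 0 := by
  have h0 : heatK ε 0 x r = 0 := by
    rw [heatK_zero, Real.sqrt_eq_zero_of_nonpos, inv_zero, zero_mul]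
    exact mul_nonpos_of_nonneg_of_nonpos (by positivity) hr
  induction j using heatK_induction with
  | h0 => exact h0
  | h1 => rw [heatK_one, h0, mul_zero]
  | h j a b => rw [heatK_add_two, a, b]; ring

lemma measurable_heatK (j : ℕ) : Measurable (fun q : ℝ × ℝ => heatK ε j q.1 q.2) := by
  have h0 : Measurable (fun q : ℝ × ℝ => heatK ε 0 q.1 q.2) := by
    simp only [heatK_zero]; fun_prop
  induction j using heatK_induction with
  | h0 => exact h0
  | h1 => simp only [heatK_one]; fun_prop
  | h j a b => simp only [heatK_add_two]; fun_prop

lemma continuousAt_heatK (hε : 0 < ε) (j : ℕ) (x : ℝ) {r : ℝ} (hr : 0 < r) :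
    ContinuousAt (fun q : ℝ × ℝ => heatK ε j q.1 q.2) (x, r) := by
  have hd : ∀ c : ℝ, 0 < c → ∀ f : ℝ × ℝ → ℝ, Continuous f →
      ContinuousAt (fun q : ℝ × ℝ => f q / (c * ε * q.2)) (x, r) := by
    intro c hc f hf
    exact ContinuousAt.div₀ hf.continuousAt (by fun_prop) (by positivity)
  have h0 : ContinuousAt (fun q : ℝ × ℝ => heatK ε 0 q.1 q.2) (x, r) := by
    simp only [heatK_zero]
    refine ContinuousAt.mul ?_ ((hd 4 (by norm_num) _ (by fun_prop)).neg.rexp)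
    exact ContinuousAt.inv₀ (by fun_prop) (by positivity)
  induction j using heatK_induction with
  | h0 => exact h0
  | h1 => simp only [heatK_one]; exact ((hd 2 (by norm_num) _ (by fun_prop)).neg.mul h0)
  | h j a b =>
    simp only [heatK_add_two]
    exact ((hd 2 (by norm_num) _ (by fun_prop)).neg.mul b).sub
      ((hd 2 (by norm_num) (fun _ => (j : ℝ) + 1) (by fun_prop)).mul a)

/-- The recursion is the Leibniz rule applied to `K_x = -(x / (2 ε r)) K`, as for Hermite
polynomials. The computation is purely algebraic, so no sign of `r` is needed. -/
lemma hasDerivAt_heatK_space (j : ℕ) (x r : ℝ) :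
    HasDerivAt (fun y => heatK ε j y r) (heatK ε (j + 1) x r) x := by
  have hx : HasDerivAt (fun y : ℝ => -(y / (2 * ε * r))) (-(1 / (2 * ε * r))) x :=
    ((hasDerivAt_id x).div_const _).neg
  have h0 : ∀ x, HasDerivAt (fun y => heatK ε 0 y r) (heatK ε 1 x r) x := by
    intro x
    simp only [heatK_one, heatK_zero]
    have := ((((hasDerivAt_id x).pow 2).div_const (4 * ε * r)).neg.exp).const_mul
      ((√(4 * Real.pi * ε * r))⁻¹)
    refine this.congr_deriv ?_
    simp only [id, Nat.cast_ofNat, Pi.neg_apply, Pi.pow_apply]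
    have : 2 * x ^ (2 - 1) * 1 / (4 * ε * r) = x / (2 * ε * r) := by
      rw [show 2 * x ^ (2 - 1) * 1 = 2 * x by norm_num,
        show 4 * ε * r = 2 * (2 * ε * r) by ring, mul_div_mul_left _ _ two_ne_zero]
    rw [this]; ring
  induction j using heatK_induction with
  | h0 => exact h0 x
  | h1 =>
    simp only [heatK_one (ε := ε)]
    refine (hx.mul (h0 x)).congr_deriv ?_
    rw [show (1 + 1 : ℕ) = 0 + 2 by norm_num, heatK_add_two]
    push_cast; ring
  | h j a b =>
    simp only [heatK_add_two (ε := ε) j]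
    refine ((hx.mul b).sub (a.const_mul ((j + 1) / (2 * ε * r)))).congr_deriv ?_
    rw [show j + 2 + 1 = (j + 1) + 2 by ring, heatK_add_two (j + 1)]
    push_cast; ring

lemma hasDerivAt_heatK_time (hε : 0 < ε) (j : ℕ) (x : ℝ) {r : ℝ} (hr : 0 < r) :
    HasDerivAt (fun s => heatK ε j x s) (ε * heatK ε (j + 2) x r) r := by
  have hx : ∀ c d : ℝ, 0 < d → HasDerivAt (fun s : ℝ => c / (d * ε * s)) (-(c / (d * ε * r ^ 2))) r := by
    intro c d hd
    refine ((hasDerivAt_const r c).div ((hasDerivAt_id r).const_mul (d * ε))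
      (by simp only [id]; positivity)).congr_deriv ?_
    simp only [id]; field_simp; ring
  have h0 : HasDerivAt (fun s => heatK ε 0 x s) (ε * heatK ε 2 x r) r := by
    have hs : HasDerivAt (fun s => (√(4 * Real.pi * ε * s))⁻¹)
        (-(1 / (2 * r)) * (√(4 * Real.pi * ε * r))⁻¹) r := by
      have h1 := ((hasDerivAt_id r).const_mul (4 * Real.pi * ε)).sqrt
        (by simp only [id]; positivity)
      have h2 := h1.inv (by simp only [id]; positivity)
      refine h2.congr_deriv ?_
      simp only [id]
      have hp := Real.pi_pos
      have h3 : 0 < √(4 * Real.pi * ε * r) := by positivity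
      have h4 : √(4 * Real.pi * ε * r) ^ 2 = 4 * Real.pi * ε * r := Real.sq_sqrt (by positivity)
      rw [h4]
      field_simp
    have := hs.mul (hx (x ^ 2) 4 (by norm_num)).neg.exp
    simp only [heatK_zero (ε := ε) x]
    refine this.congr_deriv ?_
    have h2 := heatK_add_two (ε := ε) 0 x r
    rw [zero_add, zero_add, heatK_one, heatK_zero] at h2
    rw [h2]
    simp only [Pi.neg_apply]
    field_simp
    push_cast
    ring
  induction j using heatK_induction with
  | h0 => exact h0
  | h1 =>
    simp only [heatK_one (ε := ε) x]
    refine ((hx x 2 (by norm_num)).neg.mul h0).congr_deriv ?_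
    rw [show (1 + 2 : ℕ) = 1 + 2 by norm_num, heatK_add_two 1, heatK_one]
    simp only [Pi.neg_apply]
    push_cast; field_simp; ring
  | h j a b =>
    simp only [heatK_add_two (ε := ε) j x]
    refine (((hx x 2 (by norm_num)).neg.mul b).sub
      ((hx (j + 1) 2 (by norm_num)).mul a)).congr_deriv ?_
    rw [heatK_add_two (j + 2), heatK_add_two j]
    simp only [Pi.neg_apply]
    rw [show j + 1 + 2 = j + 2 + 1 by ring]
    push_cast; field_simp; ring

/-- The power is at most a multiple of `e^{1+q}`, and completing the square gives `q ≤ 2 ε + q² / (8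
ε)`. Half of the Gaussian exponent is spent on the polynomial. -/
lemma one_add_pow_mul_exp_le (hε : 0 < ε) (n : ℕ) :
    ∃ C : ℝ, 0 < C ∧ ∀ q : ℝ, 0 ≤ q →
      (1 + q) ^ n * Real.exp (-(q ^ 2 / (4 * ε))) ≤ C * Real.exp (-(q ^ 2 / (8 * ε))) := by
  refine ⟨n.factorial * Real.exp (1 + 2 * ε), by positivity, fun q hq => ?_⟩
  have h1 : (1 + q) ^ n ≤ n.factorial * Real.exp (1 + q) := by
    have := Real.pow_div_factorial_le_exp (1 + q) (by positivity) n
    rwa [div_le_iff₀ (by positivity), mul_comm] at this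
  have h2 : Real.exp (1 + q) * Real.exp (-(q ^ 2 / (4 * ε)))
      ≤ Real.exp (1 + 2 * ε) * Real.exp (-(q ^ 2 / (8 * ε))) := by
    rw [← Real.exp_add, ← Real.exp_add, Real.exp_le_exp]
    have : 1 + 2 * ε + -(q ^ 2 / (8 * ε)) - (1 + q + -(q ^ 2 / (4 * ε)))
        = (q - 4 * ε) ^ 2 / (8 * ε) := by
      field_simp; ring
    have h3 : 0 ≤ (q - 4 * ε) ^ 2 / (8 * ε) := by positivity
    linarith
  calc _ ≤ n.factorial * Real.exp (1 + q) * Real.exp (-(q ^ 2 / (4 * ε))) := by gcongr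
    _ = n.factorial * (Real.exp (1 + q) * Real.exp (-(q ^ 2 / (4 * ε)))) := by ring
    _ ≤ n.factorial * (Real.exp (1 + 2 * ε) * Real.exp (-(q ^ 2 / (8 * ε)))) := by gcongr
    _ = _ := by ring

/-- In the variable `|x| / √r`, each order of differentiation costs at most one factor `(1 + |x| /
√r) / √r`; the term of the recursion that skips an order carries `1 / r`, the price of two. -/
lemma abs_heatK_le_pow (hε : 0 < ε) (j : ℕ) : ∃ C : ℝ, 0 < C ∧ ∀ x r : ℝ, 0 < r →
    |heatK ε j x r| ≤ C * (1 + |x| / √r) ^ j / √r ^ j * heatK ε 0 x r := by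
  have hpos : ∀ x r : ℝ, 0 < r → 0 < heatK ε 0 x r := fun x r hr => by
    rw [heatK_zero]; positivity
  have hx : ∀ x r : ℝ, 0 < r → |x / (2 * ε * r)| ≤ 1 / (2 * ε) * (1 + |x| / √r) / √r := by
    intro x r hr
    have h1 : 0 < √r := Real.sqrt_pos.mpr hr
    rw [abs_div, abs_of_pos (by positivity : 0 < 2 * ε * r)]
    have : |x| / (2 * ε * r) = 1 / (2 * ε) * (|x| / √r) / √r := by
      nth_rw 1 [← Real.mul_self_sqrt hr.le]
      field_simp
    rw [this]
    gcongr
    linarith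
  induction j using heatK_induction with
  | h0 =>
    refine ⟨1, one_pos, fun x r hr => ?_⟩
    rw [abs_of_pos (hpos x r hr)]; simp
  | h1 =>
    refine ⟨1 / (2 * ε), by positivity, fun x r hr => ?_⟩
    rw [heatK_one, abs_mul, abs_neg, abs_of_pos (hpos x r hr), pow_one, pow_one]
    have := hpos x r hr
    gcongr
    exact hx x r hr
  | h j a b =>
    obtain ⟨C, hC, hCb⟩ := a
    obtain ⟨D, hD, hDb⟩ := b
    refine ⟨1 / (2 * ε) * D + (j + 1) / (2 * ε) * C, by positivity, fun x r hr => ?_⟩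
    have h1 : 0 < √r := Real.sqrt_pos.mpr hr
    have hK := hpos x r hr
    rw [heatK_add_two]
    have hq : 1 ≤ 1 + |x| / √r := by
      have : 0 ≤ |x| / √r := by positivity
      linarith
    set q := 1 + |x| / √r
    have e1 : |-(x / (2 * ε * r)) * heatK ε (j + 1) x r| ≤
        1 / (2 * ε) * q / √r * (D * q ^ (j + 1) / √r ^ (j + 1) * heatK ε 0 x r) := by
      rw [abs_mul, abs_neg]
      gcongr
      · exact hx x r hr
      · exact hDb x r hr
    have e2 : |(j + 1) / (2 * ε * r) * heatK ε j x r| ≤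
        (j + 1) / (2 * ε * r) * (C * q ^ (j + 2) / √r ^ j * heatK ε 0 x r) := by
      rw [abs_mul, abs_of_pos (by positivity : 0 < ((j : ℝ) + 1) / (2 * ε * r))]
      gcongr
      refine (hCb x r hr).trans ?_
      gcongr ?_ / _ * _
      gcongr C * ?_
      exact pow_le_pow_right₀ hq (by omega)
    refine (abs_sub _ _).trans ((add_le_add e1 e2).trans (le_of_eq ?_))
    have h2 : r = √r ^ 2 := (Real.sq_sqrt hr.le).symm
    rw [show ((j : ℝ) + 1) / (2 * ε * r) = ((j : ℝ) + 1) / (2 * ε * √r ^ 2) by rw [← h2]]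
    field_simp
    ring

/-- Gaussian bound for all derivatives of the heat kernel, with polynomial weights. -/
lemma abs_heatK_le (hε : 0 < ε) (j m : ℕ) : ∃ C : ℝ, 0 < C ∧ ∀ x r : ℝ, 0 < r →
    (1 + |x| / √r) ^ m * |heatK ε j x r| ≤ C / √r ^ (j + 1) * Real.exp (-(x ^ 2 / (8 * ε * r))) := by
  obtain ⟨C, hC, hCb⟩ := abs_heatK_le_pow hε j
  obtain ⟨D, hD, hDb⟩ := one_add_pow_mul_exp_le hε (m + j)
  have hp : 0 < √(4 * Real.pi * ε) := by have := Real.pi_pos; positivity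
  refine ⟨C * (√(4 * Real.pi * ε))⁻¹ * D, by positivity, fun x r hr => ?_⟩
  have h1 : 0 < √r := Real.sqrt_pos.mpr hr
  have h2 := hDb (|x| / √r) (by positivity)
  have e0 : (|x| / √r) ^ 2 = x ^ 2 / r := by rw [div_pow, sq_abs, Real.sq_sqrt hr.le]
  have e1 : (|x| / √r) ^ 2 / (4 * ε) = x ^ 2 / (4 * ε * r) := by rw [e0]; field_simp
  have e2 : (|x| / √r) ^ 2 / (8 * ε) = x ^ 2 / (8 * ε * r) := by rw [e0]; field_simp
  rw [e1, e2] at h2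
  set q := 1 + |x| / √r with hq
  have hq0 : 0 < q := by positivity
  calc q ^ m * |heatK ε j x r| ≤ q ^ m * (C * q ^ j / √r ^ j * heatK ε 0 x r) := by
        gcongr; exact hCb x r hr
    _ = C * (√(4 * Real.pi * ε))⁻¹ / √r ^ (j + 1) *
        (q ^ (m + j) * Real.exp (-(x ^ 2 / (4 * ε * r)))) := by
        rw [heatK_zero, Real.sqrt_mul (by have := Real.pi_pos; positivity)]
        field_simp
        ring
    _ ≤ C * (√(4 * Real.pi * ε))⁻¹ / √r ^ (j + 1) *
        (D * Real.exp (-(x ^ 2 / (8 * ε * r)))) := by gcongr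
    _ = _ := by ring

/-- Away from `x = 0` the kernel vanishes to every order as `r → 0`. -/
lemma abs_heatK_le_of_ne_zero (hε : 0 < ε) (j m : ℕ) : ∃ C : ℝ, 0 < C ∧ ∀ x r : ℝ, x ≠ 0 → 0 < r →
    |heatK ε j x r| ≤ C / √r ^ (j + 1) * (r / x ^ 2) ^ m := by
  obtain ⟨C, hC, hCb⟩ := abs_heatK_le hε j 0
  refine ⟨C * (m.factorial * (8 * ε) ^ m), by positivity, fun x r hx hr => ?_⟩
  have h1 : 0 < √r := Real.sqrt_pos.mpr hr
  have h2 := hCb x r hr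
  rw [pow_zero, one_mul] at h2
  have h3 : Real.exp (-(x ^ 2 / (8 * ε * r))) ≤ m.factorial * (8 * ε) ^ m * (r / x ^ 2) ^ m := by
    have hx2 : 0 < x ^ 2 := by positivity
    have h4 := Real.pow_div_factorial_le_exp (x ^ 2 / (8 * ε * r)) (by positivity) m
    rw [Real.exp_neg]
    have h5 : m.factorial * (8 * ε) ^ m * (r / x ^ 2) ^ m
        = ((x ^ 2 / (8 * ε * r)) ^ m / m.factorial)⁻¹ := by
      rw [div_pow, div_pow, mul_pow (8 * ε)]; field_simp
    rw [h5]
    exact inv_anti₀ (by positivity) h4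
  calc _ ≤ _ := h2
    _ ≤ C / √r ^ (j + 1) * (m.factorial * (8 * ε) ^ m * (r / x ^ 2) ^ m) := by gcongr
    _ = _ := by ring

lemma integrable_exp_neg_sq_div {c : ℝ} (hc : 0 < c) :
    Integrable (fun z : ℝ => Real.exp (-(z ^ 2 / c))) := by
  have := integrable_exp_neg_mul_sq (b := 1 / c) (by positivity)
  convert this using 3
  ring

lemma integral_exp_neg_sq_div {c : ℝ} :
    ∫ z : ℝ, Real.exp (-(z ^ 2 / c)) = √(Real.pi * c) := by
  have := integral_gaussian (1 / c)
  convert this using 3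
  · ring_nf
  · simp

end heatK

/-! ### Convolution with the heat kernel -/

/-- Convolution in space of a bounded function with the `j`-th derivative of the heat kernel. -/
noncomputable def heatS (ε : ℝ) (j : ℕ) (g : ℝ → ℝ) (x r : ℝ) : ℝ :=
  ∫ y, heatK ε j (x - y) r * g y

section heatS

variable {ε : ℝ}

lemma heatS_of_nonpos (hε : 0 < ε) (j : ℕ) (g : ℝ → ℝ) (x : ℝ) {r : ℝ} (hr : r ≤ 0) :
    heatS ε j g x r = 0 := by
  simp [heatS, heatK_of_nonpos hε j _ hr]

/-- One integrable majorant serves a whole neighbourhood of `(x₀, r₀)`: for `r < 2 r₀` and `|x - x₀|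
< 1` the Gaussian is dominated by a wider one centred at `x₀`. Continuity of the convolutions and
all differentiation under the integral in `heatS` rest on it. -/
lemma heatK_dominated (hε : 0 < ε) (j : ℕ) (x₀ : ℝ) {r₀ : ℝ} (hr₀ : 0 < r₀) :
    ∃ B : ℝ → ℝ, Integrable B ∧
      ∀ᶠ q : ℝ × ℝ in 𝓝 (x₀, r₀), ∀ y, |heatK ε j (q.1 - y) q.2| ≤ B y := by
  obtain ⟨C, hC, hCb⟩ := abs_heatK_le hε j 0
  refine ⟨fun y => C / √(r₀ / 2) ^ (j + 1) * (Real.exp (1 / (16 * ε * r₀)) *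
    Real.exp (-((x₀ - y) ^ 2 / (32 * ε * r₀)))), ?_, ?_⟩
  · have h := (integrable_exp_neg_sq_div (c := 32 * ε * r₀) (by positivity)).comp_sub_left x₀
    exact (h.const_mul _).const_mul _
  · have h1 : ∀ᶠ q : ℝ × ℝ in 𝓝 (x₀, r₀), |q.1 - x₀| < 1 := by
      have : Tendsto (fun q : ℝ × ℝ => |q.1 - x₀|) (𝓝 (x₀, r₀)) (𝓝 (|x₀ - x₀|)) :=
        Continuous.tendsto (by fun_prop) (x₀, r₀)
      exact this.eventually_lt_const (by simp)
    have h2 : ∀ᶠ q : ℝ × ℝ in 𝓝 (x₀, r₀), r₀ / 2 < q.2 :=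
      continuous_snd.continuousAt.eventually_const_lt (by simp; linarith)
    have h3 : ∀ᶠ q : ℝ × ℝ in 𝓝 (x₀, r₀), q.2 < 2 * r₀ :=
      continuous_snd.continuousAt.eventually_lt_const (by simp; linarith)
    filter_upwards [h1, h2, h3] with q hq1 hq2 hq3 y
    have hq0 : 0 < q.2 := by linarith
    have h4 := hCb (q.1 - y) q.2 hq0
    rw [pow_zero, one_mul] at h4
    refine h4.trans ?_
    have h5 : Real.exp (-((q.1 - y) ^ 2 / (8 * ε * q.2))) ≤ Real.exp (1 / (16 * ε * r₀)) *
        Real.exp (-((x₀ - y) ^ 2 / (32 * ε * r₀))) := by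
      rw [← Real.exp_add, Real.exp_le_exp]
      have h6 : (q.1 - y) ^ 2 / (16 * ε * r₀) ≤ (q.1 - y) ^ 2 / (8 * ε * q.2) := by
        apply div_le_div_of_nonneg_left (by positivity) (by positivity)
        nlinarith
      have h7 : (x₀ - y) ^ 2 ≤ 2 * (q.1 - y) ^ 2 + 2 := by
        have : (q.1 - x₀) ^ 2 ≤ 1 := by rw [← sq_abs]; nlinarith [abs_nonneg (q.1 - x₀)]
        nlinarith [sq_nonneg ((q.1 - y) + (q.1 - x₀))]
      have h8 : (x₀ - y) ^ 2 / (32 * ε * r₀) ≤ (2 * (q.1 - y) ^ 2 + 2) / (32 * ε * r₀) := by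
        gcongr
      have h9 : (2 * (q.1 - y) ^ 2 + 2) / (32 * ε * r₀) =
        (q.1 - y) ^ 2 / (16 * ε * r₀) + 1 / (16 * ε * r₀) := by field_simp; ring
      linarith
    gcongr

lemma measurable_heatK_sub (j : ℕ) (x r : ℝ) : Measurable (fun y => heatK ε j (x - y) r) :=
  (measurable_heatK j).comp (f := fun y : ℝ => (x - y, r)) (by fun_prop)

lemma integrable_heatK_sub (hε : 0 < ε) (j : ℕ) (x r : ℝ) :
    Integrable (fun y => heatK ε j (x - y) r) := by
  rcases le_or_gt r 0 with hr | hr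
  · simp [heatK_of_nonpos hε j _ hr]
  · obtain ⟨B, hB, hBb⟩ := heatK_dominated hε j x hr
    exact hB.mono' (measurable_heatK_sub j x r).aestronglyMeasurable
      (Eventually.of_forall fun y => hBb.self_of_nhds y)

lemma integrable_heatK_sub_mul (hε : 0 < ε) (j : ℕ) {g : ℝ → ℝ} {M : ℝ} (hg : Measurable g)
    (hM : ∀ y, |g y| ≤ M) (x r : ℝ) : Integrable (fun y => heatK ε j (x - y) r * g y) :=
  (integrable_heatK_sub hε j x r).mul_bdd hg.aestronglyMeasurable
    (Eventually.of_forall fun y => hM y)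

/-- The convolved function may vary along the filter as well, as it does in `heatS ε j (f (t - r)) x
r` when `t` moves. -/
lemma tendsto_heatS (hε : 0 < ε) (j : ℕ) {ι : Type*} {l : Filter ι} [l.IsCountablyGenerated]
    {X R : ι → ℝ} {G : ι → ℝ → ℝ} {g : ℝ → ℝ} {x r M : ℝ} (hr : 0 < r)
    (hX : Tendsto X l (𝓝 x)) (hR : Tendsto R l (𝓝 r)) (hG : ∀ i, Measurable (G i))
    (hM : ∀ i y, |G i y| ≤ M) (hGg : ∀ y, Tendsto (fun i => G i y) l (𝓝 (g y))) :
    Tendsto (fun i => heatS ε j (G i) (X i) (R i)) l (𝓝 (heatS ε j g x r)) := by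
  obtain ⟨B, hB, hBb⟩ := heatK_dominated hε j x hr
  have hXR : Tendsto (fun i => (X i, R i)) l (𝓝 (x, r)) := hX.prodMk_nhds hR
  refine tendsto_integral_filter_of_dominated_convergence (fun y => B y * M) ?_ ?_
    (hB.mul_const M) ?_
  · exact Eventually.of_forall fun i =>
      ((measurable_heatK_sub j (X i) (R i)).mul (hG i)).aestronglyMeasurable
  · filter_upwards [hXR.eventually hBb] with i hi
    refine Eventually.of_forall fun y => ?_
    rw [norm_mul, Real.norm_eq_abs, Real.norm_eq_abs]
    have := hi y
    have h2 := hM i y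
    have h3 : 0 ≤ B y := (abs_nonneg _).trans this
    gcongr
  · refine Eventually.of_forall fun y => Tendsto.mul ?_ (hGg y)
    have h1 := continuousAt_heatK hε j (x - y) hr
    have h2 : Tendsto (fun i => (X i - y, R i)) l (𝓝 (x - y, r)) :=
      (hX.sub_const y).prodMk_nhds hR
    exact h1.tendsto.comp h2

lemma continuousAt_heatS (hε : 0 < ε) (j : ℕ) {g : ℝ → ℝ} {M : ℝ} (hg : Measurable g)
    (hM : ∀ y, |g y| ≤ M) (x : ℝ) {r : ℝ} (hr : 0 < r) :
    ContinuousAt (fun q : ℝ × ℝ => heatS ε j g q.1 q.2) (x, r) :=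
  tendsto_heatS hε j (G := fun _ => g) hr continuous_fst.continuousAt continuous_snd.continuousAt
    (fun _ => hg) (fun _ => hM) fun _ => tendsto_const_nhds

lemma hasDerivAt_heatS_space (hε : 0 < ε) (j : ℕ) {g : ℝ → ℝ} {M : ℝ} (hg : Measurable g)
    (hM : ∀ y, |g y| ≤ M) (x r : ℝ) :
    HasDerivAt (fun x => heatS ε j g x r) (heatS ε (j + 1) g x r) x := by
  rcases le_or_gt r 0 with hr | hr
  · simp only [heatS_of_nonpos hε _ g _ hr]
    exact hasDerivAt_const x 0
  obtain ⟨B, hB, hBb⟩ := heatK_dominated hε (j + 1) x hr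
  have h1 : ∀ᶠ x' in 𝓝 x, ∀ y, |heatK ε (j + 1) (x' - y) r| ≤ B y := by
    have : Tendsto (fun x' : ℝ => (x', r)) (𝓝 x) (𝓝 (x, r)) := Continuous.tendsto (by fun_prop) x
    exact this.eventually hBb
  refine (hasDerivAt_integral_of_dominated_loc_of_deriv_le
    (F := fun x y => heatK ε j (x - y) r * g y) (F' := fun x y => heatK ε (j + 1) (x - y) r * g y)
    (bound := fun y => B y * M) (μ := volume) h1
    (Eventually.of_forall fun x' =>
      ((measurable_heatK_sub j x' r).mul hg).aestronglyMeasurable)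
    (integrable_heatK_sub_mul hε j hg hM x r)
    ((measurable_heatK_sub (j + 1) x r).mul hg).aestronglyMeasurable
    (Eventually.of_forall fun y x' hx' => ?_) (hB.mul_const M)
    (Eventually.of_forall fun y x' _ => ?_)).2
  · rw [norm_mul, Real.norm_eq_abs, Real.norm_eq_abs]
    have := hx' y
    have h2 := hM y
    have h3 : 0 ≤ B y := (abs_nonneg _).trans this
    gcongr
  · exact ((hasDerivAt_heatK_space j (x' - y) r).comp_sub_const x' y).mul_const (g y)

lemma hasDerivAt_heatS_time (hε : 0 < ε) (j : ℕ) {g : ℝ → ℝ} {M : ℝ} (hg : Measurable g)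
    (hM : ∀ y, |g y| ≤ M) (x : ℝ) {r : ℝ} (hr : 0 < r) :
    HasDerivAt (fun r => heatS ε j g x r) (ε * heatS ε (j + 2) g x r) r := by
  obtain ⟨B, hB, hBb⟩ := heatK_dominated hε (j + 2) x hr
  have h1 : ∀ᶠ r' in 𝓝 r, (∀ y, |heatK ε (j + 2) (x - y) r'| ≤ B y) ∧ 0 < r' := by
    have : Tendsto (fun r' : ℝ => (x, r')) (𝓝 r) (𝓝 (x, r)) := Continuous.tendsto (by fun_prop) r
    exact (this.eventually hBb).and (lt_mem_nhds hr)
  have hmain := (hasDerivAt_integral_of_dominated_loc_of_deriv_le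
    (F := fun r y => heatK ε j (x - y) r * g y)
    (F' := fun r y => ε * heatK ε (j + 2) (x - y) r * g y)
    (bound := fun y => ε * B y * M) (μ := volume) h1
    (Eventually.of_forall fun r' =>
      ((measurable_heatK_sub j x r').mul hg).aestronglyMeasurable)
    (integrable_heatK_sub_mul hε j hg hM x r)
    (((measurable_heatK_sub (j + 2) x r).const_mul ε).mul hg).aestronglyMeasurable
    (Eventually.of_forall fun y r' hr' => ?_) ((hB.const_mul ε).mul_const M)
    (Eventually.of_forall fun y r' hr' => ?_)).2
  · refine hmain.congr_deriv ?_
    simp only [heatS, mul_assoc]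
    exact integral_const_mul _ _
  · rw [norm_mul, norm_mul, Real.norm_eq_abs, Real.norm_eq_abs, Real.norm_eq_abs, abs_of_pos hε]
    have := hr'.1 y
    have h2 := hM y
    have h3 : 0 ≤ B y := (abs_nonneg _).trans this
    gcongr
  · exact (hasDerivAt_heatK_time hε j (x - y) hr'.2).mul_const (g y)

lemma abs_heatS_le (hε : 0 < ε) (j : ℕ) : ∃ C : ℝ, 0 < C ∧ ∀ (g : ℝ → ℝ) (M x r : ℝ),
    (∀ y, |g y| ≤ M) → |heatS ε j g x r| ≤ C * M / √r ^ j := by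
  obtain ⟨C, hC, hCb⟩ := abs_heatK_le hε j 0
  refine ⟨C * √(Real.pi * (8 * ε)), by have := Real.pi_pos; positivity, fun g M x r hM => ?_⟩
  have hM0 : 0 ≤ M := (abs_nonneg _).trans (hM 0)
  rcases le_or_gt r 0 with hr | hr
  · rw [heatS_of_nonpos hε j g x hr, abs_zero]; positivity
  have h1 : 0 < √r := Real.sqrt_pos.mpr hr
  have hint := (integrable_exp_neg_sq_div (c := 8 * ε * r) (by positivity)).comp_sub_left x
  have h2 : ∫ y, C / √r ^ (j + 1) * Real.exp (-((x - y) ^ 2 / (8 * ε * r))) * M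
      = C * √(Real.pi * (8 * ε)) * M / √r ^ j := by
    rw [integral_mul_const, integral_const_mul, integral_sub_left_eq_self
      (fun z => Real.exp (-(z ^ 2 / (8 * ε * r)))) volume x, integral_exp_neg_sq_div,
      ← mul_assoc Real.pi, Real.sqrt_mul (by have := Real.pi_pos; positivity)]
    field_simp
    ring
  rw [← h2, ← Real.norm_eq_abs, heatS]
  refine norm_integral_le_of_norm_le ((hint.const_mul _).mul_const _)
    (Eventually.of_forall fun y => ?_)
  rw [norm_mul, Real.norm_eq_abs, Real.norm_eq_abs]
  have h3 := hCb (x - y) r hr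
  rw [pow_zero, one_mul] at h3
  have := hM y
  gcongr

lemma integral_heatK_succ (hε : 0 < ε) (j : ℕ) (x r : ℝ) :
    ∫ y, heatK ε (j + 1) (x - y) r = 0 := by
  rw [integral_sub_left_eq_self (fun z => heatK ε (j + 1) z r) volume x]
  have hi : ∀ j, Integrable (fun z => heatK ε j z r) := fun j => by
    have := (integrable_heatK_sub hε j 0 r).comp_neg
    simpa using this
  exact integral_eq_zero_of_hasDerivAt_of_integrable
    (fun z => hasDerivAt_heatK_space j z r) (hi (j + 1)) (hi j)

/-- The second derivative has an integrable singularity if `g` is Hölder continuous at `x`. -/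
lemma abs_heatS_two_le (hε : 0 < ε) : ∃ C : ℝ, 0 < C ∧ ∀ (g : ℝ → ℝ) (M H x r : ℝ), Measurable g →
    (∀ y, |g y| ≤ M) → 0 ≤ H → (∀ y, |g y - g x| ≤ H * √|y - x|) → 0 < r →
    |heatS ε 2 g x r| ≤ C * H * r ^ (-(3 / 4) : ℝ) := by
  obtain ⟨C, hC, hCb⟩ := abs_heatK_le hε 2 1
  refine ⟨C * √(Real.pi * (8 * ε)), by have := Real.pi_pos; positivity,
    fun g M H x r hg hM hH hgx hr => ?_⟩
  have h1 : 0 < √r := Real.sqrt_pos.mpr hr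
  have hint := (integrable_exp_neg_sq_div (c := 8 * ε * r) (by positivity)).comp_sub_left x
  -- The second derivative of the kernel has integral zero, so the constant `g x` may be subtracted.
  have h0 : heatS ε 2 g x r = ∫ y, heatK ε 2 (x - y) r * (g y - g x) := by
    simp only [mul_sub]
    rw [integral_sub (integrable_heatK_sub_mul hε 2 hg hM x r)
      ((integrable_heatK_sub hε 2 x r).mul_const _), integral_mul_const,
      integral_heatK_succ hε 1, zero_mul, sub_zero, heatS]
  have hpow : (√r ^ 2)⁻¹ * √√r = r ^ (-(3 / 4) : ℝ) := by
    rw [Real.sq_sqrt hr.le, Real.sqrt_eq_rpow, Real.sqrt_eq_rpow, ← Real.rpow_mul hr.le,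
      ← Real.rpow_neg_one, ← Real.rpow_add hr]
    norm_num
  have h2 : ∫ y, C / √r ^ (2 + 1) * Real.exp (-((x - y) ^ 2 / (8 * ε * r))) * (H * √√r)
      = C * √(Real.pi * (8 * ε)) * H * r ^ (-(3 / 4) : ℝ) := by
    rw [integral_mul_const, integral_const_mul, integral_sub_left_eq_self
      (fun z => Real.exp (-(z ^ 2 / (8 * ε * r)))) volume x, integral_exp_neg_sq_div,
      ← mul_assoc Real.pi, Real.sqrt_mul (by have := Real.pi_pos; positivity), ← hpow]
    field_simp
  rw [← h2, ← Real.norm_eq_abs, h0]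
  refine norm_integral_le_of_norm_le ((hint.const_mul _).mul_const _)
    (Eventually.of_forall fun y => ?_)
  rw [norm_mul, Real.norm_eq_abs, Real.norm_eq_abs]
  have h3 := hCb (x - y) r hr
  rw [pow_one] at h3
  -- The root `|y - x|^{1/2}` is `r^{1/4}` times a root of `|x - y| / √r`. The latter is absorbed by
  -- the polynomial weight with `m = 1`, and the gain `r^{1/4}` turns `r^{-1}` into `r^{-3/4}`.
  have h4 : √|y - x| ≤ √√r * (1 + |x - y| / √r) := by
    have h5 : |y - x| = √r * (|x - y| / √r) := by rw [abs_sub_comm]; field_simp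
    rw [h5, Real.sqrt_mul h1.le]
    gcongr
    have h6 : 0 ≤ |x - y| / √r := by positivity
    rw [Real.sqrt_le_left (by positivity)]
    nlinarith
  calc |heatK ε 2 (x - y) r| * |g y - g x|
      ≤ |heatK ε 2 (x - y) r| * (H * (√√r * (1 + |x - y| / √r))) := by
        gcongr
        exact (hgx y).trans (by gcongr)
    _ = (1 + |x - y| / √r) * |heatK ε 2 (x - y) r| * (H * √√r) := by ring
    _ ≤ _ := by gcongr

/-- Reflection `y ↦ 2c - y` preserves the kernel centred at `c` and changes the sign of `g`. This
gives the zero boundary values of the volume potential. -/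
lemma heatS_eq_zero_of_odd {g : ℝ → ℝ} {c : ℝ} (hg : ∀ y, g (2 * c - y) = -g y) (r : ℝ) :
    heatS ε 0 g c r = 0 := by
  have h1 : ∫ y, heatK ε 0 (c - y) r * g y = ∫ y, heatK ε 0 (c - (2 * c - y)) r * g (2 * c - y) :=
    (integral_sub_left_eq_self (fun y => heatK ε 0 (c - y) r * g y) volume (2 * c)).symm
  have h2 : ∀ y, heatK ε 0 (c - (2 * c - y)) r * g (2 * c - y) = -(heatK ε 0 (c - y) r * g y) := by
    intro y
    rw [hg, heatK_zero, heatK_zero, show (c - (2 * c - y)) ^ 2 = (c - y) ^ 2 by ring]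
    ring
  simp only [h2, integral_neg] at h1
  rw [heatS]; linarith

/-- The heat semigroup as a Gaussian average, meaningful also at time `0`. -/
noncomputable def heatAvg (ε : ℝ) (g : ℝ → ℝ) (x r : ℝ) : ℝ :=
  ∫ q, (√Real.pi)⁻¹ * Real.exp (-q ^ 2) * g (x - √(4 * ε * r) * q)

/-- The substitution `y = x - √(4 ε r) q` removes the singularity of the kernel at `r = 0`. -/
lemma heatAvg_eq_heatS (hε : 0 < ε) (g : ℝ → ℝ) (x : ℝ) {r : ℝ} (hr : 0 < r) :
    heatAvg ε g x r = heatS ε 0 g x r := by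
  have hc : 0 < √(4 * ε * r) := by positivity
  have h1 : heatS ε 0 g x r = ∫ z, heatK ε 0 z r * g (x - z) := by
    rw [← integral_sub_left_eq_self _ volume x]
    simp [heatS]
  have h2 := Measure.integral_comp_mul_left (fun z => heatK ε 0 z r * g (x - z)) (√(4 * ε * r))
  rw [abs_of_pos (inv_pos.mpr hc), smul_eq_mul] at h2
  have h3 : ∀ q, heatK ε 0 (√(4 * ε * r) * q) r * g (x - √(4 * ε * r) * q) = (√(4 * ε * r))⁻¹ *
      ((√Real.pi)⁻¹ * Real.exp (-q ^ 2) * g (x - √(4 * ε * r) * q)) := by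
    intro q
    rw [heatK_zero, mul_pow, Real.sq_sqrt (by positivity),
      show 4 * Real.pi * ε * r = Real.pi * (4 * ε * r) by ring, Real.sqrt_mul Real.pi_pos.le,
      mul_div_cancel_left₀ _ (by positivity), mul_inv]
    ring
  simp only [h3] at h2
  rw [integral_const_mul] at h2
  rw [h1]
  exact mul_left_cancel₀ (inv_ne_zero hc.ne') h2

lemma integrable_gaussian_weight :
    Integrable (fun q : ℝ => (√Real.pi)⁻¹ * Real.exp (-q ^ 2)) := by
  have := integrable_exp_neg_mul_sq (b := 1) one_pos
  simp only [neg_one_mul] at this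
  exact this.const_mul _

lemma integral_gaussian_weight : ∫ q : ℝ, (√Real.pi)⁻¹ * Real.exp (-q ^ 2) = 1 := by
  have := integral_gaussian 1
  simp only [neg_one_mul, div_one] at this
  rw [integral_const_mul, this, inv_mul_cancel₀ (by have := Real.pi_pos; positivity)]

lemma heatAvg_of_nonpos (hε : 0 < ε) (g : ℝ → ℝ) (x : ℝ) {r : ℝ} (hr : r ≤ 0) :
    heatAvg ε g x r = g x := by
  have : √(4 * ε * r) = 0 :=
    Real.sqrt_eq_zero_of_nonpos (mul_nonpos_of_nonneg_of_nonpos (by positivity) hr)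
  simp only [heatAvg, this, zero_mul, sub_zero]
  rw [integral_mul_const, integral_gaussian_weight, one_mul]

lemma abs_heatAvg_le (g : ℝ → ℝ) {M : ℝ} (hM : ∀ y, |g y| ≤ M) (x r : ℝ) :
    |heatAvg ε g x r| ≤ M := by
  have : M = ∫ q : ℝ, (√Real.pi)⁻¹ * Real.exp (-q ^ 2) * M := by
    rw [integral_mul_const, integral_gaussian_weight, one_mul]
  rw [this, ← Real.norm_eq_abs, heatAvg]
  refine norm_integral_le_of_norm_le (integrable_gaussian_weight.mul_const M)
    (Eventually.of_forall fun q => ?_)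
  rw [norm_mul, Real.norm_eq_abs, Real.norm_eq_abs, abs_of_nonneg (by positivity)]
  have := hM (x - √(4 * ε * r) * q)
  gcongr

/-- The Gaussian weight no longer depends on `r`, so dominated convergence works down to `r = 0`.
There the continuity hypothesis only concerns the single point `x`. -/
lemma tendsto_heatAvg {ι : Type*} {l : Filter ι} [l.IsCountablyGenerated]
    {X R : ι → ℝ} {g : ℝ → ℝ} {x r M : ℝ} (hX : Tendsto X l (𝓝 x)) (hR : Tendsto R l (𝓝 r))
    (hg : Measurable g) (hM : ∀ y, |g y| ≤ M) (hgc : ∀ q, ContinuousAt g (x - √(4 * ε * r) * q)) :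
    Tendsto (fun i => heatAvg ε g (X i) (R i)) l (𝓝 (heatAvg ε g x r)) := by
  refine tendsto_integral_filter_of_dominated_convergence
    (fun q => (√Real.pi)⁻¹ * Real.exp (-q ^ 2) * M) ?_ ?_
    (integrable_gaussian_weight.mul_const M) ?_
  · exact Eventually.of_forall fun i => Measurable.aestronglyMeasurable (by fun_prop)
  · refine Eventually.of_forall fun i => Eventually.of_forall fun q => ?_
    rw [norm_mul, Real.norm_eq_abs, Real.norm_eq_abs, abs_of_nonneg (by positivity)]
    have := hM (X i - √(4 * ε * R i) * q)
    gcongr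
  · refine Eventually.of_forall fun q => Tendsto.const_mul _ ?_
    refine (hgc q).tendsto.comp (hX.sub (Tendsto.mul_const q ?_))
    exact (hR.const_mul (4 * ε)).sqrt

lemma continuous_heatAvg {g : ℝ → ℝ} {M : ℝ} (hg : Continuous g) (hM : ∀ y, |g y| ≤ M) :
    Continuous (fun q : ℝ × ℝ => heatAvg ε g q.1 q.2) :=
  continuous_iff_continuousAt.mpr fun q => tendsto_heatAvg (X := Prod.fst) (R := Prod.snd)
    (x := q.1) (r := q.2) continuous_fst.continuousAt continuous_snd.continuousAt hg.measurable hM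
    fun _ => hg.continuousAt

end heatS

/-! ### Volume potentials -/

/-- A bounded measurable source `f s y` (time, space), vanishing for `s ≤ 0` and continuous in
time for `s > 0`. -/
structure IsSource (M : ℝ) (f : ℝ → ℝ → ℝ) : Prop where
  measurable : Measurable (Function.uncurry f)
  bound : ∀ s y, |f s y| ≤ M
  eq_zero : ∀ s ≤ 0, ∀ y, f s y = 0
  continuousAt : ∀ s, 0 < s → ∀ y, ContinuousAt (fun s => f s y) s

/-- The volume potential of `f` for the heat equation on the line (`j = 0`) and its formal spatial
derivatives. -/
noncomputable def volPot (ε : ℝ) (j : ℕ) (f : ℝ → ℝ → ℝ) (x t : ℝ) : ℝ :=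
  ∫ r, heatS ε j (f (t - r)) x r

/-- The integrable singularity `c * r ^ (-p)` on `(0, b]`. -/
noncomputable def singWeight (c p b r : ℝ) : ℝ := (Ioc 0 b).indicator (fun r => c * r ^ (-p)) r

lemma integrable_singWeight (c : ℝ) {p : ℝ} (hp : p < 1) (b : ℝ) :
    Integrable (singWeight c p b) := by
  unfold singWeight
  rw [integrable_indicator_iff measurableSet_Ioc]
  rcases le_or_gt 0 b with hb | hb
  · rw [← intervalIntegrable_iff_integrableOn_Ioc_of_le hb]
    exact (intervalIntegral.intervalIntegrable_rpow' (by linarith)).const_mul c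
  · simp [Ioc_eq_empty_of_le hb.le]

lemma singWeight_nonneg {c p b r : ℝ} (hc : 0 ≤ c) : 0 ≤ singWeight c p b r := by
  unfold singWeight
  refine indicator_nonneg (fun r hr => ?_) r
  have := hr.1
  positivity

lemma singWeight_of_mem {c p b r : ℝ} (hr : r ∈ Ioc 0 b) : singWeight c p b r = c * r ^ (-p) :=
  indicator_of_mem hr _

section volPot

variable {ε M : ℝ} {f : ℝ → ℝ → ℝ}

lemma IsSource.measurable_slice (hf : IsSource M f) (s : ℝ) : Measurable (f s) :=
  hf.measurable.comp (f := fun y : ℝ => (s, y)) (by fun_prop)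

lemma IsSource.nonneg (hf : IsSource M f) : 0 ≤ M := (abs_nonneg _).trans (hf.bound 0 0)

lemma IsSource.sub {M' : ℝ} {f' : ℝ → ℝ → ℝ} (hf : IsSource M f) (hf' : IsSource M' f') :
    IsSource (M + M') (fun s y => f s y - f' s y) where
  measurable := hf.measurable.sub hf'.measurable
  bound s y := (abs_sub _ _).trans (add_le_add (hf.bound s y) (hf'.bound s y))
  eq_zero s hs y := by rw [hf.eq_zero s hs, hf'.eq_zero s hs, sub_zero]
  continuousAt s hs y := (hf.continuousAt s hs y).sub (hf'.continuousAt s hs y)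

lemma IsSource.tendsto (hf : IsSource M f) {s : ℝ} (hs : s ≠ 0) (y : ℝ) :
    ContinuousAt (fun s => f s y) s := by
  rcases lt_or_gt_of_ne hs with h | h
  · have : (fun s => f s y) =ᶠ[𝓝 s] fun _ => 0 := by
      filter_upwards [gt_mem_nhds h] with s' hs' using hf.eq_zero s' (le_of_lt hs') y
    exact continuousAt_const.congr this.symm
  · exact hf.continuousAt s h y

lemma heatS_source_eq_zero (hε : 0 < ε) (hf : IsSource M f) (j : ℕ) {x t r : ℝ}
    (hr : r ∉ Ioo 0 t) : heatS ε j (f (t - r)) x r = 0 := by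
  by_cases h : r ≤ 0
  · exact heatS_of_nonpos hε j _ x h
  · have : t - r ≤ 0 := by
      push Not at h
      simp only [mem_Ioo, not_and, not_lt] at hr
      linarith [hr h]
    simp [heatS, hf.eq_zero _ this]

lemma stronglyMeasurable_heatS_source (hf : IsSource M f) (j : ℕ) (x : ℝ) :
    StronglyMeasurable (fun p : ℝ × ℝ => heatS ε j (f p.2) x (p.1 - p.2)) := by
  have : Measurable (fun q : (ℝ × ℝ) × ℝ => heatK ε j (x - q.2) (q.1.1 - q.1.2) * f q.1.2 q.2) := by
    refine Measurable.mul ?_ ?_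
    · exact (measurable_heatK j).comp
        (f := fun q : (ℝ × ℝ) × ℝ => (x - q.2, q.1.1 - q.1.2)) (by fun_prop)
    · exact hf.measurable.comp (f := fun q : (ℝ × ℝ) × ℝ => (q.1.2, q.2)) (by fun_prop)
  exact this.stronglyMeasurable.integral_prod_right (f := fun p : ℝ × ℝ => fun y =>
    heatK ε j (x - y) (p.1 - p.2) * f p.2 y)

lemma aestronglyMeasurable_heatS_source (hf : IsSource M f) (j : ℕ) (x t : ℝ) :
    AEStronglyMeasurable (fun r => heatS ε j (f (t - r)) x r) := by
  have h := (stronglyMeasurable_heatS_source (ε := ε) hf j x).comp_measurable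
    (g := fun r : ℝ => (t, t - r)) (by fun_prop)
  refine h.aestronglyMeasurable.congr (Eventually.of_forall fun r => ?_)
  simp [Function.comp]

lemma abs_heatS_source_le (hε : 0 < ε) (j : ℕ) : ∃ C : ℝ, 0 < C ∧ ∀ {M : ℝ} {f : ℝ → ℝ → ℝ},
    IsSource M f → ∀ {t b : ℝ}, t ≤ b → ∀ x r : ℝ,
    |heatS ε j (f (t - r)) x r| ≤ singWeight (C * M) (j / 2) b r := by
  obtain ⟨C, hC, hCb⟩ := abs_heatS_le hε j
  refine ⟨C, hC, fun {M f} hf {t b} htb x r => ?_⟩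
  have hM := hf.nonneg
  by_cases hr : r ∈ Ioo 0 t
  · rw [singWeight_of_mem ⟨hr.1, hr.2.le.trans htb⟩]
    refine (hCb _ M x r (hf.bound _)).trans (le_of_eq ?_)
    rw [Real.sqrt_eq_rpow, ← Real.rpow_natCast, ← Real.rpow_mul hr.1.le, div_eq_mul_inv,
      ← Real.rpow_neg hr.1.le]
    ring_nf
  · rw [heatS_source_eq_zero hε hf j hr, abs_zero]
    exact singWeight_nonneg (by positivity)

lemma integrable_heatS_source (hε : 0 < ε) (hf : IsSource M f) {j : ℕ} (hj : j ≤ 1) (x t : ℝ) :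
    Integrable (fun r => heatS ε j (f (t - r)) x r) := by
  obtain ⟨C, hC, hCb⟩ := abs_heatS_source_le hε j
  have : (j : ℝ) ≤ 1 := by exact_mod_cast hj
  exact (integrable_singWeight (C * M) (by linarith : (j / 2 : ℝ) < 1) t).mono'
    (aestronglyMeasurable_heatS_source hf j x t)
    (Eventually.of_forall fun r => hCb hf le_rfl x r)

lemma volPot_sub (hε : 0 < ε) (hf : IsSource M f) {M' : ℝ} {f' : ℝ → ℝ → ℝ}
    (hf' : IsSource M' f') {j : ℕ} (hj : j ≤ 1) (x t : ℝ) :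
    volPot ε j (fun s y => f s y - f' s y) x t = volPot ε j f x t - volPot ε j f' x t := by
  unfold volPot
  rw [← integral_sub (integrable_heatS_source hε hf hj x t)
    (integrable_heatS_source hε hf' hj x t)]
  refine integral_congr_ae (Eventually.of_forall fun r => ?_)
  simp only [heatS]
  rw [← integral_sub (integrable_heatK_sub_mul hε j (hf.measurable_slice _) (hf.bound _) x r)
    (integrable_heatK_sub_mul hε j (hf'.measurable_slice _) (hf'.bound _) x r)]
  simp only [mul_sub]

lemma volPot_of_nonpos (hε : 0 < ε) (hf : IsSource M f) (j : ℕ) (x : ℝ) {t : ℝ} (ht : t ≤ 0) :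
    volPot ε j f x t = 0 := by
  have : ∀ r, heatS ε j (f (t - r)) x r = 0 := fun r =>
    heatS_source_eq_zero hε hf j (by rw [Ioo_eq_empty_of_le ht]; simp)
  simp [volPot, this]

lemma volPot_eq_zero_of_odd {c : ℝ} (hodd : ∀ s y, f s (2 * c - y) = -f s y) (t : ℝ) :
    volPot ε 0 f c t = 0 := by
  simp [volPot, heatS_eq_zero_of_odd (hodd _)]

lemma tendsto_heatS_source (hε : 0 < ε) (hf : IsSource M f) (j : ℕ) {x t r : ℝ} (hr : r ≠ 0)
    (hrt : r ≠ t) :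
    ContinuousAt (fun q : ℝ × ℝ => heatS ε j (f (q.2 - r)) q.1 r) (x, t) := by
  rcases le_or_gt r 0 with h | h
  · simp only [heatS_of_nonpos hε j _ _ h]
    exact continuousAt_const
  · refine tendsto_heatS hε j (R := fun _ => r) h continuous_fst.continuousAt tendsto_const_nhds
      (fun q => hf.measurable_slice _) (fun q => hf.bound _) fun y => ?_
    have h1 : Tendsto (fun q : ℝ × ℝ => q.2 - r) (𝓝 (x, t)) (𝓝 (t - r)) :=
      Continuous.tendsto (by fun_prop) (x, t)
    exact (hf.tendsto (sub_ne_zero.mpr hrt.symm) y).tendsto.comp h1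

/-- The integrand converges except at `r = 0`, where the kernel is singular, and at `r = t`, where
the source may jump at its time `0`. Both are null sets. -/
lemma continuousAt_volPot_of_bound (hε : 0 < ε) (hf : IsSource M f) (j : ℕ) {x t c p b : ℝ}
    (hp : p < 1)
    (hb : ∀ᶠ q : ℝ × ℝ in 𝓝 (x, t), ∀ r, |heatS ε j (f (q.2 - r)) q.1 r| ≤ singWeight c p b r) :
    ContinuousAt (fun q : ℝ × ℝ => volPot ε j f q.1 q.2) (x, t) := by
  refine tendsto_integral_filter_of_dominated_convergence (singWeight c p b)
    (Eventually.of_forall fun q => aestronglyMeasurable_heatS_source hf j q.1 q.2)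
    (hb.mono fun q hq => Eventually.of_forall hq) (integrable_singWeight c hp b) ?_
  filter_upwards [compl_mem_ae_iff.mpr (measure_singleton t),
    compl_mem_ae_iff.mpr (measure_singleton 0)] with r h1 h2
  exact tendsto_heatS_source hε hf j h2 h1

lemma continuous_volPot (hε : 0 < ε) (hf : IsSource M f) {j : ℕ} (hj : j ≤ 1) :
    Continuous (fun q : ℝ × ℝ => volPot ε j f q.1 q.2) := by
  obtain ⟨C, hC, hCb⟩ := abs_heatS_source_le hε j
  have hj' : (j : ℝ) ≤ 1 := by exact_mod_cast hj
  rw [continuous_iff_continuousAt]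
  rintro ⟨x, t⟩
  refine continuousAt_volPot_of_bound hε hf j (by linarith : (j / 2 : ℝ) < 1) (c := C * M)
    (b := t + 1) ?_
  have : ∀ᶠ q : ℝ × ℝ in 𝓝 (x, t), q.2 < t + 1 :=
    continuous_snd.continuousAt.eventually_lt_const (by simp)
  filter_upwards [this] with q hq r using hCb hf hq.le q.1 r

/-- The locally uniform integrable bound is the only thing that depends on the source: `p = 1/2` for
the first derivative of a bounded source, `p = 3/4` for the second derivative of a Hölder source. -/
lemma hasDerivAt_volPot_of_bound (hε : 0 < ε) (hf : IsSource M f) {j : ℕ} (hj : j ≤ 1)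
    {x t c p b : ℝ} (hp : p < 1)
    (hb : ∀ᶠ x' in 𝓝 x, ∀ r, |heatS ε (j + 1) (f (t - r)) x' r| ≤ singWeight c p b r) :
    HasDerivAt (fun y => volPot ε j f y t) (volPot ε (j + 1) f x t) x :=
  (hasDerivAt_integral_of_dominated_loc_of_deriv_le
    (F := fun x r => heatS ε j (f (t - r)) x r) (F' := fun x r => heatS ε (j + 1) (f (t - r)) x r)
    (bound := singWeight c p b) (μ := volume) hb
    (Eventually.of_forall fun x' => aestronglyMeasurable_heatS_source hf j x' t)
    (integrable_heatS_source hε hf hj x t)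
    (aestronglyMeasurable_heatS_source hf (j + 1) x t)
    (Eventually.of_forall fun r x' hx' => hx' r) (integrable_singWeight c hp b)
    (Eventually.of_forall fun r x' _ =>
      hasDerivAt_heatS_space hε j (hf.measurable_slice _) (hf.bound _) x' r)).2

lemma hasDerivAt_volPot (hε : 0 < ε) (hf : IsSource M f) (x t : ℝ) :
    HasDerivAt (fun y => volPot ε 0 f y t) (volPot ε 1 f x t) x := by
  obtain ⟨C, hC, hCb⟩ := abs_heatS_source_le hε 1
  exact hasDerivAt_volPot_of_bound hε hf zero_le_one (by norm_num : ((1 : ℕ) / 2 : ℝ) < 1)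
    (c := C * M) (b := t) (Eventually.of_forall fun x' r => hCb hf le_rfl x' r)

/-- Factoring `e^{lam t}` out of the bound at time `t - r` leaves `∫ e^{-lam r} r^{-j/2} dr` over
`(0, b]`, which tends to `0` as `lam → ∞` by dominated convergence. The threshold for `lam` does not
depend on the source, so large `lam` turns a Lipschitz map into a contraction without shortening the
time interval. -/
lemma abs_volPot_le_of_exp (hε : 0 < ε) (b : ℝ) {δ : ℝ} (hδ : 0 < δ) {j : ℕ} (hj : j ≤ 1) :
    ∀ᶠ lam : ℝ in atTop, ∀ {M A : ℝ} {f : ℝ → ℝ → ℝ}, IsSource M f → 0 ≤ A →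
      (∀ s y, |f s y| ≤ A * Real.exp (lam * s)) →
      ∀ x t, t ≤ b → |volPot ε j f x t| ≤ δ * A * Real.exp (lam * t) := by
  obtain ⟨C, hC, hCb⟩ := abs_heatS_le hε j
  have hj' : (j : ℝ) ≤ 1 := by exact_mod_cast hj
  have hint := integrable_singWeight C (by linarith : (j / 2 : ℝ) < 1) b
  have hlim : Tendsto (fun lam : ℝ => ∫ r, Real.exp (-(lam * r)) * singWeight C (j / 2) b r) atTop
      (𝓝 (∫ _ : ℝ, (0 : ℝ))) := by
    refine tendsto_integral_filter_of_dominated_convergence (singWeight C (j / 2) b) ?_ ?_ hint ?_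
    · exact Eventually.of_forall fun lam =>
        Continuous.aestronglyMeasurable (by fun_prop) |>.mul hint.aestronglyMeasurable
    · filter_upwards [eventually_ge_atTop 0] with lam hlam
      refine Eventually.of_forall fun r => ?_
      rw [norm_mul, Real.norm_eq_abs, Real.abs_exp, Real.norm_eq_abs,
        abs_of_nonneg (singWeight_nonneg hC.le)]
      by_cases hr : r ∈ Ioc 0 b
      · have : Real.exp (-(lam * r)) ≤ 1 := by
          rw [Real.exp_le_one_iff]
          have := hr.1
          have : 0 ≤ lam * r := by positivity
          linarith
        exact mul_le_of_le_one_left (singWeight_nonneg hC.le) this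
      · simp [singWeight, hr]
    · refine Eventually.of_forall fun r => ?_
      by_cases hr : r ∈ Ioc 0 b
      · have h1 : Tendsto (fun lam : ℝ => lam * r) atTop atTop :=
          tendsto_id.atTop_mul_const hr.1
        simpa using (Real.tendsto_exp_neg_atTop_nhds_zero.comp h1).mul_const
          (singWeight C (j / 2) b r)
      · simp [singWeight, hr]
  rw [integral_zero] at hlim
  filter_upwards [hlim.eventually_lt_const hδ, eventually_ge_atTop 0] with lam hlam hlam0
  intro M A f hf hA hfA x t htb
  have hb : ∀ r, ‖heatS ε j (f (t - r)) x r‖ ≤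
      A * Real.exp (lam * t) * (Real.exp (-(lam * r)) * singWeight C (j / 2) b r) := by
    intro r
    rw [Real.norm_eq_abs]
    by_cases hr : r ∈ Ioo 0 t
    · refine (hCb _ _ x r (fun y => hfA (t - r) y)).trans (le_of_eq ?_)
      rw [singWeight_of_mem ⟨hr.1, hr.2.le.trans htb⟩, mul_sub, Real.exp_sub, Real.exp_neg,
        Real.sqrt_eq_rpow, ← Real.rpow_natCast, ← Real.rpow_mul hr.1.le, div_eq_mul_inv,
        ← Real.rpow_neg hr.1.le]
      ring_nf
    · rw [heatS_source_eq_zero hε hf j hr, abs_zero]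
      have := singWeight_nonneg (p := (j / 2 : ℝ)) (b := b) (r := r) hC.le
      positivity
  have hint2 : Integrable (fun r => Real.exp (-(lam * r)) * singWeight C (j / 2) b r) := by
    refine hint.mono' ?_ ?_
    · exact Continuous.aestronglyMeasurable (by fun_prop) |>.mul hint.aestronglyMeasurable
    · refine Eventually.of_forall fun r => ?_
      rw [norm_mul, Real.norm_eq_abs, Real.abs_exp, Real.norm_eq_abs,
        abs_of_nonneg (singWeight_nonneg hC.le)]
      by_cases hr : r ∈ Ioc 0 b
      · have : Real.exp (-(lam * r)) ≤ 1 := by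
          rw [Real.exp_le_one_iff]
          have := hr.1
          have : 0 ≤ lam * r := by positivity
          linarith
        exact mul_le_of_le_one_left (singWeight_nonneg hC.le) this
      · simp [singWeight, hr]
  have := norm_integral_le_of_norm_le (hint2.const_mul (A * Real.exp (lam * t)))
    (Eventually.of_forall hb)
  rw [integral_const_mul, Real.norm_eq_abs] at this
  refine this.trans ?_
  calc _ ≤ A * Real.exp (lam * t) * δ := by gcongr
    _ = _ := by ring

/-- The spatial derivative of the volume potential of a bounded source is Hölder continuous. -/
lemma abs_volPot_one_sub_le (hε : 0 < ε) (hf : IsSource M f) (b : ℝ) : ∃ C : ℝ, 0 ≤ C ∧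
    ∀ t ≤ b, ∀ x x', |volPot ε 1 f x t - volPot ε 1 f x' t| ≤ C * √|x - x'| := by
  obtain ⟨C, hC, hCb⟩ := abs_heatS_le hε 1
  obtain ⟨D, hD, hDb⟩ := abs_heatS_le hε 2
  have hM := hf.nonneg
  have hpt : ∀ g : ℝ → ℝ, Measurable g → (∀ y, |g y| ≤ M) → ∀ x x' r : ℝ, 0 < r →
      |heatS ε 1 g x r - heatS ε 1 g x' r| ≤ √(2 * C * D) * M * r ^ (-(3 / 4) : ℝ) * √|x - x'| := by
    intro g hg hgM x x' r hr
    have h1 : |heatS ε 1 g x r - heatS ε 1 g x' r| ≤ 2 * C * M / √r := by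
      have a1 := hCb g M x r hgM
      have a2 := hCb g M x' r hgM
      rw [pow_one] at a1 a2
      refine (abs_sub _ _).trans ((add_le_add a1 a2).trans (le_of_eq (by ring)))
    have h2 : |heatS ε 1 g x r - heatS ε 1 g x' r| ≤ D * M / r * |x - x'| := by
      have := Convex.norm_image_sub_le_of_norm_hasDerivWithin_le (s := univ)
        (f := fun x => heatS ε 1 g x r) (f' := fun x => heatS ε 2 g x r) (C := D * M / r)
        (fun y _ => (hasDerivAt_heatS_space hε 1 hg hgM y r).hasDerivWithinAt)
        (fun y _ => by
          have := hDb g M y r hgM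
          rwa [Real.sq_sqrt hr.le] at this) convex_univ (mem_univ x') (mem_univ x)
      simpa [Real.norm_eq_abs] using this
    -- Interpolation: the geometric mean of the size bound `r^{-1/2}` and the Lipschitz bound
    -- `r^{-1} |x - x'|` is `r^{-3/4} |x - x'|^{1/2}`, integrable at `r = 0`.
    have h3 : |heatS ε 1 g x r - heatS ε 1 g x' r| ^ 2 ≤
        (2 * C * M / √r) * (D * M / r * |x - x'|) := by
      rw [sq]; gcongr
    have h4 : (2 * C * M / √r) * (D * M / r * |x - x'|) =
        (√(2 * C * D) * M * r ^ (-(3 / 4) : ℝ) * √|x - x'|) ^ 2 := by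
      rw [mul_pow, mul_pow, mul_pow, Real.sq_sqrt (by positivity), Real.sq_sqrt (abs_nonneg _),
        ← Real.rpow_natCast (r ^ _), ← Real.rpow_mul hr.le]
      have : r ^ (-(3 / 4) * ((2 : ℕ) : ℝ) : ℝ) = (√r)⁻¹ * r⁻¹ := by
        rw [Real.sqrt_eq_rpow, ← Real.rpow_neg hr.le, ← Real.rpow_neg_one r, ← Real.rpow_add hr]
        norm_num
      rw [this]
      ring
    rw [h4] at h3
    exact le_of_sq_le_sq h3 (by positivity)
  have hint := integrable_singWeight (√(2 * C * D) * M) (by norm_num : (3 / 4 : ℝ) < 1) b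
  refine ⟨∫ r, singWeight (√(2 * C * D) * M) (3 / 4) b r,
    integral_nonneg fun r => singWeight_nonneg (by positivity), fun t ht x x' => ?_⟩
  unfold volPot
  rw [← integral_sub (integrable_heatS_source hε hf le_rfl x t)
    (integrable_heatS_source hε hf le_rfl x' t), ← integral_mul_const, ← Real.norm_eq_abs]
  refine norm_integral_le_of_norm_le (hint.mul_const _) (Eventually.of_forall fun r => ?_)
  rw [Real.norm_eq_abs]
  by_cases hr : r ∈ Ioo 0 t
  · rw [singWeight_of_mem ⟨hr.1, hr.2.le.trans ht⟩]
    exact hpt _ (hf.measurable_slice _) (hf.bound _) x x' r hr.1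
  · rw [heatS_source_eq_zero hε hf 1 hr, heatS_source_eq_zero hε hf 1 hr, sub_zero, abs_zero]
    have := singWeight_nonneg (c := √(2 * C * D) * M) (p := 3 / 4) (b := b) (r := r) (by positivity)
    positivity

end volPot

/-! ### Volume potentials of locally Hölder continuous sources -/

section volPotRegularity

variable {ε M H x₁ x₂ t₁ : ℝ} {f : ℝ → ℝ → ℝ}

lemma abs_heatS_two_source_le (hε : 0 < ε) (hf : IsSource M f) (hH0 : 0 ≤ H)
    (hH : ∀ x ∈ Ioo x₁ x₂, ∀ s, t₁ ≤ s → ∀ y, |f s y - f s x| ≤ H * √|y - x|) {t₂ : ℝ}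
    (ht : t₁ < t₂) (b : ℝ) : ∃ C : ℝ, 0 ≤ C ∧ ∀ x ∈ Ioo x₁ x₂, ∀ t ∈ Icc t₂ b, ∀ r,
      |heatS ε 2 (f (t - r)) x r| ≤ singWeight C (3 / 4) b r := by
  obtain ⟨C, hC, hCb⟩ := abs_heatS_two_le hε
  obtain ⟨D, hD, hDb⟩ := abs_heatS_le hε 2
  have hM := hf.nonneg
  have hd : 0 < t₂ - t₁ := sub_pos.mpr ht
  refine ⟨C * H + D * M * (t₂ - t₁) ^ (-(1 / 4) : ℝ), by positivity, fun x hx t ht r => ?_⟩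
  by_cases hr : r ∈ Ioo 0 t
  · rw [singWeight_of_mem ⟨hr.1, hr.2.le.trans ht.2⟩, add_mul]
    have hr0 := hr.1
    -- For small `r` the source time `t - r` is still at least `t₁` and the Hölder bound applies.
    -- For larger `r` the kernel is not singular, and the crude bound `r^{-1}` is at most a constant
    -- times `r^{-3/4}`.
    rcases le_or_gt r (t₂ - t₁) with h | h
    · refine (hCb _ M H x r (hf.measurable_slice _) (hf.bound _) hH0
        (hH x hx (t - r) (by linarith [ht.1])) hr.1).trans ?_
      have : 0 ≤ D * M * (t₂ - t₁) ^ (-(1 / 4) : ℝ) * r ^ (-(3 / 4) : ℝ) := by positivity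
      linarith
    · have h1 := hDb (f (t - r)) M x r (hf.bound _)
      rw [Real.sq_sqrt hr.1.le] at h1
      have h2 : r⁻¹ ≤ (t₂ - t₁) ^ (-(1 / 4) : ℝ) * r ^ (-(3 / 4) : ℝ) := by
        have h3 : r⁻¹ = r ^ (-(1 / 4) : ℝ) * r ^ (-(3 / 4) : ℝ) := by
          rw [← Real.rpow_add hr.1, ← Real.rpow_neg_one]; norm_num
        rw [h3]
        gcongr ?_ * _
        exact Real.rpow_le_rpow_of_nonpos hd h.le (by norm_num)
      have h4 : 0 ≤ C * H * r ^ (-(3 / 4) : ℝ) := by positivity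
      calc _ ≤ D * M * r⁻¹ := by rw [← div_eq_mul_inv]; exact h1
        _ ≤ D * M * ((t₂ - t₁) ^ (-(1 / 4) : ℝ) * r ^ (-(3 / 4) : ℝ)) := by gcongr
        _ ≤ _ := by linarith
  · rw [heatS_source_eq_zero hε hf 2 hr, abs_zero]
    exact singWeight_nonneg (by positivity)

lemma hasDerivAt_volPot_one (hε : 0 < ε) (hf : IsSource M f) (hH0 : 0 ≤ H)
    (hH : ∀ x ∈ Ioo x₁ x₂, ∀ s, t₁ ≤ s → ∀ y, |f s y - f s x| ≤ H * √|y - x|) {x t : ℝ}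
    (hx : x ∈ Ioo x₁ x₂) (ht : t₁ < t) :
    HasDerivAt (fun y => volPot ε 1 f y t) (volPot ε 2 f x t) x := by
  obtain ⟨C, hC, hCb⟩ := abs_heatS_two_source_le hε hf hH0 hH ht t
  refine hasDerivAt_volPot_of_bound hε hf le_rfl (by norm_num : (3 / 4 : ℝ) < 1) (c := C)
    (b := t) ?_
  filter_upwards [Ioo_mem_nhds hx.1 hx.2] with x' hx' r using hCb x' hx' t ⟨le_rfl, le_rfl⟩ r

lemma continuousAt_volPot_two (hε : 0 < ε) (hf : IsSource M f) (hH0 : 0 ≤ H)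
    (hH : ∀ x ∈ Ioo x₁ x₂, ∀ s, t₁ ≤ s → ∀ y, |f s y - f s x| ≤ H * √|y - x|) {x t : ℝ}
    (hx : x ∈ Ioo x₁ x₂) (ht : t₁ < t) :
    ContinuousAt (fun q : ℝ × ℝ => volPot ε 2 f q.1 q.2) (x, t) := by
  obtain ⟨t₂, h1, h2⟩ := exists_between ht
  obtain ⟨C, hC, hCb⟩ := abs_heatS_two_source_le hε hf hH0 hH h1 (t + 1)
  refine continuousAt_volPot_of_bound hε hf 2 (by norm_num : (3 / 4 : ℝ) < 1) (c := C)
    (b := t + 1) ?_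
  have : Ioo x₁ x₂ ×ˢ Ioo t₂ (t + 1) ∈ 𝓝 (x, t) :=
    prod_mem_nhds (Ioo_mem_nhds hx.1 hx.2) (Ioo_mem_nhds h2 (by linarith))
  filter_upwards [this] with q hq r using hCb q.1 hq.1 q.2 ⟨hq.2.1.le, hq.2.2.le⟩ r

lemma continuousAt_of_sqrt_bound {g : ℝ → ℝ} {x : ℝ} (h : ∀ y, |g y - g x| ≤ H * √|y - x|) :
    ContinuousAt g x := by
  rw [ContinuousAt, tendsto_iff_dist_tendsto_zero]
  have h1 : Tendsto (fun y => H * √|y - x|) (𝓝 x) (𝓝 0) := by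
    have : Tendsto (fun y => H * √|y - x|) (𝓝 x) (𝓝 (H * √|x - x|)) :=
      Continuous.tendsto (by fun_prop) x
    simpa using this
  exact squeeze_zero (fun y => dist_nonneg) h h1

/-- Integral form of the heat equation for the volume potential. -/
lemma volPot_sub_eq_integral (hε : 0 < ε) (hf : IsSource M f) (hH0 : 0 ≤ H)
    (hH : ∀ x ∈ Ioo x₁ x₂, ∀ s, t₁ ≤ s → ∀ y, |f s y - f s x| ≤ H * √|y - x|) {x ta tb : ℝ}
    (hx : x ∈ Ioo x₁ x₂) (hta : t₁ < ta) (hab : ta ≤ tb) :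
    volPot ε 0 f x tb - volPot ε 0 f x ta =
      ∫ τ in ta..tb, (ε * volPot ε 2 f x τ + f τ x) := by
  obtain ⟨C, hC, hCb⟩ := abs_heatS_two_source_le hε hf hH0 hH hta tb
  have hwint := integrable_singWeight C (by norm_num : (3 / 4 : ℝ) < 1) tb
  have hshift : ∀ s τ : ℝ, heatS ε 2 (f s) x (τ - s) = heatS ε 2 (f (τ - (τ - s))) x (τ - s) := by
    intro s τ; rw [sub_sub_cancel]
  -- the fundamental theorem of calculus for the heat flow started at time `s`
  have hFTC : ∀ s, ∫ τ in ta..tb, ε * heatS ε 2 (f s) x (τ - s) =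
      heatAvg ε (f s) x (tb - s) - heatAvg ε (f s) x (ta - s) := by
    intro s
    rcases le_or_gt tb s with hs | hs
    · have h0 : ∀ τ ∈ uIcc ta tb, ε * heatS ε 2 (f s) x (τ - s) = 0 := by
        intro τ hτ
        rw [uIcc_of_le hab] at hτ
        rw [heatS_of_nonpos hε 2 _ _ (by linarith [hτ.2]), mul_zero]
      rw [intervalIntegral.integral_congr h0, heatAvg_of_nonpos hε _ _ (by linarith),
        heatAvg_of_nonpos hε _ _ (by linarith)]
      simp
    -- The flow started at time `s` contributes nothing before `s`, so the fundamental theorem is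
    -- applied on `[c, tb]` only.
    set c := max s ta with hc
    have hctb : c ≤ tb := max_le hs.le hab
    have hmeas : AEStronglyMeasurable (fun τ => ε * heatS ε 2 (f s) x (τ - s)) := by
      have h := (stronglyMeasurable_heatS_source (ε := ε) hf 2 x).comp_measurable
        (g := fun τ : ℝ => (τ, s)) (by fun_prop)
      exact (h.const_mul ε).aestronglyMeasurable
    have hint : IntervalIntegrable (fun τ => ε * heatS ε 2 (f s) x (τ - s)) volume ta tb := by
      rw [intervalIntegrable_iff_integrableOn_Ioc_of_le hab]
      refine Integrable.mono' (((hwint.comp_sub_right s).const_mul ε).restrict)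
        hmeas.restrict ?_
      refine (ae_restrict_mem measurableSet_Ioc).mono fun τ hτ => ?_
      rw [norm_mul, Real.norm_eq_abs, Real.norm_eq_abs, abs_of_pos hε, hshift]
      gcongr
      exact hCb x hx τ ⟨hτ.1.le, hτ.2⟩ _
    have hint1 : IntervalIntegrable (fun τ => ε * heatS ε 2 (f s) x (τ - s)) volume ta c :=
      hint.mono_set (by
        rw [uIcc_of_le hab, uIcc_of_le (le_max_right _ _)]; exact Icc_subset_Icc le_rfl hctb)
    have hint2 : IntervalIntegrable (fun τ => ε * heatS ε 2 (f s) x (τ - s)) volume c tb :=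
      hint.mono_set (by
        rw [uIcc_of_le hab, uIcc_of_le hctb]; exact Icc_subset_Icc (le_max_right _ _) le_rfl)
    rw [← intervalIntegral.integral_add_adjacent_intervals hint1 hint2]
    have hz : ∫ τ in ta..c, ε * heatS ε 2 (f s) x (τ - s) = 0 := by
      rcases le_total s ta with h | h
      · rw [hc, max_eq_right h, intervalIntegral.integral_same]
      · have h0 : ∀ τ ∈ uIcc ta c, ε * heatS ε 2 (f s) x (τ - s) = 0 := by
          intro τ hτ
          rw [uIcc_of_le (le_max_right _ _), hc, max_eq_left h] at hτ
          rw [heatS_of_nonpos hε 2 _ _ (by linarith [hτ.2]), mul_zero]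
        rw [intervalIntegral.integral_congr h0]; simp
    have hcc : heatAvg ε (f s) x (c - s) = heatAvg ε (f s) x (ta - s) := by
      rcases le_total s ta with h | h
      · rw [hc, max_eq_right h]
      · rw [hc, max_eq_left h, heatAvg_of_nonpos hε _ _ (by linarith),
          heatAvg_of_nonpos hε _ _ (by linarith)]
    rw [hz, zero_add, ← hcc]
    have hd : ∀ τ, s < τ → HasDerivAt (fun τ => heatAvg ε (f s) x (τ - s))
        (ε * heatS ε 2 (f s) x (τ - s)) τ := by
      intro τ hτ
      have h1 := (hasDerivAt_heatS_time hε 0 (hf.measurable_slice s) (hf.bound s) x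
        (sub_pos.mpr hτ)).comp_sub_const τ s
      refine h1.congr_of_eventuallyEq ?_
      filter_upwards [lt_mem_nhds hτ] with τ' hτ'
      exact heatAvg_eq_heatS hε _ _ (sub_pos.mpr hτ')
    refine intervalIntegral.integral_eq_sub_of_hasDerivAt_of_le hctb ?_
      (fun τ hτ => hd τ ((le_max_left s ta).trans_lt hτ.1)) hint2
    intro τ hτ
    -- At the starting instant `τ = s` continuity of the heat average needs `f s` continuous at `x`.
    -- This case forces `s ≥ ta > t₁`, so the Hölder bound supplies it.
    rcases ((le_max_left s ta).trans hτ.1).eq_or_lt with h | h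
    · have hcs : ContinuousAt (f s) x := by
        have : ta ≤ s := h ▸ (le_max_right s ta).trans hτ.1
        exact continuousAt_of_sqrt_bound (hH x hx s (by linarith))
      refine ContinuousAt.continuousWithinAt ?_
      have h1 : Tendsto (fun τ' => τ' - s) (𝓝 τ) (𝓝 (τ - s)) :=
        Continuous.tendsto (by fun_prop) τ
      refine tendsto_heatAvg tendsto_const_nhds h1 (hf.measurable_slice s) (hf.bound s) ?_
      intro q
      rw [← h, sub_self, mul_zero, Real.sqrt_zero, zero_mul, sub_zero]
      exact hcs
    · exact (hd τ h).continuousAt.continuousWithinAt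
  -- integrate over the starting time
  have hV : ∀ j t, volPot ε j f x t = ∫ s, heatS ε j (f s) x (t - s) := by
    intro j t
    rw [volPot, ← integral_sub_left_eq_self _ volume t]
    simp
  have hVint : ∀ t, Integrable (fun s => heatS ε 0 (f s) x (t - s)) := by
    intro t
    have := (integrable_heatS_source hε hf zero_le_one x t).comp_sub_left t
    simpa using this
  have hfm : Measurable (fun s => f s x) :=
    hf.measurable.comp (f := fun s : ℝ => (s, x)) (by fun_prop)
  have hfint : IntegrableOn (fun s => f s x) (Ioc ta tb) :=
    Measure.integrableOn_of_bounded (M := M) (by simp) hfm.aestronglyMeasurable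
      (Eventually.of_forall fun s => hf.bound s x)
  have hindint : Integrable ((Ioc ta tb).indicator fun s => f s x) :=
    hfint.integrable_indicator measurableSet_Ioc
  -- At nonpositive times `heatAvg` returns `f s x` while `heatS` returns `0`. The mismatch at the
  -- lower limit for `ta < s < tb` is where the source term of the heat equation comes from; after
  -- `tb` the two copies cancel.
  have hsplit : (fun s => heatAvg ε (f s) x (tb - s) - heatAvg ε (f s) x (ta - s)) =ᵐ[volume]
      fun s => heatS ε 0 (f s) x (tb - s) - heatS ε 0 (f s) x (ta - s)
        - (Ioc ta tb).indicator (fun s => f s x) s := by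
    filter_upwards [compl_mem_ae_iff.mpr (measure_singleton ta),
      compl_mem_ae_iff.mpr (measure_singleton tb)] with s h1 h2
    rcases lt_or_gt_of_ne h1 with h | h
    · rw [heatAvg_eq_heatS hε _ _ (by linarith), heatAvg_eq_heatS hε _ _ (by linarith),
        indicator_of_notMem (fun hs => by linarith [hs.1]), sub_zero]
    · rcases lt_or_gt_of_ne h2 with h' | h'
      · rw [heatAvg_eq_heatS hε _ _ (by linarith), heatAvg_of_nonpos hε _ _ (by linarith),
          heatS_of_nonpos hε _ _ _ (by linarith : ta - s ≤ 0),
          indicator_of_mem (show s ∈ Ioc ta tb from ⟨h, le_of_lt h'⟩)]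
        ring
      · rw [heatAvg_of_nonpos hε _ _ (by linarith), heatAvg_of_nonpos hε _ _ (by linarith),
          heatS_of_nonpos hε _ _ _ (by linarith), heatS_of_nonpos hε _ _ _ (by linarith),
          indicator_of_notMem (fun hs => by linarith [hs.2])]
        ring
  have hleft : ∫ s, (heatAvg ε (f s) x (tb - s) - heatAvg ε (f s) x (ta - s)) =
      volPot ε 0 f x tb - volPot ε 0 f x ta - ∫ s in ta..tb, f s x := by
    have hdiff : Integrable (fun s => heatS ε 0 (f s) x (tb - s) - heatS ε 0 (f s) x (ta - s)) :=
      (hVint tb).sub (hVint ta)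
    rw [integral_congr_ae hsplit, integral_sub hdiff hindint,
      integral_sub (hVint tb) (hVint ta), ← hV, ← hV, integral_indicator measurableSet_Ioc,
      intervalIntegral.integral_of_le hab]
  have hprod : Integrable (fun p : ℝ × ℝ => ε * heatS ε 2 (f p.2) x (p.1 - p.2))
      ((volume.restrict (Ioc ta tb)).prod volume) := by
    -- The Fubini majorant is the indicator of `(0, tb]` in `s` times the singular weight in `τ -
    -- s`, integrable as the integrand of a convolution.
    have h1 : Integrable ((Ioc 0 tb).indicator fun _ : ℝ => (1 : ℝ)) :=
      (integrable_indicator_iff measurableSet_Ioc).mpr (by simp)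
    have h2 := h1.convolution_integrand (ContinuousLinearMap.mul ℝ ℝ) hwint
    have h3 := (h2.const_mul ε).mono_measure (ν := volume.prod volume)
      (μ := (volume.restrict (Ioc ta tb)).prod volume)
      (Measure.prod_mono Measure.restrict_le_self le_rfl)
    refine h3.mono' ((stronglyMeasurable_heatS_source (ε := ε) hf 2 x).const_mul
      ε).aestronglyMeasurable ?_
    have hmem : ∀ᵐ p : ℝ × ℝ ∂((volume.restrict (Ioc ta tb)).prod volume), p.1 ∈ Ioc ta tb := by
      have : ∀ᵐ τ : ℝ ∂(volume.restrict (Ioc ta tb)), τ ∈ Ioc ta tb :=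
        ae_restrict_mem measurableSet_Ioc
      exact Measure.quasiMeasurePreserving_fst.ae this
    filter_upwards [hmem] with p hp
    rw [norm_mul, Real.norm_eq_abs, Real.norm_eq_abs, abs_of_pos hε]
    gcongr
    by_cases hs : p.2 ∈ Ioc 0 tb
    · rw [indicator_of_mem hs, ContinuousLinearMap.mul_apply', one_mul, hshift]
      exact hCb x hx p.1 ⟨hp.1.le, hp.2⟩ _
    · rw [indicator_of_notMem hs, ContinuousLinearMap.mul_apply', zero_mul]
      have : heatS ε 2 (f p.2) x (p.1 - p.2) = 0 := by
        rw [hshift]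
        refine heatS_source_eq_zero hε hf 2 fun h => hs ⟨by linarith [h.2], ?_⟩
        linarith [h.1, hp.2]
      rw [this, abs_zero]
  have hswap := integral_integral_swap
    (f := fun τ s => ε * heatS ε 2 (f s) x (τ - s)) hprod
  have e1 : ∫ s, ∫ τ in Ioc ta tb, ε * heatS ε 2 (f s) x (τ - s) =
      ∫ s, (heatAvg ε (f s) x (tb - s) - heatAvg ε (f s) x (ta - s)) := by
    refine integral_congr_ae (Eventually.of_forall fun s => ?_)
    simp only
    rw [← hFTC s, intervalIntegral.integral_of_le hab]
  have e2 : ∫ τ in Ioc ta tb, ∫ s, ε * heatS ε 2 (f s) x (τ - s) =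
      ∫ τ in ta..tb, ε * volPot ε 2 f x τ := by
    rw [intervalIntegral.integral_of_le hab]
    refine integral_congr_ae (Eventually.of_forall fun τ => ?_)
    simp only
    rw [hV 2 τ, integral_const_mul]
  have hcont : ContinuousOn (fun τ => ε * volPot ε 2 f x τ) (Icc ta tb) := fun τ hτ => by
    have h1 := continuousAt_volPot_two hε hf hH0 hH hx (hta.trans_le hτ.1)
    have h2 : ContinuousAt (fun τ => volPot ε 2 f x τ) τ :=
      ContinuousAt.comp (f := fun τ : ℝ => (x, τ)) h1 (by fun_prop)
    exact (continuousAt_const.mul h2).continuousWithinAt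
  rw [intervalIntegral.integral_add (hcont.intervalIntegrable_of_Icc hab)
    ((intervalIntegrable_iff_integrableOn_Ioc_of_le hab).mpr hfint), ← e2, hswap, e1, hleft]
  ring

/-- The integral identity has a continuous integrand for `τ > t₁`, so the fundamental theorem of
calculus gives the time derivative with no differentiation across the singularity `r = 0`. -/
lemma hasDerivAt_volPot_time (hε : 0 < ε) (hf : IsSource M f) (hH0 : 0 ≤ H)
    (hH : ∀ x ∈ Ioo x₁ x₂, ∀ s, t₁ ≤ s → ∀ y, |f s y - f s x| ≤ H * √|y - x|) {x t : ℝ}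
    (hx : x ∈ Ioo x₁ x₂) (ht : t₁ < t) (ht₁ : 0 ≤ t₁) :
    HasDerivAt (fun τ => volPot ε 0 f x τ) (ε * volPot ε 2 f x t + f t x) t := by
  obtain ⟨ta, h1, h2⟩ := exists_between ht
  have hta0 : 0 < ta := by linarith
  have hc : ∀ τ, ta ≤ τ → ContinuousAt (fun τ => ε * volPot ε 2 f x τ + f τ x) τ := by
    intro τ hτ
    have h3 := continuousAt_volPot_two hε hf hH0 hH hx (h1.trans_le hτ)
    have h4 : ContinuousAt (fun τ => volPot ε 2 f x τ) τ :=
      ContinuousAt.comp (f := fun τ : ℝ => (x, τ)) h3 (by fun_prop)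
    exact (continuousAt_const.mul h4).add (hf.continuousAt τ (by linarith) x)
  have hco : ContinuousOn (fun τ => ε * volPot ε 2 f x τ + f τ x) (Ioi ta) :=
    fun τ hτ => (hc τ (le_of_lt hτ)).continuousWithinAt
  have hii : IntervalIntegrable (fun τ => ε * volPot ε 2 f x τ + f τ x) volume ta t :=
    ContinuousOn.intervalIntegrable_of_Icc h2.le fun τ hτ => (hc τ hτ.1).continuousWithinAt
  have h5 := intervalIntegral.integral_hasDerivAt_right hii
    (hco.stronglyMeasurableAtFilter isOpen_Ioi t h2) (hc t h2.le)
  refine (h5.add_const (volPot ε 0 f x ta)).congr_of_eventuallyEq ?_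
  filter_upwards [lt_mem_nhds h2] with τ hτ
  rw [← volPot_sub_eq_integral hε hf hH0 hH hx h1 (le_of_lt hτ)]
  ring

end volPotRegularity

/-! ### Double layer potentials -/

/-- A bounded boundary datum, vanishing for `s ≤ 0` and continuous for `s > 0`. -/
structure IsBoundaryDatum (M : ℝ) (ψ : ℝ → ℝ) : Prop where
  measurable : Measurable ψ
  bound : ∀ s, |ψ s| ≤ M
  eq_zero : ∀ s ≤ 0, ψ s = 0
  continuousAt : ∀ s, 0 < s → ContinuousAt ψ s

/-- The solution of the heat equation on the half line `x > 0` with zero initial values and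
boundary values `ψ`. -/
noncomputable def dblLayer (ε : ℝ) (ψ : ℝ → ℝ) (x t : ℝ) : ℝ :=
  ∫ q in Ioi 0, 2 * (√Real.pi)⁻¹ * Real.exp (-q ^ 2) * ψ (t - x ^ 2 / (4 * ε * q ^ 2))

/-- Convolution in time with the `j`-th derivative of the heat kernel. -/
noncomputable def layerPot (ε : ℝ) (j : ℕ) (ψ : ℝ → ℝ) (x t : ℝ) : ℝ :=
  ∫ r, heatK ε j x r * ψ (t - r)

section dblLayer

variable {ε M : ℝ} {ψ : ℝ → ℝ}

lemma IsBoundaryDatum.nonneg (hψ : IsBoundaryDatum M ψ) : 0 ≤ M :=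
  (abs_nonneg _).trans (hψ.bound 0)

lemma IsBoundaryDatum.continuousAt_of_ne (hψ : IsBoundaryDatum M ψ) {s : ℝ} (hs : s ≠ 0) :
    ContinuousAt ψ s := by
  rcases lt_or_gt_of_ne hs with h | h
  · have : ψ =ᶠ[𝓝 s] fun _ => 0 := by
      filter_upwards [gt_mem_nhds h] with s' hs' using hψ.eq_zero s' (le_of_lt hs')
    exact continuousAt_const.congr this.symm
  · exact hψ.continuousAt s h

lemma IsBoundaryDatum.sub {M' : ℝ} {ψ' : ℝ → ℝ} (hψ : IsBoundaryDatum M ψ)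
    (hψ' : IsBoundaryDatum M' ψ') : IsBoundaryDatum (M + M') (fun s => ψ s - ψ' s) where
  measurable := hψ.measurable.sub hψ'.measurable
  bound s := (abs_sub _ _).trans (add_le_add (hψ.bound s) (hψ'.bound s))
  eq_zero s hs := by rw [hψ.eq_zero s hs, hψ'.eq_zero s hs, sub_zero]
  continuousAt s hs := (hψ.continuousAt s hs).sub (hψ'.continuousAt s hs)

lemma integrable_half_gaussian_weight :
    IntegrableOn (fun q : ℝ => 2 * (√Real.pi)⁻¹ * Real.exp (-q ^ 2)) (Ioi 0) := by
  have := (integrable_gaussian_weight.const_mul 2).integrableOn (s := Ioi 0)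
  simpa only [mul_assoc] using this

lemma integral_half_gaussian_weight :
    ∫ q in Ioi (0 : ℝ), 2 * (√Real.pi)⁻¹ * Real.exp (-q ^ 2) = 1 := by
  have := integral_gaussian_Ioi 1
  simp only [neg_one_mul, div_one] at this
  rw [integral_const_mul, this]
  have := Real.pi_pos
  field_simp

lemma measurable_dblLayer_integrand (hψ : Measurable ψ) (x t : ℝ) : Measurable (fun q : ℝ =>
    2 * (√Real.pi)⁻¹ * Real.exp (-q ^ 2) * ψ (t - x ^ 2 / (4 * ε * q ^ 2))) := by
  fun_prop

lemma norm_dblLayer_integrand_le (hM : ∀ s, |ψ s| ≤ M) (x t q : ℝ) :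
    ‖2 * (√Real.pi)⁻¹ * Real.exp (-q ^ 2) * ψ (t - x ^ 2 / (4 * ε * q ^ 2))‖ ≤
      2 * (√Real.pi)⁻¹ * Real.exp (-q ^ 2) * M := by
  rw [norm_mul, Real.norm_eq_abs, Real.norm_eq_abs, abs_of_nonneg (by positivity)]
  have := hM (t - x ^ 2 / (4 * ε * q ^ 2))
  gcongr

lemma integrable_dblLayer_integrand (hψ : Measurable ψ) (hM : ∀ s, |ψ s| ≤ M) (x t : ℝ) :
    IntegrableOn (fun q : ℝ =>
      2 * (√Real.pi)⁻¹ * Real.exp (-q ^ 2) * ψ (t - x ^ 2 / (4 * ε * q ^ 2))) (Ioi 0) :=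
  (integrable_half_gaussian_weight.mul_const M).mono'
    (measurable_dblLayer_integrand hψ x t).aestronglyMeasurable
    (Eventually.of_forall (norm_dblLayer_integrand_le hM x t))

lemma dblLayer_sub (hψ : IsBoundaryDatum M ψ) {M' : ℝ} {ψ' : ℝ → ℝ}
    (hψ' : IsBoundaryDatum M' ψ') (x t : ℝ) :
    dblLayer ε (fun s => ψ s - ψ' s) x t = dblLayer ε ψ x t - dblLayer ε ψ' x t := by
  unfold dblLayer
  rw [← integral_sub (integrable_dblLayer_integrand hψ.measurable hψ.bound x t)
    (integrable_dblLayer_integrand hψ'.measurable hψ'.bound x t)]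
  simp only [mul_sub]

/-- In the Gaussian variable `q` the jump relation is immediate: at `x = 0` the time delay vanishes
and the weight has mass one. -/
lemma dblLayer_zero_left (ψ : ℝ → ℝ) (t : ℝ) : dblLayer ε ψ 0 t = ψ t := by
  simp only [dblLayer, ne_eq, OfNat.ofNat_ne_zero, not_false_eq_true, zero_pow, zero_div, sub_zero]
  rw [integral_mul_const, integral_half_gaussian_weight, one_mul]

lemma dblLayer_of_nonpos (hε : 0 < ε) (hψ : IsBoundaryDatum M ψ) (x : ℝ) {t : ℝ} (ht : t ≤ 0) :
    dblLayer ε ψ x t = 0 := by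
  have : ∀ q : ℝ, ψ (t - x ^ 2 / (4 * ε * q ^ 2)) = 0 := fun q => hψ.eq_zero _ (by
    have : 0 ≤ x ^ 2 / (4 * ε * q ^ 2) := by positivity
    linarith)
  simp [dblLayer, this]

lemma abs_dblLayer_le (hM : ∀ s, |ψ s| ≤ M) (x t : ℝ) : |dblLayer ε ψ x t| ≤ M := by
  have h := norm_integral_le_of_norm_le (μ := volume.restrict (Ioi 0))
    (integrable_half_gaussian_weight.mul_const M)
    (Eventually.of_forall (norm_dblLayer_integrand_le (ε := ε) hM x t))
  rwa [integral_mul_const, integral_half_gaussian_weight, one_mul] at h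

/-- At a fixed distance from the boundary the double layer potential is a strict contraction. -/
lemma abs_dblLayer_le_mul (hε : 0 < ε) {L T : ℝ} (hL : 0 < L) (hT : 0 < T) :
    ∃ κ : ℝ, 0 ≤ κ ∧ κ < 1 ∧ ∀ {M : ℝ} {ψ : ℝ → ℝ}, (∀ s, |ψ s| ≤ M) → (∀ s ≤ 0, ψ s = 0) →
      ∀ t ≤ T, |dblLayer ε ψ L t| ≤ κ * M := by
  -- For `q ≤ q₀` and `t ≤ T` the delayed time `t - L² / (4 ε q²)` is nonpositive and the density
  -- vanishes. The contraction constant is the Gaussian mass of `(q₀, ∞)`.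
  set q₀ := L / √(4 * ε * T) with hq₀
  have hq₀pos : 0 < q₀ := by positivity
  set w : ℝ → ℝ := fun q => 2 * (√Real.pi)⁻¹ * Real.exp (-q ^ 2) with hw
  have hwpos : ∀ q, 0 < w q := fun q => by have := Real.pi_pos; positivity
  have hwint : IntegrableOn w (Ioi 0) := integrable_half_gaussian_weight
  have hsplit : (∫ q in Ioc 0 q₀, w q) + ∫ q in Ioi q₀, w q = 1 := by
    rw [← integral_half_gaussian_weight, ← setIntegral_union (by
      rw [Set.disjoint_left]; intro q h1 h2; exact absurd h1.2 (not_le.mpr h2)) measurableSet_Ioi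
      (hwint.mono_set Ioc_subset_Ioi_self) (hwint.mono_set (Ioi_subset_Ioi hq₀pos.le)),
      Ioc_union_Ioi_eq_Ioi hq₀pos.le]
  have hpos : 0 < ∫ q in Ioc 0 q₀, w q := by
    rw [← intervalIntegral.integral_of_le hq₀pos.le]
    exact intervalIntegral.intervalIntegral_pos_of_pos (by
      rw [intervalIntegrable_iff_integrableOn_Ioc_of_le hq₀pos.le]
      exact hwint.mono_set Ioc_subset_Ioi_self) hwpos hq₀pos
  refine ⟨∫ q in Ioi q₀, w q, integral_nonneg fun q => (hwpos q).le, by linarith,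
    fun {M ψ} hM h0 t ht => ?_⟩
  have hM0 : 0 ≤ M := (abs_nonneg _).trans (hM 0)
  have hb : ∀ᵐ q ∂volume.restrict (Ioi 0),
      ‖2 * (√Real.pi)⁻¹ * Real.exp (-q ^ 2) * ψ (t - L ^ 2 / (4 * ε * q ^ 2))‖ ≤
      (Ioi q₀).indicator (fun q => w q * M) q := by
    refine (ae_restrict_mem measurableSet_Ioi).mono fun q hq => ?_
    by_cases h : q ∈ Ioi q₀
    · rw [indicator_of_mem h]
      exact norm_dblLayer_integrand_le hM L t q
    · rw [indicator_of_notMem h]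
      have hq0 : 0 < q := hq
      have hqq : q ≤ q₀ := not_lt.mp h
      have h1 : T ≤ L ^ 2 / (4 * ε * q ^ 2) := by
        have h2 : q ^ 2 ≤ L ^ 2 / (4 * ε * T) := by
          calc q ^ 2 ≤ q₀ ^ 2 := by gcongr
            _ = _ := by rw [hq₀, div_pow, Real.sq_sqrt (by positivity)]
        rw [le_div_iff₀ (by positivity)] at h2 ⊢
        linarith
      rw [h0 _ (by linarith), mul_zero, norm_zero]
  have h := norm_integral_le_of_norm_le (μ := volume.restrict (Ioi 0)) (by
    refine Integrable.indicator ?_ measurableSet_Ioi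
    exact hwint.mul_const M) hb
  rw [setIntegral_indicator measurableSet_Ioi, inter_eq_right.mpr (Ioi_subset_Ioi hq₀pos.le),
    integral_mul_const] at h
  exact h

lemma continuousAt_dblLayer_of_ae (hψ : Measurable ψ) (hM : ∀ s, |ψ s| ≤ M) {x t : ℝ}
    (hc : ∀ᵐ q ∂volume.restrict (Ioi 0), ContinuousAt ψ (t - x ^ 2 / (4 * ε * q ^ 2))) :
    ContinuousAt (fun p : ℝ × ℝ => dblLayer ε ψ p.1 p.2) (x, t) := by
  refine tendsto_integral_filter_of_dominated_convergence
    (fun q => 2 * (√Real.pi)⁻¹ * Real.exp (-q ^ 2) * M)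
    (Eventually.of_forall fun p => (measurable_dblLayer_integrand hψ p.1 p.2).aestronglyMeasurable)
    (Eventually.of_forall fun p =>
      Eventually.of_forall (norm_dblLayer_integrand_le hM p.1 p.2))
    (integrable_half_gaussian_weight.mul_const M) ?_
  filter_upwards [hc] with q hq
  refine Tendsto.const_mul _ (hq.tendsto.comp ?_)
  have : Continuous fun p : ℝ × ℝ => p.2 - p.1 ^ 2 / (4 * ε * q ^ 2) := by fun_prop
  exact this.tendsto (x, t)

/-- The density may jump only at time `0`, which the delayed time hits for at most one `q > 0`
unless `x = t = 0`. -/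
lemma continuousAt_dblLayer (hε : 0 < ε) (hψ : IsBoundaryDatum M ψ) {x t : ℝ}
    (hxt : x ≠ 0 ∨ t ≠ 0) : ContinuousAt (fun p : ℝ × ℝ => dblLayer ε ψ p.1 p.2) (x, t) := by
  refine continuousAt_dblLayer_of_ae hψ.measurable hψ.bound ?_
  have hne : ∀ᵐ q ∂volume.restrict (Ioi (0 : ℝ)), q ≠ √(x ^ 2 / (4 * ε * t)) :=
    ae_restrict_of_ae (compl_mem_ae_iff.mpr (measure_singleton _))
  filter_upwards [hne, ae_restrict_mem measurableSet_Ioi] with q h1 h2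
  have hq : 0 < q := h2
  refine hψ.continuousAt_of_ne fun h => h1 ?_
  have h3 : t = x ^ 2 / (4 * ε * q ^ 2) := by linarith
  have h4 : x ≠ 0 := by
    rcases hxt with h' | h'
    · exact h'
    · rintro rfl; simp at h3; exact h' h3
  have h5 : x ^ 2 / (4 * ε * t) = q ^ 2 := by
    rw [h3]; field_simp
  rw [h5, Real.sqrt_sq hq.le]

lemma continuous_dblLayer_of_continuous (hψ : Continuous ψ) (hM : ∀ s, |ψ s| ≤ M) :
    Continuous (fun p : ℝ × ℝ => dblLayer ε ψ p.1 p.2) :=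
  continuous_iff_continuousAt.mpr fun _ =>
    continuousAt_dblLayer_of_ae hψ.measurable hM (Eventually.of_forall fun _ => hψ.continuousAt)

/-- The double layer potential is the convolution with the normal derivative of the kernel. -/
lemma dblLayer_eq_layerPot (hε : 0 < ε) (ψ : ℝ → ℝ) {x : ℝ} (hx : 0 < x) (t : ℝ) :
    dblLayer ε ψ x t = -2 * ε * layerPot ε 1 ψ x t := by
  have h1 : layerPot ε 1 ψ x t = ∫ r in Ioi 0, heatK ε 1 x r * ψ (t - r) := by
    rw [layerPot, setIntegral_eq_integral_of_forall_compl_eq_zero]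
    intro r hr
    rw [heatK_of_nonpos hε 1 x (not_lt.mp hr), zero_mul]
  have hder : ∀ q ∈ Ioi (0 : ℝ), HasDerivWithinAt (fun q => x ^ 2 / (4 * ε * q ^ 2))
      (-(x ^ 2 / (2 * ε * q ^ 3))) (Ioi 0) q := by
    intro q hq
    have hq0 : 0 < q := hq
    have := ((hasDerivAt_const q (x ^ 2)).div (((hasDerivAt_id q).pow 2).const_mul (4 * ε))
      (by simp only [id, Pi.pow_apply]; positivity))
    refine (this.congr_deriv ?_).hasDerivWithinAt
    simp only [id, Pi.pow_apply]
    field_simp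
    norm_num
    ring
  have hinj : InjOn (fun q : ℝ => x ^ 2 / (4 * ε * q ^ 2)) (Ioi 0) := by
    intro p hp q hq h
    have hp0 : 0 < p := hp
    have hq0 : 0 < q := hq
    simp only at h
    rw [div_eq_div_iff (by positivity) (by positivity)] at h
    have h2 : q ^ 2 = p ^ 2 := by
      have : x ^ 2 * (4 * ε) ≠ 0 := by positivity
      apply mul_left_cancel₀ this; linarith
    exact ((sq_eq_sq₀ hq0.le hp0.le).mp h2).symm
  have himg : (fun q : ℝ => x ^ 2 / (4 * ε * q ^ 2)) '' Ioi 0 = Ioi 0 := by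
    ext r
    constructor
    · rintro ⟨q, hq, rfl⟩
      have hq0 : 0 < q := hq
      simp only [mem_Ioi]
      positivity
    · intro hr
      have hr0 : 0 < r := hr
      refine ⟨x / √(4 * ε * r), by simp only [mem_Ioi]; positivity, ?_⟩
      simp only [div_pow]
      rw [Real.sq_sqrt (by positivity)]
      field_simp
  have h2 := integral_image_eq_integral_abs_deriv_smul measurableSet_Ioi hder hinj
    (fun r => heatK ε 1 x r * ψ (t - r))
  rw [himg] at h2
  rw [h1, h2, dblLayer, ← integral_const_mul]
  refine setIntegral_congr_fun measurableSet_Ioi fun q hq => ?_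
  have hq0 : 0 < q := hq
  simp only [smul_eq_mul]
  have hpi := Real.pi_pos
  have h3 : √(4 * Real.pi * ε * (x ^ 2 / (4 * ε * q ^ 2))) = √Real.pi * (x / q) := by
    rw [show 4 * Real.pi * ε * (x ^ 2 / (4 * ε * q ^ 2)) = Real.pi * (x / q) ^ 2 by field_simp,
      Real.sqrt_mul hpi.le, Real.sqrt_sq (by positivity)]
  have h4 : x ^ 2 / (4 * ε * (x ^ 2 / (4 * ε * q ^ 2))) = q ^ 2 := by field_simp
  rw [heatK_one, heatK_zero, h3, h4, abs_neg, abs_of_pos (by positivity)]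
  field_simp
  ring

/-- Decay of order `m = j + 1` in `r / x²` outweighs the prefactor: the bound becomes a multiple of
`(√r / x²)^(j+1)`. All layer integrals away from the boundary are therefore nonsingular. -/
lemma abs_heatK_le_of_le (hε : 0 < ε) (j : ℕ) {δ : ℝ} (hδ : 0 < δ) (b : ℝ) :
    ∃ C : ℝ, 0 ≤ C ∧ ∀ x r : ℝ, δ ≤ x → r ≤ b → |heatK ε j x r| ≤ C := by
  obtain ⟨C, hC, hCb⟩ := abs_heatK_le_of_ne_zero hε j (j + 1)
  refine ⟨C * (√b / δ ^ 2) ^ (j + 1), by positivity, fun x r hx hr => ?_⟩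
  rcases le_or_gt r 0 with h | h
  · rw [heatK_of_nonpos hε j x h, abs_zero]; positivity
  · have hx0 : 0 < x := hδ.trans_le hx
    refine (hCb x r hx0.ne' h).trans ?_
    have h1 : 0 < √r := Real.sqrt_pos.mpr h
    have h2 : C / √r ^ (j + 1) * (r / x ^ 2) ^ (j + 1) = C * (√r / x ^ 2) ^ (j + 1) := by
      rw [div_mul_eq_mul_div, mul_div_assoc, ← div_pow]
      congr 2
      nth_rw 1 [← Real.mul_self_sqrt h.le]
      field_simp
    rw [h2]
    gcongr

lemma measurable_layerPot_integrand (j : ℕ) (hψ : Measurable ψ) (x t : ℝ) :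
    Measurable (fun r => heatK ε j x r * ψ (t - r)) :=
  ((measurable_heatK j).comp (f := fun r : ℝ => (x, r)) (by fun_prop)).mul
    (hψ.comp (f := fun r : ℝ => t - r) (by fun_prop))

lemma abs_layerPot_integrand_le (hε : 0 < ε) (hψ : IsBoundaryDatum M ψ) {j : ℕ} {x t b C : ℝ}
    (hC : ∀ r ≤ b, |heatK ε j x r| ≤ C) (ht : t ≤ b) (r : ℝ) :
    |heatK ε j x r * ψ (t - r)| ≤ (Ioc 0 b).indicator (fun _ => C * M) r := by
  have hM := hψ.nonneg
  by_cases hr : r ∈ Ioc 0 b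
  · rw [indicator_of_mem hr, abs_mul]
    have h1 := hC r hr.2
    have h2 := hψ.bound (t - r)
    have h3 : 0 ≤ C := (abs_nonneg _).trans h1
    gcongr
  · rw [indicator_of_notMem hr]
    rcases le_or_gt r 0 with h | h
    · rw [heatK_of_nonpos hε j x h, zero_mul, abs_zero]
    · have : b < r := by by_contra! h'; exact hr ⟨h, h'⟩
      rw [hψ.eq_zero _ (by linarith), mul_zero, abs_zero]

lemma integrable_indicator_const_Ioc (b c : ℝ) :
    Integrable ((Ioc 0 b).indicator fun _ : ℝ => c) :=
  (integrable_indicator_iff measurableSet_Ioc).mpr (by simp)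

lemma continuousAt_layerPot (hε : 0 < ε) (hψ : IsBoundaryDatum M ψ) (j : ℕ) {x : ℝ}
    (hx : 0 < x) (t : ℝ) : ContinuousAt (fun p : ℝ × ℝ => layerPot ε j ψ p.1 p.2) (x, t) := by
  obtain ⟨C, hC0, hC⟩ := abs_heatK_le_of_le hε j (half_pos hx) (t + 1)
  refine tendsto_integral_filter_of_dominated_convergence
    ((Ioc 0 (t + 1)).indicator fun _ => C * M)
    (Eventually.of_forall fun p =>
      (measurable_layerPot_integrand j hψ.measurable p.1 p.2).aestronglyMeasurable) ?_
    (integrable_indicator_const_Ioc _ _) ?_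
  · have : Ioi (x / 2) ×ˢ Iio (t + 1) ∈ 𝓝 (x, t) :=
      prod_mem_nhds (Ioi_mem_nhds (by linarith)) (Iio_mem_nhds (by linarith))
    filter_upwards [this] with p hp
    exact Eventually.of_forall (abs_layerPot_integrand_le hε hψ
      (fun r hr => hC p.1 r (le_of_lt hp.1) hr) (le_of_lt hp.2))
  · filter_upwards [compl_mem_ae_iff.mpr (measure_singleton t)] with r h1
    refine Tendsto.mul ?_ ?_
    · exact (hasDerivAt_heatK_space j x r).continuousAt.tendsto.comp
        (continuous_fst.tendsto (x, t))
    · have h2 : Tendsto (fun p : ℝ × ℝ => p.2 - r) (𝓝 (x, t)) (𝓝 (t - r)) :=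
        Continuous.tendsto (by fun_prop) (x, t)
      exact (hψ.continuousAt_of_ne (sub_ne_zero.mpr (Ne.symm h1))).tendsto.comp h2

lemma integrable_layerPot_integrand (hε : 0 < ε) (hψ : IsBoundaryDatum M ψ) (j : ℕ) {x : ℝ}
    (hx : 0 < x) (t : ℝ) : Integrable (fun r => heatK ε j x r * ψ (t - r)) := by
  obtain ⟨C, hC0, hC⟩ := abs_heatK_le_of_le hε j hx t
  exact (integrable_indicator_const_Ioc t (C * M)).mono'
    (measurable_layerPot_integrand j hψ.measurable x t).aestronglyMeasurable
    (Eventually.of_forall (abs_layerPot_integrand_le hε hψ (fun r hr => hC x r le_rfl hr) le_rfl))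

lemma abs_layerPot_le (hε : 0 < ε) (hψ : IsBoundaryDatum M ψ) (j : ℕ) {δ : ℝ} (hδ : 0 < δ)
    (b : ℝ) : ∃ C : ℝ, 0 ≤ C ∧ ∀ x t, δ ≤ x → t ≤ b → |layerPot ε j ψ x t| ≤ C := by
  obtain ⟨C, hC0, hC⟩ := abs_heatK_le_of_le hε j hδ b
  have hM := hψ.nonneg
  refine ⟨∫ r, (Ioc 0 b).indicator (fun _ => C * M) r, integral_nonneg fun r =>
    indicator_nonneg (fun _ _ => by positivity) r, fun x t hx ht => ?_⟩
  rw [layerPot, ← Real.norm_eq_abs]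
  exact norm_integral_le_of_norm_le (integrable_indicator_const_Ioc b (C * M))
    (Eventually.of_forall (abs_layerPot_integrand_le hε hψ (fun r hr => hC x r hx hr) ht))

lemma hasDerivAt_layerPot_space (hε : 0 < ε) (hψ : IsBoundaryDatum M ψ) (j : ℕ) {x : ℝ}
    (hx : 0 < x) (t : ℝ) :
    HasDerivAt (fun y => layerPot ε j ψ y t) (layerPot ε (j + 1) ψ x t) x := by
  obtain ⟨C, hC0, hC⟩ := abs_heatK_le_of_le hε (j + 1) (half_pos hx) t
  exact (hasDerivAt_integral_of_dominated_loc_of_deriv_le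
    (F := fun x r => heatK ε j x r * ψ (t - r)) (F' := fun x r => heatK ε (j + 1) x r * ψ (t - r))
    (bound := (Ioc 0 t).indicator fun _ => C * M) (μ := volume)
    (Ioi_mem_nhds (by linarith : x / 2 < x))
    (Eventually.of_forall fun x' =>
      (measurable_layerPot_integrand j hψ.measurable x' t).aestronglyMeasurable)
    (integrable_layerPot_integrand hε hψ j hx t)
    (measurable_layerPot_integrand (j + 1) hψ.measurable x t).aestronglyMeasurable
    (Eventually.of_forall fun r x' hx' => abs_layerPot_integrand_le hε hψ
      (fun r hr => hC x' r (le_of_lt hx') hr) le_rfl r)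
    (integrable_indicator_const_Ioc _ _)
    (Eventually.of_forall fun r x' _ => (hasDerivAt_heatK_space j x' r).mul_const _)).2

/-- For `x > 0` the extension by zero is flat at `r = 0`: the decay estimate with `m = 3` gives
`O(r²)` there. Hence differentiating a layer potential in time produces no boundary term. -/
lemma hasDerivAt_heatK_one_time (hε : 0 < ε) {x : ℝ} (hx : 0 < x) (r : ℝ) :
    HasDerivAt (fun s => heatK ε 1 x s) (ε * heatK ε 3 x r) r := by
  rcases lt_trichotomy r 0 with h | rfl | h
  · rw [heatK_of_nonpos hε 3 x h.le, mul_zero]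
    refine (hasDerivAt_const r (0 : ℝ)).congr_of_eventuallyEq ?_
    filter_upwards [gt_mem_nhds h] with s hs using heatK_of_nonpos hε 1 x (le_of_lt hs)
  · rw [heatK_of_nonpos hε 3 x le_rfl, mul_zero]
    obtain ⟨C, hC, hCb⟩ := abs_heatK_le_of_ne_zero hε 1 3
    have hb : (fun s => heatK ε 1 x s) =O[𝓝 0] fun s => ‖s - 0‖ ^ 2 := by
      refine Asymptotics.IsBigO.of_bound (C / x ^ 6) (Eventually.of_forall fun s => ?_)
      rw [sub_zero, Real.norm_eq_abs, norm_pow, norm_norm, Real.norm_eq_abs, sq_abs]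
      rcases le_or_gt s 0 with h | h
      · rw [heatK_of_nonpos hε 1 x h, abs_zero]; positivity
      · refine (hCb x s hx.ne' h).trans (le_of_eq ?_)
        rw [Real.sq_sqrt h.le]
        field_simp
    have := (hb.hasFDerivAt (by norm_num)).hasDerivAt
    simpa using this
  · exact hasDerivAt_heatK_time hε 1 x h

lemma layerPot_eq_integral_sub (j : ℕ) (ψ : ℝ → ℝ) (x t : ℝ) :
    layerPot ε j ψ x t = ∫ s, heatK ε j x (t - s) * ψ s := by
  rw [layerPot, ← integral_sub_left_eq_self _ volume t]
  simp

/-- The density is only continuous for positive times, so the convolution is first rewritten with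
the time shift on the kernel, which then takes the derivative. -/
lemma hasDerivAt_layerPot_time (hε : 0 < ε) (hψ : IsBoundaryDatum M ψ) {x : ℝ}
    (hx : 0 < x) (t : ℝ) :
    HasDerivAt (fun τ => layerPot ε 1 ψ x τ) (ε * layerPot ε 3 ψ x t) t := by
  obtain ⟨C, hC0, hC⟩ := abs_heatK_le_of_le hε 3 hx (t + 1)
  have hmeas : ∀ j τ, Measurable (fun s => heatK ε j x (τ - s) * ψ s) := fun j τ =>
    ((measurable_heatK j).comp (f := fun s : ℝ => (x, τ - s)) (by fun_prop)).mul hψ.measurable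
  have hi : Integrable (fun s => heatK ε 1 x (t - s) * ψ s) := by
    have := (integrable_layerPot_integrand hε hψ 1 hx t).comp_sub_left t
    simpa using this
  have hM := hψ.nonneg
  have h := (hasDerivAt_integral_of_dominated_loc_of_deriv_le
    (F := fun τ s => heatK ε 1 x (τ - s) * ψ s)
    (F' := fun τ s => ε * heatK ε 3 x (τ - s) * ψ s)
    (bound := (Ioc 0 (t + 1)).indicator fun _ => ε * C * M) (μ := volume)
    (Iio_mem_nhds (by linarith : t < t + 1))
    (Eventually.of_forall fun τ => (hmeas 1 τ).aestronglyMeasurable) hi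
    (by simpa only [mul_assoc] using ((hmeas 3 t).const_mul ε).aestronglyMeasurable)
    (Eventually.of_forall fun s τ hτ => ?_)
    (integrable_indicator_const_Ioc _ _)
    (Eventually.of_forall fun s τ _ =>
      ((hasDerivAt_heatK_one_time hε hx (τ - s)).comp_sub_const τ s).mul_const _)).2
  · simp only [layerPot_eq_integral_sub]
    refine h.congr_deriv ?_
    rw [← integral_const_mul]
    simp only [mul_assoc]
  · have hτ' : τ < t + 1 := hτ
    by_cases hs : s ∈ Ioc 0 (t + 1)
    · rw [indicator_of_mem hs, norm_mul, norm_mul, Real.norm_eq_abs, Real.norm_eq_abs,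
        Real.norm_eq_abs, abs_of_pos hε]
      have h1 := hC x (τ - s) le_rfl (by linarith [hs.1])
      have h2 := hψ.bound s
      gcongr
    · rw [indicator_of_notMem hs]
      rcases le_or_gt s 0 with h | h
      · rw [hψ.eq_zero s h, mul_zero, norm_zero]
      · have : t + 1 < s := by by_contra! h'; exact hs ⟨h, h'⟩
        rw [heatK_of_nonpos hε 3 x (by linarith), mul_zero, zero_mul, norm_zero]

end dblLayer

/-! ### Boundary densities and the linear heat problem -/

section densities

variable {ε L T : ℝ}

lemma isBoundaryDatum_indicator (φ : ℝ →ᵇ ℝ) : IsBoundaryDatum ‖φ‖ ((Ioi 0).indicator φ) where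
  measurable := φ.continuous.measurable.indicator measurableSet_Ioi
  bound s := by
    by_cases hs : s ∈ Ioi (0 : ℝ)
    · rw [indicator_of_mem hs]; exact φ.norm_coe_le_norm s
    · rw [indicator_of_notMem hs, abs_zero]; exact norm_nonneg _
  eq_zero s hs := indicator_of_notMem (not_lt.mpr hs) _
  continuousAt s hs := by
    refine φ.continuous.continuousAt.congr ?_
    filter_upwards [Ioi_mem_nhds hs] with s' hs' using (indicator_of_mem hs' _).symm

lemma continuous_indicator_of_eq_zero (φ : ℝ →ᵇ ℝ) (h0 : φ 0 = 0) :
    Continuous ((Ioi (0 : ℝ)).indicator φ) := by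
  have : (Ioi (0 : ℝ)).indicator φ = fun t => φ (max t 0) := by
    ext t
    by_cases ht : t ∈ Ioi (0 : ℝ)
    · rw [indicator_of_mem ht, max_eq_left (le_of_lt ht)]
    · rw [indicator_of_notMem ht, max_eq_right (not_lt.mp ht), h0]
  rw [this]
  exact φ.continuous.comp (by fun_prop)

/-- The trace at distance `L` of the double layer potential, as an operator on densities. -/
noncomputable def layerTrace (hε : 0 < ε) (hL : 0 < L) (T : ℝ) (φ : ℝ →ᵇ ℝ) : ℝ →ᵇ ℝ :=
  BoundedContinuousFunction.ofNormedAddCommGroup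
    (fun t => dblLayer ε ((Ioi 0).indicator φ) L (min t T))
    (by
      have h : Continuous fun t => dblLayer ε ((Ioi 0).indicator φ) L t :=
        continuous_iff_continuousAt.mpr fun t =>
          ContinuousAt.comp (f := fun t : ℝ => (L, t))
            (continuousAt_dblLayer hε (isBoundaryDatum_indicator φ) (Or.inl hL.ne'))
            (by fun_prop)
      exact h.comp (by fun_prop)) ‖φ‖
    (fun t => abs_dblLayer_le (isBoundaryDatum_indicator φ).bound L _)

/-- The pair is the fixed point of `(φ, ψ) ↦ (h₁ - Kψ, h₂ - Kφ)`, with `K` the trace at distance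
`L`; freezing time after `T` in `layerTrace` makes the bound `κ < 1` uniform on the line. Since `Kψ`
and `Kφ` vanish at time `0`, `h₁ 0 = 0` forces `φ 0 = 0`, so cutting `φ` off at negative times
creates no jump; likewise for `ψ`. This is how compatible data give continuity at a corner. -/
lemma exists_layer_densities (hε : 0 < ε) (hL : 0 < L) (hT : 0 < T) (h₁ h₂ : ℝ →ᵇ ℝ) :
    ∃ (M : ℝ) (φ ψ : ℝ → ℝ), IsBoundaryDatum M φ ∧ IsBoundaryDatum M ψ ∧
      (∀ t ∈ Ioc 0 T, φ t + dblLayer ε ψ L t = h₁ t) ∧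
      (∀ t ∈ Ioc 0 T, ψ t + dblLayer ε φ L t = h₂ t) ∧
      (h₁ 0 = 0 → Continuous φ) ∧ (h₂ 0 = 0 → Continuous ψ) := by
  obtain ⟨κ, hκ0, hκ1, hκ⟩ := abs_dblLayer_le_mul hε hL hT
  have hA : ∀ φ ψ : ℝ →ᵇ ℝ,
      dist (layerTrace hε hL T φ) (layerTrace hε hL T ψ) ≤ κ * dist φ ψ := by
    intro φ ψ
    rw [dist_le (by positivity)]
    intro t
    have h1 := dblLayer_sub (ε := ε) (isBoundaryDatum_indicator φ) (isBoundaryDatum_indicator ψ) L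
      (min t T)
    have h2 : (fun s => (Ioi 0).indicator φ s - (Ioi 0).indicator ψ s)
        = (Ioi 0).indicator (φ - ψ : ℝ →ᵇ ℝ) := by
      ext s
      by_cases hs : s ∈ Ioi (0 : ℝ) <;> simp [indicator_of_mem, indicator_of_notMem, hs]
    rw [h2] at h1
    have hd := isBoundaryDatum_indicator (φ - ψ)
    rw [Real.dist_eq, dist_eq_norm]
    change |dblLayer ε _ L (min t T) - dblLayer ε _ L (min t T)| ≤ _
    rw [← h1]
    exact hκ hd.bound hd.eq_zero _ (min_le_right t T)
  set Φ : (ℝ →ᵇ ℝ) × (ℝ →ᵇ ℝ) → (ℝ →ᵇ ℝ) × (ℝ →ᵇ ℝ) := fun p =>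
    (h₁ - layerTrace hε hL T p.2, h₂ - layerTrace hε hL T p.1) with hΦ
  have hcontr : ContractingWith ⟨κ, hκ0⟩ Φ := by
    refine ⟨by exact_mod_cast hκ1, LipschitzWith.of_dist_le_mul fun p q => ?_⟩
    rw [Prod.dist_eq]
    simp only [hΦ, dist_sub_left]
    refine max_le ?_ ?_
    · exact (hA _ _).trans (mul_le_mul_of_nonneg_left (le_max_right _ _) hκ0)
    · exact (hA _ _).trans (mul_le_mul_of_nonneg_left (le_max_left _ _) hκ0)
  obtain ⟨p, hp⟩ : ∃ p, Φ p = p := ⟨_, hcontr.fixedPoint_isFixedPt⟩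
  have hp1 : ∀ t, p.1 t = h₁ t - dblLayer ε ((Ioi 0).indicator p.2) L (min t T) := fun t => by
    conv_lhs => rw [← hp]
    rfl
  have hp2 : ∀ t, p.2 t = h₂ t - dblLayer ε ((Ioi 0).indicator p.1) L (min t T) := fun t => by
    conv_lhs => rw [← hp]
    rfl
  have hmono : ∀ (φ : ℝ →ᵇ ℝ) (M : ℝ), ‖φ‖ ≤ M → IsBoundaryDatum M ((Ioi 0).indicator φ) :=
    fun φ M h => { isBoundaryDatum_indicator φ with
      bound := fun s => ((isBoundaryDatum_indicator φ).bound s).trans h }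
  refine ⟨max ‖p.1‖ ‖p.2‖, (Ioi 0).indicator p.1, (Ioi 0).indicator p.2,
    hmono _ _ (le_max_left _ _), hmono _ _ (le_max_right _ _), ?_, ?_, ?_, ?_⟩
  · intro t ht
    rw [indicator_of_mem (show t ∈ Ioi 0 from ht.1), hp1 t, min_eq_left ht.2]; ring
  · intro t ht
    rw [indicator_of_mem (show t ∈ Ioi 0 from ht.1), hp2 t, min_eq_left ht.2]; ring
  · intro h
    refine continuous_indicator_of_eq_zero p.1 ?_
    rw [hp1, h, min_eq_left hT.le, dblLayer_of_nonpos hε (isBoundaryDatum_indicator _) L le_rfl,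
      sub_zero]
  · intro h
    refine continuous_indicator_of_eq_zero p.2 ?_
    rw [hp2, h, min_eq_left hT.le, dblLayer_of_nonpos hε (isBoundaryDatum_indicator _) L le_rfl,
      sub_zero]

end densities

/-- `U` is a regular solution of the linear heat equation with initial values `u₀` and boundary
values `g₁`, `g₂`; `U₁` and `U₂` are its spatial derivatives. -/
structure IsHeatSolution (ε L T : ℝ) (u₀ g₁ g₂ : ℝ → ℝ) (U U₁ U₂ : ℝ → ℝ → ℝ) : Prop where
  bounded : ∃ M : ℝ, ∀ x t, |U x t| ≤ M
  continuousOn : ContinuousOn (fun z : ℝ × ℝ => U z.1 z.2)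
    ((Icc 0 L ×ˢ Icc 0 T) \ {((0 : ℝ), (0 : ℝ)), (L, (0 : ℝ))})
  corner_left : u₀ 0 = g₁ 0 →
    ContinuousWithinAt (fun z : ℝ × ℝ => U z.1 z.2) (Icc 0 L ×ˢ Icc 0 T) (0, 0)
  corner_right : u₀ L = g₂ 0 →
    ContinuousWithinAt (fun z : ℝ × ℝ => U z.1 z.2) (Icc 0 L ×ˢ Icc 0 T) (L, 0)
  initial : ∀ x ∈ Icc 0 L, U x 0 = u₀ x
  boundary_left : ∀ t ∈ Ioc 0 T, U 0 t = g₁ t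
  boundary_right : ∀ t ∈ Ioc 0 T, U L t = g₂ t
  hasDerivAt : ∀ x ∈ Ioo 0 L, ∀ t, 0 < t → HasDerivAt (fun y => U y t) (U₁ x t) x
  hasDerivAt_one : ∀ x ∈ Ioo 0 L, ∀ t, 0 < t → HasDerivAt (fun y => U₁ y t) (U₂ x t) x
  hasDerivAt_time : ∀ x ∈ Ioo 0 L, ∀ t, 0 < t → HasDerivAt (fun s => U x s) (ε * U₂ x t) t
  continuousAt_one : ∀ x ∈ Ioo 0 L, ∀ t, 0 < t →
    ContinuousAt (fun z : ℝ × ℝ => U₁ z.1 z.2) (x, t)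
  continuousAt_two : ∀ x ∈ Ioo 0 L, ∀ t, 0 < t →
    ContinuousAt (fun z : ℝ × ℝ => U₂ z.1 z.2) (x, t)
  gradient_bound : ∀ δ, 0 < δ → ∃ C : ℝ, 0 ≤ C ∧ ∀ x ∈ Icc δ (L - δ), ∀ t ∈ Ioc 0 T,
    |U₁ x t| ≤ C / √t

/-- The Gaussian average attains the initial values, and each layer takes its density on its own
side. The densities are matched to the boundary data minus the trace of the average. In the interior
the layers equal smooth convolutions, so only the average contributes the gradient singularity `1 /
√t`. -/
theorem exists_isHeatSolution {ε L T : ℝ} (hε : 0 < ε) (hL : 0 < L) (hT : 0 < T)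
    {u₀ g₁ g₂ : ℝ → ℝ} (hu₀ : ContinuousOn u₀ (Icc 0 L)) (hg₁ : ContinuousOn g₁ (Icc 0 T))
    (hg₂ : ContinuousOn g₂ (Icc 0 T)) : ∃ U U₁ U₂, IsHeatSolution ε L T u₀ g₁ g₂ U U₁ U₂ := by
  have hext : ∀ {b : ℝ}, 0 < b → ∀ {g : ℝ → ℝ}, ContinuousOn g (Icc 0 b) →
      ∃ G : ℝ →ᵇ ℝ, ∀ t ∈ Icc 0 b, G t = g t := by
    intro b hb g hg
    obtain ⟨C, hC⟩ := isCompact_Icc.exists_bound_of_continuousOn hg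
    refine ⟨BoundedContinuousFunction.ofNormedAddCommGroup (IccExtend hb.le ((Icc 0 b).domRestrict g))
      (continuousOn_iff_continuous_domRestrict.mp hg).Icc_extend' C fun t => hC _ (Subtype.mem _),
      fun t ht => ?_⟩
    exact IccExtend_of_mem hb.le ((Icc 0 b).domRestrict g) ht
  obtain ⟨V, hV⟩ := hext hL hu₀
  obtain ⟨G₁, hG₁⟩ := hext hT hg₁
  obtain ⟨G₂, hG₂⟩ := hext hT hg₂
  have hVb : ∀ y, |V y| ≤ ‖V‖ := V.norm_coe_le_norm
  have hVm := V.continuous.measurable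
  have hW : Continuous fun q : ℝ × ℝ => heatAvg ε V q.1 q.2 := continuous_heatAvg V.continuous hVb
  set tr : ℝ → (ℝ →ᵇ ℝ) := fun x => BoundedContinuousFunction.ofNormedAddCommGroup
    (fun t => heatAvg ε V x t) (hW.comp (by fun_prop : Continuous fun t : ℝ => (x, t))) ‖V‖
    (fun t => abs_heatAvg_le V hVb x t) with htr
  have htr_apply : ∀ x t, tr x t = heatAvg ε V x t := fun _ _ => rfl
  obtain ⟨M, φ, ψ, hφ, hψ, hφeq, hψeq, hφ0, hψ0⟩ :=
    exists_layer_densities hε hL hT (G₁ - tr 0) (G₂ - tr L)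
  set U : ℝ → ℝ → ℝ := fun x t =>
    heatAvg ε V x t + dblLayer ε φ x t + dblLayer ε ψ (L - x) t with hU
  have hUint : ∀ x ∈ Ioo 0 L, ∀ t, 0 < t → U x t = heatS ε 0 V x t
      + -2 * ε * layerPot ε 1 φ x t + -2 * ε * layerPot ε 1 ψ (L - x) t := by
    intro x hx t ht
    simp only [hU]
    rw [heatAvg_eq_heatS hε _ _ ht, dblLayer_eq_layerPot hε _ hx.1,
      dblLayer_eq_layerPot hε _ (sub_pos.mpr hx.2)]
  have hrefl : ∀ x : ℝ, HasDerivAt (fun y => L - y) (-1) x := fun x => by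
    simpa using (hasDerivAt_id x).const_sub L
  have hD2 : ∀ x t : ℝ, x ≠ L ∨ t ≠ 0 →
      ContinuousAt (fun z : ℝ × ℝ => dblLayer ε ψ (L - z.1) z.2) (x, t) := by
    intro x t h
    have h' : L - x ≠ 0 ∨ t ≠ 0 := h.imp_left fun h => sub_ne_zero.mpr h.symm
    exact ContinuousAt.comp (f := fun z : ℝ × ℝ => (L - z.1, z.2))
      (continuousAt_dblLayer hε hψ h') (by fun_prop)
  have hL2 : ∀ j : ℕ, ∀ x ∈ Ioo 0 L, ∀ t : ℝ,
      ContinuousAt (fun z : ℝ × ℝ => layerPot ε j ψ (L - z.1) z.2) (x, t) := fun j x hx t =>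
    ContinuousAt.comp (x := (x, t)) (f := fun z : ℝ × ℝ => (L - z.1, z.2))
      (g := fun z : ℝ × ℝ => layerPot ε j ψ z.1 z.2)
      (continuousAt_layerPot hε hψ j (sub_pos.mpr hx.2) t) (by fun_prop)
  refine ⟨U, fun x t => heatS ε 1 V x t + -2 * ε * layerPot ε 2 φ x t
      - -2 * ε * layerPot ε 2 ψ (L - x) t,
    fun x t => heatS ε 2 V x t + -2 * ε * layerPot ε 3 φ x t
      + -2 * ε * layerPot ε 3 ψ (L - x) t, ?_⟩
  constructor
  case bounded =>
    refine ⟨‖V‖ + M + M, fun x t => ?_⟩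
    refine (abs_add_three _ _ _).trans ?_
    exact add_le_add (add_le_add (abs_heatAvg_le V hVb x t) (abs_dblLayer_le hφ.bound x t))
      (abs_dblLayer_le hψ.bound _ t)
  case continuousOn =>
    rintro ⟨x, t⟩ ⟨-, hz⟩
    simp only [mem_insert_iff, Prod.mk.injEq, mem_singleton_iff, not_or, not_and_or] at hz
    exact ((hW.continuousAt.add (continuousAt_dblLayer hε hφ hz.1)).add
      (hD2 x t hz.2)).continuousWithinAt
  case corner_left =>
    intro h
    have hc : Continuous φ := hφ0 (by
      change G₁ 0 - heatAvg ε V 0 0 = 0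
      rw [hG₁ 0 ⟨le_rfl, hT.le⟩, heatAvg_of_nonpos hε _ _ le_rfl, hV 0 ⟨le_rfl, hL.le⟩, h,
        sub_self])
    exact ((hW.continuousAt.add
      (continuous_dblLayer_of_continuous hc hφ.bound).continuousAt).add
      (hD2 0 0 (Or.inl hL.ne))).continuousWithinAt
  case corner_right =>
    intro h
    have hc : Continuous ψ := hψ0 (by
      change G₂ 0 - heatAvg ε V L 0 = 0
      rw [hG₂ 0 ⟨le_rfl, hT.le⟩, heatAvg_of_nonpos hε _ _ le_rfl, hV L ⟨hL.le, le_rfl⟩, h,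
        sub_self])
    exact ((hW.continuousAt.add (continuousAt_dblLayer hε hφ (Or.inl hL.ne'))).add
      ((continuous_dblLayer_of_continuous hc hψ.bound).comp
        (by fun_prop : Continuous fun z : ℝ × ℝ => (L - z.1, z.2))).continuousAt).continuousWithinAt
  case initial =>
    intro x hx
    simp only [hU]
    rw [heatAvg_of_nonpos hε _ _ le_rfl, dblLayer_of_nonpos hε hφ _ le_rfl,
      dblLayer_of_nonpos hε hψ _ le_rfl, hV x hx]
    ring
  case boundary_left =>
    intro t ht
    have h1 := hφeq t ht
    change φ t + _ = G₁ t - heatAvg ε V 0 t at h1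
    rw [hG₁ t ⟨ht.1.le, ht.2⟩] at h1
    simp only [hU]
    rw [dblLayer_zero_left, sub_zero]
    linarith
  case boundary_right =>
    intro t ht
    have h1 := hψeq t ht
    change ψ t + _ = G₂ t - heatAvg ε V L t at h1
    rw [hG₂ t ⟨ht.1.le, ht.2⟩] at h1
    simp only [hU]
    rw [sub_self, dblLayer_zero_left]
    linarith
  case hasDerivAt =>
    intro x hx t ht
    have hLx : 0 < L - x := sub_pos.mpr hx.2
    have h1 := ((hasDerivAt_heatS_space hε 0 hVm hVb x t).add
      ((hasDerivAt_layerPot_space hε hφ 1 hx.1 t).const_mul (-2 * ε))).add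
      ((HasDerivAt.comp x (hasDerivAt_layerPot_space hε hψ 1 hLx t) (hrefl x)).const_mul (-2 * ε))
    refine (h1.congr_of_eventuallyEq ?_).congr_deriv (by ring)
    filter_upwards [Ioo_mem_nhds hx.1 hx.2] with y hy using hUint y hy t ht
  case hasDerivAt_one =>
    intro x hx t ht
    have hLx : 0 < L - x := sub_pos.mpr hx.2
    have h1 := ((hasDerivAt_heatS_space hε 1 hVm hVb x t).add
      ((hasDerivAt_layerPot_space hε hφ 2 hx.1 t).const_mul (-2 * ε))).sub
      ((HasDerivAt.comp x (hasDerivAt_layerPot_space hε hψ 2 hLx t) (hrefl x)).const_mul (-2 * ε))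
    exact h1.congr_deriv (by ring)
  case hasDerivAt_time =>
    intro x hx t ht
    have hLx : 0 < L - x := sub_pos.mpr hx.2
    have h1 := ((hasDerivAt_heatS_time hε 0 hVm hVb x ht).add
      ((hasDerivAt_layerPot_time hε hφ hx.1 t).const_mul (-2 * ε))).add
      ((hasDerivAt_layerPot_time hε hψ hLx t).const_mul (-2 * ε))
    refine (h1.congr_of_eventuallyEq ?_).congr_deriv (by ring)
    filter_upwards [lt_mem_nhds ht] with s hs using hUint x hx s hs
  case continuousAt_one =>
    intro x hx t ht
    exact ((continuousAt_heatS hε 1 hVm hVb x ht).add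
      (continuousAt_const.mul (continuousAt_layerPot hε hφ 2 hx.1 t))).sub
      (continuousAt_const.mul (hL2 2 x hx t))
  case continuousAt_two =>
    intro x hx t ht
    exact ((continuousAt_heatS hε 2 hVm hVb x ht).add
      (continuousAt_const.mul (continuousAt_layerPot hε hφ 3 hx.1 t))).add
      (continuousAt_const.mul (hL2 3 x hx t))
  case gradient_bound =>
    intro δ hδ
    obtain ⟨C, hC, hCb⟩ := abs_heatS_le hε 1
    obtain ⟨D, hD, hDb⟩ := abs_layerPot_le hε hφ 2 hδ T
    obtain ⟨D', hD', hDb'⟩ := abs_layerPot_le hε hψ 2 hδ T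
    refine ⟨C * ‖V‖ + (2 * ε * D + 2 * ε * D') * √T, by positivity, fun x hx t ht => ?_⟩
    have ht0 := ht.1
    have h0 : 0 < √t := Real.sqrt_pos.mpr ht.1
    have h1 := hCb V ‖V‖ x t hVb
    rw [pow_one] at h1
    have h2 : |(-2 * ε * layerPot ε 2 φ x t)| ≤ 2 * ε * D := by
      rw [abs_mul, abs_mul, abs_neg, abs_two, abs_of_pos hε]
      have := hDb x t hx.1 ht.2
      gcongr
    have h3 : |(-2 * ε * layerPot ε 2 ψ (L - x) t)| ≤ 2 * ε * D' := by
      rw [abs_mul, abs_mul, abs_neg, abs_two, abs_of_pos hε]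
      have := hDb' (L - x) t (by linarith [hx.2]) ht.2
      gcongr
    -- The layer terms are bounded; inserting `√T / √t ≥ 1` gives them the common form `C / √t`.
    have h4 : 2 * ε * D + 2 * ε * D' ≤ (2 * ε * D + 2 * ε * D') * √T / √t := by
      rw [mul_div_assoc]
      refine le_mul_of_one_le_right (by positivity) ?_
      rw [one_le_div h0]
      exact Real.sqrt_le_sqrt ht.2
    rw [add_div]
    have h5 := abs_sub (heatS ε 1 V x t + -2 * ε * layerPot ε 2 φ x t)
      (-2 * ε * layerPot ε 2 ψ (L - x) t)
    have h6 := abs_add_le (heatS ε 1 V x t) (-2 * ε * layerPot ε 2 φ x t)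
    linarith

/-! ### Odd periodic extension of a source -/

/-- The triangle wave of period `2 L` folding the line onto `[0, L]`. -/
noncomputable def foldLine (L y : ℝ) : ℝ := L / Real.pi * Real.arccos (Real.cos (Real.pi * y / L))

/-- The extension of a source `h x t` on `(0, L) × (0, T]` to the whole line, odd about `0` and
about `L`, constant in time after `T`, written with the time variable first. -/
noncomputable def oddExt (L T : ℝ) (h : ℝ → ℝ → ℝ) (s y : ℝ) : ℝ :=
  if 0 < s then Real.sign (Real.sin (Real.pi * y / L)) * h (foldLine L y) (min s T) else 0

section oddExt

variable {L T M : ℝ} {h : ℝ → ℝ → ℝ}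

lemma foldLine_mem (hL : 0 < L) {y : ℝ} (hy : Real.sin (Real.pi * y / L) ≠ 0) :
    foldLine L y ∈ Ioo 0 L := by
  have hpi := Real.pi_pos
  set θ := Real.pi * y / L
  have h1 : Real.cos θ ^ 2 < 1 := by
    have := Real.sin_sq_add_cos_sq θ
    have : 0 < Real.sin θ ^ 2 := by positivity
    linarith
  have h2 := abs_lt.mp ((sq_lt_one_iff_abs_lt_one _).mp h1)
  have h3 : 0 < Real.arccos (Real.cos θ) := Real.arccos_pos.mpr h2.2
  have h4 : Real.arccos (Real.cos θ) < Real.pi := by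
    refine lt_of_le_of_ne (Real.arccos_le_pi _) fun h => ?_
    rw [Real.arccos_eq_pi] at h
    linarith
  refine ⟨by unfold foldLine; positivity, ?_⟩
  unfold foldLine
  rw [div_mul_eq_mul_div, div_lt_iff₀ hpi]
  exact mul_lt_mul_of_pos_left h4 hL

lemma sin_pos_of_mem (hL : 0 < L) {y : ℝ} (hy : y ∈ Ioo 0 L) : 0 < Real.sin (Real.pi * y / L) := by
  have hpi := Real.pi_pos
  have := hy.1
  refine Real.sin_pos_of_pos_of_lt_pi (by positivity) ?_
  rw [div_lt_iff₀ hL]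
  exact mul_lt_mul_of_pos_left hy.2 hpi

lemma foldLine_of_mem (hL : 0 < L) {y : ℝ} (hy : y ∈ Ioo 0 L) : foldLine L y = y := by
  have hpi := Real.pi_pos
  have := hy.1
  unfold foldLine
  rw [Real.arccos_cos (by positivity)]
  · field_simp
  · rw [div_le_iff₀ hL]
    exact mul_le_mul_of_nonneg_left hy.2.le hpi.le

lemma oddExt_of_mem (hL : 0 < L) (h : ℝ → ℝ → ℝ) {s y : ℝ} (hs : 0 < s) (hy : y ∈ Ioo 0 L) :
    oddExt L T h s y = h y (min s T) := by
  rw [oddExt, if_pos hs, Real.sign_of_pos (sin_pos_of_mem hL hy), one_mul, foldLine_of_mem hL hy]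

lemma oddExt_congr (hL : 0 < L) (hT : 0 < T) {h' : ℝ → ℝ → ℝ}
    (hh : ∀ x ∈ Ioo 0 L, ∀ t ∈ Ioc 0 T, h x t = h' x t) : oddExt L T h = oddExt L T h' := by
  ext s y
  unfold oddExt
  by_cases hs : 0 < s
  · rw [if_pos hs, if_pos hs]
    by_cases hy : Real.sin (Real.pi * y / L) = 0
    · rw [hy, Real.sign_zero, zero_mul, zero_mul]
    · rw [hh _ (foldLine_mem hL hy) _ ⟨lt_min hs hT, min_le_right _ _⟩]
  · rw [if_neg hs, if_neg hs]

lemma oddExt_odd_zero (s y : ℝ) : oddExt L T h s (2 * 0 - y) = -oddExt L T h s y := by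
  unfold oddExt foldLine
  rw [show Real.pi * (2 * 0 - y) / L = -(Real.pi * y / L) by ring, Real.sin_neg, Real.cos_neg]
  split_ifs
  · rw [Real.sign_neg, neg_mul]
  · simp

lemma oddExt_odd_right (hL : 0 < L) (s y : ℝ) :
    oddExt L T h s (2 * L - y) = -oddExt L T h s y := by
  unfold oddExt foldLine
  rw [show Real.pi * (2 * L - y) / L = 2 * Real.pi - Real.pi * y / L by field_simp,
    Real.sin_two_pi_sub, Real.cos_two_pi_sub]
  split_ifs
  · rw [Real.sign_neg, neg_mul]
  · simp

lemma abs_oddExt_le (hL : 0 < L) {B : ℝ → ℝ} {s y : ℝ} (hB : 0 ≤ B s)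
    (hM : 0 < s → ∀ x ∈ Ioo 0 L, |h x (min s T)| ≤ B s) : |oddExt L T h s y| ≤ B s := by
  unfold oddExt
  split_ifs with hs
  · by_cases hy : Real.sin (Real.pi * y / L) = 0
    · rw [hy, Real.sign_zero, zero_mul, abs_zero]; exact hB
    · rw [abs_mul]
      have h1 := hM hs _ (foldLine_mem hL hy)
      rcases Real.sign_apply_eq (Real.sin (Real.pi * y / L)) with h2 | h2 | h2 <;> rw [h2] <;>
        simp <;> assumption
  · simpa using hB

lemma oddExt_sub (h h' : ℝ → ℝ → ℝ) (s y : ℝ) :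
    oddExt L T h s y - oddExt L T h' s y = oddExt L T (fun x t => h x t - h' x t) s y := by
  unfold oddExt
  split_ifs <;> ring

lemma measurable_real_sign : Measurable Real.sign := by
  unfold Real.sign
  exact Measurable.ite measurableSet_Iio measurable_const
    (Measurable.ite measurableSet_Ioi measurable_const measurable_const)

lemma isSource_oddExt (hL : 0 < L) (hT : 0 < T)
    (hc : ContinuousOn (fun z : ℝ × ℝ => h z.1 z.2) (Ioo 0 L ×ˢ Ioc 0 T)) (hM0 : 0 ≤ M)
    (hM : ∀ x ∈ Ioo 0 L, ∀ t ∈ Ioc 0 T, |h x t| ≤ M) : IsSource M (oddExt L T h) where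
  measurable := by
    classical
    set S : Set (ℝ × ℝ) := Ioo 0 L ×ˢ Ioc 0 T with hS
    have hSm : MeasurableSet S := measurableSet_Ioo.prod measurableSet_Ioc
    have hm : Measurable (S.piecewise (fun z : ℝ × ℝ => h z.1 z.2) fun _ => 0) :=
      hc.measurable_piecewise continuousOn_const hSm
    have hfold : Continuous (foldLine L) := by unfold foldLine; fun_prop
    -- Replacing `h` by its extension by zero changes nothing: wherever the sign factor is nonzero,
    -- the folded point lies in the open strip. At multiples of `L` the sign is `0`.
    have heq : Function.uncurry (oddExt L T h) = fun p : ℝ × ℝ => if 0 < p.1 then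
        Real.sign (Real.sin (Real.pi * p.2 / L)) *
        S.piecewise (fun z : ℝ × ℝ => h z.1 z.2) (fun _ => 0) (foldLine L p.2, min p.1 T) else 0 := by
      ext ⟨s, y⟩
      simp only [Function.uncurry, oddExt]
      split_ifs with hs
      · by_cases hy : Real.sin (Real.pi * y / L) = 0
        · rw [hy, Real.sign_zero, zero_mul, zero_mul]
        · rw [piecewise_eq_of_mem _ _ _
            (show (foldLine L y, min s T) ∈ S from
              ⟨foldLine_mem hL hy, lt_min hs hT, min_le_right _ _⟩)]
      · rfl
    rw [heq]
    refine Measurable.ite (measurableSet_lt measurable_const measurable_fst) ?_ measurable_const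
    refine Measurable.mul (measurable_real_sign.comp (by fun_prop)) (hm.comp ?_)
    exact ((hfold.comp continuous_snd).prodMk (by fun_prop)).measurable
  bound s y := abs_oddExt_le hL (B := fun _ => M) hM0 fun hs x hx =>
    hM x hx _ ⟨lt_min hs hT, min_le_right _ _⟩
  eq_zero s hs y := if_neg (not_lt.mpr hs)
  continuousAt s hs y := by
    have he : (fun s => oddExt L T h s y) =ᶠ[𝓝 s] fun s =>
        Real.sign (Real.sin (Real.pi * y / L)) * h (foldLine L y) (min s T) := by
      filter_upwards [lt_mem_nhds hs] with s' hs' using if_pos hs'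
    refine ContinuousAt.congr ?_ he.symm
    by_cases hy : Real.sin (Real.pi * y / L) = 0
    · simp only [hy, Real.sign_zero, zero_mul]
      exact continuousAt_const
    · have h1 : ContinuousOn (fun s => h (foldLine L y) (min s T)) (Ioi 0) :=
        hc.comp (f := fun s : ℝ => (foldLine L y, min s T)) (by fun_prop) fun s hs =>
          ⟨foldLine_mem hL hy, lt_min hs hT, min_le_right _ _⟩
      exact continuousAt_const.mul (h1.continuousAt (Ioi_mem_nhds hs))

/-- A local Hölder bound for `h` gives a Hölder bound for the extension at interior points. -/
lemma oddExt_holder (hL : 0 < L) (hsrc : IsSource M (oddExt L T h)) {δ t₁ H : ℝ} (hδ : 0 < δ)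
    (ht₁ : 0 < t₁) (ht₁T : t₁ ≤ T) (hH : 0 ≤ H)
    (hh : ∀ x ∈ Icc δ (L - δ), ∀ y ∈ Icc δ (L - δ), ∀ t ∈ Icc t₁ T,
      |h y t - h x t| ≤ H * √|y - x|) :
    ∀ x ∈ Ioo (2 * δ) (L - 2 * δ), ∀ s, t₁ ≤ s → ∀ y,
      |oddExt L T h s y - oddExt L T h s x| ≤ (H + 2 * M / √δ) * √|y - x| := by
  intro x hx s hs y
  have hM := hsrc.nonneg
  have hs0 : 0 < s := ht₁.trans_le hs
  rw [add_mul]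
  by_cases hy : y ∈ Icc δ (L - δ)
  · have hxI : x ∈ Icc δ (L - δ) := ⟨by linarith [hx.1], by linarith [hx.2]⟩
    rw [oddExt_of_mem hL h hs0 ⟨by linarith [hy.1], by linarith [hy.2]⟩,
      oddExt_of_mem hL h hs0 ⟨by linarith [hxI.1], by linarith [hxI.2]⟩]
    have := hh x hxI y hy (min s T) ⟨le_min hs ht₁T, min_le_right _ _⟩
    have h2 : 0 ≤ 2 * M / √δ * √|y - x| := by positivity
    linarith
  · have h1 : δ ≤ |y - x| := by
      by_contra! hlt
      have := abs_lt.mp hlt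
      exact hy ⟨by linarith [hx.1], by linarith [hx.2]⟩
    have h2 : √δ ≤ √|y - x| := Real.sqrt_le_sqrt h1
    have h3 : 0 < √δ := Real.sqrt_pos.mpr hδ
    have h4 : 2 * M ≤ 2 * M / √δ * √|y - x| := by
      rw [div_mul_eq_mul_div, le_div_iff₀ h3]
      gcongr
    have h5 := (abs_sub (oddExt L T h s y) (oddExt L T h s x)).trans
      (add_le_add (hsrc.bound s y) (hsrc.bound s x))
    have h6 : 0 ≤ H * √|y - x| := by positivity
    linarith

end oddExt

/-! ### The nonlinear source term -/

/-- The lower order terms of the equation, for `u = U + v` and `u_x = U₁ + p`. -/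
noncomputable def sourceTerm (a b β : ℝ) (F : ℝ → ℝ → ℝ → ℝ → ℝ) (U U₁ v p : ℝ → ℝ → ℝ)
    (x t : ℝ) : ℝ :=
  F x t (U x t + v x t) (U₁ x t + p x t) - a * (U x t + v x t)
    - b * ∫ τ in (0 : ℝ)..t, Real.exp (-β * (t - τ)) * (U x τ + v x τ)

section sourceTerm

variable {ε a b β L T : ℝ} {F : ℝ → ℝ → ℝ → ℝ → ℝ} {u₀ g₁ g₂ : ℝ → ℝ} {U U₁ U₂ v p : ℝ → ℝ → ℝ}

lemma mem_rect_diff_corners {x t : ℝ} (hx : x ∈ Ioo 0 L) (ht : t ∈ Icc 0 T) :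
    (x, t) ∈ (Icc 0 L ×ˢ Icc 0 T) \ {((0 : ℝ), (0 : ℝ)), (L, (0 : ℝ))} := by
  refine ⟨⟨⟨hx.1.le, hx.2.le⟩, ht⟩, ?_⟩
  rintro (h | h)
  · exact hx.1.ne' (congrArg Prod.fst h)
  · exact hx.2.ne (congrArg Prod.fst h)

lemma IsHeatSolution.continuousOn_time (hU : IsHeatSolution ε L T u₀ g₁ g₂ U U₁ U₂) {x : ℝ}
    (hx : x ∈ Ioo 0 L) : ContinuousOn (fun t => U x t) (Icc 0 T) :=
  hU.continuousOn.comp (f := fun t : ℝ => (x, t)) (by fun_prop) fun _ ht =>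
    mem_rect_diff_corners hx ht

lemma intervalIntegrable_memory (hU : IsHeatSolution ε L T u₀ g₁ g₂ U U₁ U₂)
    (hv : Continuous fun z : ℝ × ℝ => v z.1 z.2) {x t : ℝ} (hx : x ∈ Ioo 0 L) (ht : t ∈ Ioc 0 T) :
    IntervalIntegrable (fun τ => Real.exp (-β * (t - τ)) * (U x τ + v x τ)) volume 0 t := by
  refine ContinuousOn.intervalIntegrable_of_Icc ht.1.le (ContinuousOn.mul (by fun_prop)
    (((hU.continuousOn_time hx).mono (Icc_subset_Icc le_rfl ht.2)).add ?_))
  exact (hv.comp (by fun_prop : Continuous fun t : ℝ => (x, t))).continuousOn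

lemma exp_memory_le_one (hβ : 0 < β) {t τ : ℝ} (h : τ ≤ t) : Real.exp (-β * (t - τ)) ≤ 1 := by
  rw [Real.exp_le_one_iff]
  have : 0 ≤ β * (t - τ) := mul_nonneg hβ.le (by linarith)
  linarith

lemma abs_memory_le (hβ : 0 < β) {w : ℝ → ℝ} {B t : ℝ} (ht : t ∈ Ioc 0 T)
    (hw : ∀ τ ∈ Icc 0 t, |w τ| ≤ B) :
    |∫ τ in (0 : ℝ)..t, Real.exp (-β * (t - τ)) * w τ| ≤ T * B := by
  have hB : 0 ≤ B := (abs_nonneg _).trans (hw 0 ⟨le_rfl, ht.1.le⟩)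
  have := intervalIntegral.norm_integral_le_of_norm_le_const (a := 0) (b := t) (C := B)
    (f := fun τ => Real.exp (-β * (t - τ)) * w τ) (fun τ hτ => by
      rw [uIoc_of_le ht.1.le] at hτ
      rw [norm_mul, Real.norm_eq_abs, Real.norm_eq_abs, Real.abs_exp]
      have h1 := exp_memory_le_one hβ hτ.2
      have h2 := hw τ ⟨hτ.1.le, hτ.2⟩
      calc _ ≤ 1 * B := by gcongr
        _ = B := one_mul B)
  rw [sub_zero, abs_of_pos ht.1, Real.norm_eq_abs, mul_comm] at this
  exact this.trans (by gcongr; exact ht.2)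

lemma continuousOn_sourceTerm (hβ : 0 < β) (hF : HypothesesA L T F)
    (hU : IsHeatSolution ε L T u₀ g₁ g₂ U U₁ U₂)
    (hv : Continuous fun z : ℝ × ℝ => v z.1 z.2) (hp : Continuous fun z : ℝ × ℝ => p z.1 z.2)
    (hvb : ∃ B, ∀ x, ∀ t ∈ Icc 0 T, |v x t| ≤ B) :
    ContinuousOn (fun z : ℝ × ℝ => sourceTerm a b β F U U₁ v p z.1 z.2) (Ioo 0 L ×ˢ Ioc 0 T) := by
  have hUc : ContinuousOn (fun z : ℝ × ℝ => U z.1 z.2) (Ioo 0 L ×ˢ Ioc 0 T) :=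
    hU.continuousOn.mono fun z hz => mem_rect_diff_corners hz.1 ⟨hz.2.1.le, hz.2.2⟩
  have hU₁c : ContinuousOn (fun z : ℝ × ℝ => U₁ z.1 z.2) (Ioo 0 L ×ˢ Ioc 0 T) := fun z hz =>
    (hU.continuousAt_one z.1 hz.1 z.2 hz.2.1).continuousWithinAt
  have huc := hUc.add hv.continuousOn
  have hmem : ContinuousOn (fun z : ℝ × ℝ => ∫ τ in (0 : ℝ)..z.2,
      Real.exp (-β * (z.2 - τ)) * (U z.1 τ + v z.1 τ)) (Ioo 0 L ×ˢ Ioc 0 T) := by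
    -- Rescaling `τ = t θ` makes the interval of integration independent of the point, so dominated
    -- convergence applies.
    have hsub : ∀ z : ℝ × ℝ, ∫ τ in (0 : ℝ)..z.2, Real.exp (-β * (z.2 - τ)) * (U z.1 τ + v z.1 τ)
        = z.2 * ∫ θ in (0 : ℝ)..1,
          Real.exp (-β * (z.2 - z.2 * θ)) * (U z.1 (z.2 * θ) + v z.1 (z.2 * θ)) := by
      intro z
      have := intervalIntegral.mul_integral_comp_mul_left (a := 0) (b := 1) (c := z.2)
        (f := fun τ => Real.exp (-β * (z.2 - τ)) * (U z.1 τ + v z.1 τ))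
      rw [mul_zero, mul_one] at this
      exact this.symm
    simp only [hsub]
    refine ContinuousOn.mul continuousOn_snd fun z hz => ?_
    obtain ⟨MU, hMU⟩ := hU.bounded
    obtain ⟨B, hB⟩ := hvb
    refine intervalIntegral.continuousWithinAt_of_dominated_interval (bound := fun _ => MU + B)
      ?_ ?_ (by simp) ?_
    · filter_upwards [self_mem_nhdsWithin] with z' hz'
      rw [uIoc_of_le zero_le_one]
      have hc : ContinuousOn (fun θ => Real.exp (-β * (z'.2 - z'.2 * θ)) *
          (U z'.1 (z'.2 * θ) + v z'.1 (z'.2 * θ))) (Ioc 0 1) := by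
        refine ContinuousOn.mul (by fun_prop) (ContinuousOn.add ?_ ?_)
        · refine (hU.continuousOn_time hz'.1).comp (f := fun θ => z'.2 * θ) (by fun_prop) ?_
          intro θ hθ
          exact ⟨mul_nonneg hz'.2.1.le hθ.1.le,
            (mul_le_of_le_one_right hz'.2.1.le hθ.2).trans hz'.2.2⟩
        · exact (hv.comp (by fun_prop : Continuous fun θ : ℝ => (z'.1, z'.2 * θ))).continuousOn
      exact hc.aestronglyMeasurable measurableSet_Ioc
    · filter_upwards [self_mem_nhdsWithin] with z' hz'
      refine Eventually.of_forall fun θ hθ => ?_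
      rw [uIoc_of_le zero_le_one] at hθ
      have hle : z'.2 * θ ≤ z'.2 := mul_le_of_le_one_right hz'.2.1.le hθ.2
      have h1 := exp_memory_le_one hβ hle
      have h2 := hMU z'.1 (z'.2 * θ)
      have h3 := hB z'.1 (z'.2 * θ) ⟨mul_nonneg hz'.2.1.le hθ.1.le, hle.trans hz'.2.2⟩
      rw [norm_mul, Real.norm_eq_abs, Real.norm_eq_abs, Real.abs_exp]
      have h4 := abs_add_le (U z'.1 (z'.2 * θ)) (v z'.1 (z'.2 * θ))
      calc _ ≤ 1 * (MU + B) := by gcongr; linarith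
        _ = _ := one_mul _
    · refine Eventually.of_forall fun θ hθ => ?_
      rw [uIoc_of_le zero_le_one] at hθ
      have hmaps : MapsTo (fun z : ℝ × ℝ => (z.1, z.2 * θ)) (Ioo 0 L ×ˢ Ioc 0 T)
          (Ioo 0 L ×ˢ Ioc 0 T) := fun z' hz' =>
        ⟨hz'.1, mul_pos hz'.2.1 hθ.1, (mul_le_of_le_one_right hz'.2.1.le hθ.2).trans hz'.2.2⟩
      have h1 := huc.comp (f := fun z : ℝ × ℝ => (z.1, z.2 * θ)) (by fun_prop) hmaps
      have h2 : ContinuousOn (fun z : ℝ × ℝ => Real.exp (-β * (z.2 - z.2 * θ)))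
        (Ioo 0 L ×ˢ Ioc 0 T) := by fun_prop
      exact (h2.mul h1) z hz
  have hFc : ContinuousOn (fun z : ℝ × ℝ =>
      F z.1 z.2 (U z.1 z.2 + v z.1 z.2) (U₁ z.1 z.2 + p z.1 z.2)) (Ioo 0 L ×ˢ Ioc 0 T) :=
    hF.continuousOn.comp (f := fun z : ℝ × ℝ =>
      (z.1, z.2, U z.1 z.2 + v z.1 z.2, U₁ z.1 z.2 + p z.1 z.2))
      (continuousOn_fst.prodMk (continuousOn_snd.prodMk (huc.prodMk (hU₁c.add hp.continuousOn))))
      fun z hz => ⟨⟨hz.1.1.le, hz.1.2.le⟩, hz.2⟩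
  exact (hFc.sub (continuousOn_const.mul huc)).sub (continuousOn_const.mul hmem)

/-- The bound on `F` is uniform in its last argument, so no bound on `U₁` or `p` enters; `U₁` is
only controlled in the interior. -/
lemma abs_sourceTerm_le (ha : 0 < a) (hb : 0 < b) (hβ : 0 < β) (hT : 0 < T)
    (hF : HypothesesA L T F) (hU : IsHeatSolution ε L T u₀ g₁ g₂ U U₁ U₂)
    (hvb : ∃ B, ∀ x, ∀ t ∈ Icc 0 T, |v x t| ≤ B) :
    ∃ M, 0 ≤ M ∧ ∀ x ∈ Ioo 0 L, ∀ t ∈ Ioc 0 T, |sourceTerm a b β F U U₁ v p x t| ≤ M := by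
  obtain ⟨MF, hMF⟩ := hF.bounded
  obtain ⟨MU, hMU⟩ := hU.bounded
  obtain ⟨B, hB⟩ := hvb
  have hMU0 : 0 ≤ MU := (abs_nonneg _).trans (hMU 0 0)
  have hB0 : 0 ≤ B := (abs_nonneg _).trans (hB 0 0 ⟨le_rfl, hT.le⟩)
  refine ⟨|MF| + a * (MU + B) + b * (T * (MU + B)), by positivity, fun x hx t ht => ?_⟩
  have hu : ∀ τ ∈ Icc 0 t, |U x τ + v x τ| ≤ MU + B := fun τ hτ =>
    (abs_add_le _ _).trans (add_le_add (hMU x τ) (hB x τ ⟨hτ.1, hτ.2.trans ht.2⟩))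
  have h1 := hMF x ⟨hx.1.le, hx.2.le⟩ t ht (U x t + v x t) (U₁ x t + p x t)
  have h2 : |a * (U x t + v x t)| ≤ a * (MU + B) := by
    rw [abs_mul, abs_of_pos ha]
    have := hu t ⟨ht.1.le, le_rfl⟩
    gcongr
  have h3 : |b * ∫ τ in (0 : ℝ)..t, Real.exp (-β * (t - τ)) * (U x τ + v x τ)| ≤
      b * (T * (MU + B)) := by
    rw [abs_mul, abs_of_pos hb]
    have := abs_memory_le hβ ht hu
    gcongr
  unfold sourceTerm
  refine (abs_sub _ _).trans (add_le_add ((abs_sub _ _).trans (add_le_add ?_ h2)) h3)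
  exact h1.trans (le_abs_self _)

/-- The unknown heat part cancels in the differences, and `e^{lam τ} ≤ e^{lam t}` for `τ ≤ t` gives
the memory term the same exponential weight as the others. -/
lemma abs_sourceTerm_sub_le (ha : 0 < a) (hb : 0 < b) (hβ : 0 < β) {βF : ℝ}
    (hβF : ∀ x ∈ Icc 0 L, ∀ t ∈ Ioc 0 T, ∀ u₁ p₁ u₂ p₂ : ℝ,
      |F x t u₁ p₁ - F x t u₂ p₂| ≤ βF * (|u₁ - u₂| + |p₁ - p₂|))
    (hU : IsHeatSolution ε L T u₀ g₁ g₂ U U₁ U₂) {v' p' : ℝ → ℝ → ℝ}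
    (hv : Continuous fun z : ℝ × ℝ => v z.1 z.2) (hv' : Continuous fun z : ℝ × ℝ => v' z.1 z.2)
    {D lam : ℝ} (hD : 0 ≤ D) (hlam : 0 ≤ lam)
    (hvv : ∀ x, ∀ t ∈ Icc 0 T, |v x t - v' x t| ≤ D * Real.exp (lam * t))
    (hpp : ∀ x, ∀ t ∈ Icc 0 T, |p x t - p' x t| ≤ D * Real.exp (lam * t)) :
    ∀ x ∈ Ioo 0 L, ∀ t ∈ Ioc 0 T,
      |sourceTerm a b β F U U₁ v p x t - sourceTerm a b β F U U₁ v' p' x t| ≤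
        (2 * |βF| + a + b * T) * D * Real.exp (lam * t) := by
  intro x hx t ht
  have htI : t ∈ Icc 0 T := ⟨ht.1.le, ht.2⟩
  set E := D * Real.exp (lam * t) with hE
  have hE0 : 0 ≤ E := by positivity
  have h1 : |F x t (U x t + v x t) (U₁ x t + p x t) - F x t (U x t + v' x t) (U₁ x t + p' x t)| ≤
      |βF| * (E + E) := by
    refine (hβF x ⟨hx.1.le, hx.2.le⟩ t ht _ _ _ _).trans ?_
    rw [add_sub_add_left_eq_sub, add_sub_add_left_eq_sub]
    have e1 := hvv x t htI
    have e2 := hpp x t htI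
    gcongr
    exact le_abs_self _
  have h2 : |a * (v x t - v' x t)| ≤ a * E := by
    rw [abs_mul, abs_of_pos ha]
    have e1 := hvv x t htI
    gcongr
  have h3 : |b * ∫ τ in (0 : ℝ)..t, Real.exp (-β * (t - τ)) * (v x τ - v' x τ)| ≤ b * (T * E) := by
    rw [abs_mul, abs_of_pos hb]
    gcongr
    refine abs_memory_le hβ ht fun τ hτ => (hvv x τ ⟨hτ.1, hτ.2.trans ht.2⟩).trans ?_
    have := hτ.2
    rw [hE]; gcongr
  have h4 : (∫ τ in (0 : ℝ)..t, Real.exp (-β * (t - τ)) * (v x τ - v' x τ)) =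
      (∫ τ in (0 : ℝ)..t, Real.exp (-β * (t - τ)) * (U x τ + v x τ)) -
      ∫ τ in (0 : ℝ)..t, Real.exp (-β * (t - τ)) * (U x τ + v' x τ) := by
    rw [← intervalIntegral.integral_sub (intervalIntegrable_memory hU hv hx ht)
      (intervalIntegrable_memory hU hv' hx ht)]
    refine intervalIntegral.integral_congr fun τ _ => ?_
    ring
  rw [h4] at h3
  have h5 : ∀ A A' I I' : ℝ, A - a * (U x t + v x t) - b * I - (A' - a * (U x t + v' x t) - b * I')
      = (A - A') - a * (v x t - v' x t) - b * (I - I') := by intros; ring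
  unfold sourceTerm
  rw [h5]
  refine (abs_sub _ _).trans ((add_le_add ((abs_sub _ _).trans (add_le_add h1 h2)) h3).trans
    (le_of_eq ?_))
  rw [hE]; ring

end sourceTerm

/-! ### Contraction argument for the nonlinear integral equation -/

section fixedPoint

variable {ε a b β L T : ℝ} {F : ℝ → ℝ → ℝ → ℝ → ℝ} {u₀ g₁ g₂ : ℝ → ℝ} {U U₁ U₂ : ℝ → ℝ → ℝ}

/-- Clamping a time to `[0, T]`. -/
noncomputable def clampTime (T t : ℝ) : ℝ := max 0 (min t T)

lemma clampTime_mem (hT : 0 < T) (t : ℝ) : clampTime T t ∈ Icc 0 T :=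
  ⟨le_max_left _ _, max_le hT.le (min_le_right _ _)⟩

lemma clampTime_of_mem {t : ℝ} (ht : t ∈ Icc 0 T) : clampTime T t = t := by
  rw [clampTime, min_eq_left ht.2, max_eq_right ht.1]

/-- The correction `v` and its gradient solve the integral equation. -/
theorem exists_mild_solution (hε : 0 < ε) (ha : 0 < a) (hb : 0 < b) (hβ : 0 < β) (hL : 0 < L)
    (hT : 0 < T) (hF : HypothesesA L T F) (hU : IsHeatSolution ε L T u₀ g₁ g₂ U U₁ U₂) :
    ∃ (M : ℝ) (f : ℝ → ℝ → ℝ), IsSource M f ∧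
      f = oddExt L T (sourceTerm a b β F U U₁ (volPot ε 0 f) (volPot ε 1 f)) := by
  obtain ⟨βF, hβF⟩ := hF.lipschitz_up
  set Λ := 2 * |βF| + a + b * T with hΛ
  have hΛ0 : 0 < Λ := by positivity
  -- The source depends on the unknowns with Lipschitz constant `Λ`; smallness `δ` of the potentials
  -- gives the contraction constant `δ Λ = 1/2`.
  set δ := 1 / (2 * Λ) with hδ
  have hδ0 : 0 < δ := by positivity
  obtain ⟨lam, hlam0, hV0, hV1⟩ := ((eventually_ge_atTop (0 : ℝ)).and
    ((abs_volPot_le_of_exp hε T hδ0 zero_le_one).and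
      (abs_volPot_le_of_exp hε T hδ0 le_rfl))).exists
  have hV : ∀ j ≤ 1, ∀ {M A : ℝ} {f : ℝ → ℝ → ℝ}, IsSource M f → 0 ≤ A →
      (∀ s y, |f s y| ≤ A * Real.exp (lam * s)) →
      ∀ x t, t ≤ T → |volPot ε j f x t| ≤ δ * A * Real.exp (lam * t) := by
    intro j hj
    interval_cases j
    · exact hV0
    · exact hV1
  -- the unweighted functions attached to a pair of bounded functions
  set W : (ℝ × ℝ →ᵇ ℝ) → ℝ → ℝ → ℝ := fun w x t => Real.exp (lam * t) * w (x, t) with hW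
  have hWc : ∀ w, Continuous fun z : ℝ × ℝ => W w z.1 z.2 := fun w => by
    have := w.continuous
    simp only [hW]
    fun_prop
  have hWb : ∀ w, ∃ B, ∀ x, ∀ t ∈ Icc 0 T, |W w x t| ≤ B := fun w =>
    ⟨Real.exp (lam * T) * ‖w‖, fun x t ht => by
      simp only [hW]
      rw [abs_mul, Real.abs_exp]
      have h1 := w.norm_coe_le_norm (x, t)
      rw [Real.norm_eq_abs] at h1
      have h2 := ht.2
      gcongr⟩
  -- The gradient slot is an independent unknown. At the fixed point both components are potentials
  -- of the same source, which makes the second the space derivative of the first.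
  set h : (ℝ × ℝ →ᵇ ℝ) × (ℝ × ℝ →ᵇ ℝ) → ℝ → ℝ → ℝ := fun w =>
    sourceTerm a b β F U U₁ (W w.1) (W w.2) with hh
  have hsrc : ∀ w, ∃ M, IsSource M (oddExt L T (h w)) := by
    intro w
    obtain ⟨M, hM0, hM⟩ := abs_sourceTerm_le (p := W w.2) ha hb hβ hT hF hU (hWb w.1)
    exact ⟨M, isSource_oddExt hL hT
      (continuousOn_sourceTerm hβ hF hU (hWc w.1) (hWc w.2) (hWb w.1)) hM0 hM⟩
  choose M hM using hsrc
  have hexp : ∀ t, 0 ≤ t → 1 ≤ Real.exp (lam * t) := fun t ht => by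
    rw [Real.one_le_exp_iff]; positivity
  have hcancel : ∀ t, Real.exp (-(lam * t)) * Real.exp (lam * t) = 1 := fun t => by
    rw [← Real.exp_add, neg_add_cancel, Real.exp_zero]
  -- bounds for the weighted potentials
  have hweighted : ∀ j ≤ 1, ∀ {M A : ℝ} {f : ℝ → ℝ → ℝ}, IsSource M f → 0 ≤ A →
      (∀ s y, |f s y| ≤ A * Real.exp (lam * s)) → ∀ x t : ℝ,
      |Real.exp (-(lam * clampTime T t)) * volPot ε j f x (clampTime T t)| ≤ δ * A := by
    intro j hj M A f hf hA hfA x t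
    have h1 := hV j hj hf hA hfA x (clampTime T t) (clampTime_mem hT t).2
    rw [abs_mul, Real.abs_exp]
    calc _ ≤ Real.exp (-(lam * clampTime T t)) * (δ * A * Real.exp (lam * clampTime T t)) := by
          gcongr
      _ = δ * A * (Real.exp (-(lam * clampTime T t)) * Real.exp (lam * clampTime T t)) := by ring
      _ = δ * A := by rw [hcancel, mul_one]
  have hMexp : ∀ {M : ℝ} {f : ℝ → ℝ → ℝ}, IsSource M f → ∀ s y,
      |f s y| ≤ M * Real.exp (lam * s) := by
    intro M f hf s y
    have hM0 := hf.nonneg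
    rcases le_or_gt s 0 with hs | hs
    · rw [hf.eq_zero s hs, abs_zero]; positivity
    · exact (hf.bound s y).trans (le_mul_of_one_le_right hM0 (hexp s hs.le))
  have hcl : Continuous (clampTime T) := by unfold clampTime; fun_prop
  -- Clamping the time makes the weighted potentials bounded and continuous on the whole plane, so
  -- the iteration takes place in a complete space; on `[0, T]` nothing changes.
  set Φ : ∀ j ≤ 1, (ℝ × ℝ →ᵇ ℝ) × (ℝ × ℝ →ᵇ ℝ) → (ℝ × ℝ →ᵇ ℝ) := fun j hj w =>
    BoundedContinuousFunction.ofNormedAddCommGroup (fun z : ℝ × ℝ =>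
      Real.exp (-(lam * clampTime T z.2)) * volPot ε j (oddExt L T (h w)) z.1 (clampTime T z.2))
      (by
        have h1 : Continuous fun z : ℝ × ℝ => volPot ε j (oddExt L T (h w)) z.1 (clampTime T z.2) :=
          (continuous_volPot hε (hM w) hj).comp
            (continuous_fst.prodMk (hcl.comp continuous_snd))
        exact (by fun_prop : Continuous fun z : ℝ × ℝ => Real.exp (-(lam * clampTime T z.2))).mul h1)
      (δ * M w) (fun z => hweighted j hj (hM w) (hM w).nonneg (hMexp (hM w)) z.1 z.2) with hΦ
  have hWdiff : ∀ w w' : ℝ × ℝ →ᵇ ℝ, ∀ x, ∀ t, |W w x t - W w' x t| ≤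
      dist w w' * Real.exp (lam * t) := by
    intro w w' x t
    simp only [hW]
    rw [← mul_sub, abs_mul, Real.abs_exp, mul_comm]
    have := w.dist_coe_le_dist (g := w') (x, t)
    rw [Real.dist_eq] at this
    gcongr
  have hcontr : ∀ j hj w w', dist (Φ j hj w) (Φ j hj w') ≤ 1 / 2 * dist w w' := by
    intro j hj w w'
    rw [dist_le (by positivity)]
    intro z
    have hd := (hM w).sub (hM w')
    have hdb : ∀ s y, |oddExt L T (h w) s y - oddExt L T (h w') s y| ≤
        Λ * dist w w' * Real.exp (lam * s) := by
      intro s y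
      rw [oddExt_sub]
      refine abs_oddExt_le hL (B := fun s => Λ * dist w w' * Real.exp (lam * s)) (by positivity)
        fun hs x hx => ?_
      have hm : min s T ∈ Ioc 0 T := ⟨lt_min hs hT, min_le_right _ _⟩
      have := abs_sourceTerm_sub_le (p := W w.2) (p' := W w'.2) ha hb hβ hβF hU (hWc w.1)
        (hWc w'.1) dist_nonneg hlam0
        (D := dist w w')
        (fun x t _ => (hWdiff w.1 w'.1 x t).trans (by gcongr; exact le_max_left _ _))
        (fun x t _ => (hWdiff w.2 w'.2 x t).trans (by gcongr; exact le_max_right _ _)) x hx _ hm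
      refine this.trans ?_
      have hmin : min s T ≤ s := min_le_left _ _
      gcongr
    have h1 := hweighted j hj hd (by positivity) hdb z.1 z.2
    rw [volPot_sub hε (hM w) (hM w') hj, mul_sub] at h1
    rw [Real.dist_eq]
    refine h1.trans (le_of_eq ?_)
    rw [hδ]; field_simp
  have hcw : ContractingWith (1 / 2) fun w => (Φ 0 zero_le_one w, Φ 1 le_rfl w) := by
    refine ⟨by rw [← NNReal.coe_lt_coe]; norm_num, LipschitzWith.of_dist_le_mul fun w w' => ?_⟩
    rw [Prod.dist_eq]
    have : ((1 / 2 : NNReal) : ℝ) = 1 / 2 := by norm_num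
    rw [this]
    exact max_le (hcontr 0 zero_le_one w w') (hcontr 1 le_rfl w w')
  obtain ⟨w, hw⟩ : ∃ w, (Φ 0 zero_le_one w, Φ 1 le_rfl w) = w :=
    ⟨_, hcw.fixedPoint_isFixedPt⟩
  have hw0 : ∀ x, ∀ t ∈ Icc 0 T, W w.1 x t = volPot ε 0 (oddExt L T (h w)) x t := by
    intro x t ht
    have h1 : w.1 (x, t) = Real.exp (-(lam * clampTime T t))
        * volPot ε 0 (oddExt L T (h w)) x (clampTime T t) := by
      conv_lhs => rw [← hw]
      rfl
    simp only [hW]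
    rw [h1, clampTime_of_mem ht, ← mul_assoc, mul_comm (Real.exp (lam * t)), hcancel, one_mul]
  have hw1 : ∀ x, ∀ t ∈ Icc 0 T, W w.2 x t = volPot ε 1 (oddExt L T (h w)) x t := by
    intro x t ht
    have h1 : w.2 (x, t) = Real.exp (-(lam * clampTime T t))
        * volPot ε 1 (oddExt L T (h w)) x (clampTime T t) := by
      conv_lhs => rw [← hw]
      rfl
    simp only [hW]
    rw [h1, clampTime_of_mem ht, ← mul_assoc, mul_comm (Real.exp (lam * t)), hcancel, one_mul]
  refine ⟨M w, oddExt L T (h w), hM w, oddExt_congr hL hT fun x hx t ht => ?_⟩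
  have htI : t ∈ Icc 0 T := ⟨ht.1.le, ht.2⟩
  simp only [hh, sourceTerm]
  rw [hw0 x t htI, hw1 x t htI]
  congr 2
  refine intervalIntegral.integral_congr fun τ hτ => ?_
  rw [uIcc_of_le ht.1.le] at hτ
  rw [hw0 x τ ⟨hτ.1, hτ.2.trans ht.2⟩]

end fixedPoint

/-! ### Regularity and the main theorem -/

lemma abs_le_sqrt_mul_sqrt {d L : ℝ} (hd : |d| ≤ L) : |d| ≤ √L * √|d| := by
  nth_rw 1 [← Real.mul_self_sqrt (abs_nonneg d)]
  gcongr

lemma abs_sub_le_of_hasDerivAt {φ φ' : ℝ → ℝ} {c d C : ℝ}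
    (h : ∀ x ∈ Icc c d, HasDerivAt φ (φ' x) x) (hC : ∀ x ∈ Icc c d, |φ' x| ≤ C) :
    ∀ x ∈ Icc c d, ∀ y ∈ Icc c d, |φ y - φ x| ≤ C * |y - x| := fun x hx y hy =>
  Convex.norm_image_sub_le_of_norm_hasDerivWithin_le (s := Icc c d)
    (fun z hz => (h z hz).hasDerivWithinAt) hC (convex_Icc c d) hx hy

section regularity

variable {ε a b β L T M : ℝ} {F : ℝ → ℝ → ℝ → ℝ → ℝ} {u₀ g₁ g₂ : ℝ → ℝ} {U U₁ U₂ : ℝ → ℝ → ℝ}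
  {f : ℝ → ℝ → ℝ}

lemma exists_abs_volPot_le (hε : 0 < ε) (hf : IsSource M f) {j : ℕ} (hj : j ≤ 1) (T : ℝ) :
    ∃ C : ℝ, 0 ≤ C ∧ ∀ x, ∀ t ∈ Icc 0 T, |volPot ε j f x t| ≤ C := by
  obtain ⟨lam, hlam0, hV⟩ := ((eventually_ge_atTop (0 : ℝ)).and
    (abs_volPot_le_of_exp hε T one_pos hj)).exists
  have hM := hf.nonneg
  refine ⟨1 * M * Real.exp (lam * T), by positivity, fun x t ht => ?_⟩
  refine (hV hf hM (fun s y => ?_) x t ht.2).trans ?_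
  · rcases le_or_gt s 0 with hs | hs
    · rw [hf.eq_zero s hs, abs_zero]; positivity
    · refine (hf.bound s y).trans (le_mul_of_one_le_right hM ?_)
      rw [Real.one_le_exp_iff]; positivity
  · have := ht.2
    gcongr

/-- Lipschitz bound in space for the memory term, uniformly in time. -/
lemma abs_memory_sub_le (hβ : 0 < β) {w w' : ℝ → ℝ} {C D d t : ℝ} (hC : 0 ≤ C) (hD : 0 ≤ D)
    (hd : 0 ≤ d) (ht : t ∈ Ioc 0 T) (hw : ∀ τ ∈ Ioc 0 t, |w τ - w' τ| ≤ (C / √τ + D) * d) :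
    |∫ τ in (0 : ℝ)..t, Real.exp (-β * (t - τ)) * (w τ - w' τ)| ≤
      (∫ τ, (singWeight C (1 / 2) T τ + singWeight D 0 T τ)) * d := by
  have hint : Integrable fun τ => singWeight C (1 / 2) T τ + singWeight D 0 T τ :=
    (integrable_singWeight C (by norm_num) T).add (integrable_singWeight D (by norm_num) T)
  have hnn : ∀ τ, 0 ≤ singWeight C (1 / 2) T τ + singWeight D 0 T τ := fun τ =>
    add_nonneg (singWeight_nonneg hC) (singWeight_nonneg hD)
  rw [intervalIntegral.integral_of_le ht.1.le, ← integral_mul_const, ← Real.norm_eq_abs]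
  refine (norm_integral_le_of_norm_le (μ := volume.restrict (Ioc 0 t))
    (g := fun τ => (singWeight C (1 / 2) T τ + singWeight D 0 T τ) * d)
    (hint.mul_const d).restrict ?_).trans
    (setIntegral_le_integral (hint.mul_const d)
      (Eventually.of_forall fun τ => mul_nonneg (hnn τ) hd))
  refine (ae_restrict_mem measurableSet_Ioc).mono fun τ hτ => ?_
  have hτT : τ ∈ Ioc 0 T := ⟨hτ.1, hτ.2.trans ht.2⟩
  rw [norm_mul, Real.norm_eq_abs, Real.norm_eq_abs, Real.abs_exp, singWeight_of_mem hτT,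
    singWeight_of_mem hτT, neg_zero, Real.rpow_zero, mul_one, Real.rpow_neg hτ.1.le,
    ← Real.sqrt_eq_rpow, ← div_eq_mul_inv]
  have h1 := exp_memory_le_one hβ hτ.2
  have h2 := hw τ hτ
  calc _ ≤ 1 * ((C / √τ + D) * d) := by gcongr
    _ = _ := one_mul _

/-- The source term generated by a bounded source is locally Hölder continuous in space. -/
lemma sourceTerm_holder (hε : 0 < ε) (ha : 0 < a) (hb : 0 < b) (hβ : 0 < β) (hL : 0 < L)
    (hF : HypothesesA L T F) (hU : IsHeatSolution ε L T u₀ g₁ g₂ U U₁ U₂)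
    (hf : IsSource M f) {δ t₁ : ℝ} (hδ : 0 < δ) (ht₁ : 0 < t₁) :
    ∃ H : ℝ, 0 ≤ H ∧ ∀ x ∈ Icc δ (L - δ), ∀ y ∈ Icc δ (L - δ), ∀ t ∈ Icc t₁ T,
      |sourceTerm a b β F U U₁ (volPot ε 0 f) (volPot ε 1 f) y t
        - sourceTerm a b β F U U₁ (volPot ε 0 f) (volPot ε 1 f) x t| ≤ H * √|y - x| := by
  have hIcc : Icc δ (L - δ) ⊆ Ioo 0 L := fun x hx => ⟨by linarith [hx.1], by linarith [hx.2]⟩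
  obtain ⟨βF, hβF⟩ := hF.lipschitz_up
  obtain ⟨MU, hMU⟩ := hU.bounded
  have hMU0 : 0 ≤ MU := (abs_nonneg _).trans (hMU 0 0)
  obtain ⟨B₀, hB₀0, hB₀⟩ := exists_abs_volPot_le hε hf zero_le_one T
  obtain ⟨B₁, hB₁0, hB₁⟩ := exists_abs_volPot_le hε hf le_rfl T
  obtain ⟨C₁, hC₁0, hC₁⟩ := hU.gradient_bound δ hδ
  obtain ⟨C₃, hC₃0, hC₃⟩ := abs_volPot_one_sub_le hε hf T
  -- On a compact part of the interior `U₂` is bounded by continuity, which makes `U₁` Lipschitz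
  -- there.
  obtain ⟨C₂, hC₂⟩ : ∃ C₂, ∀ z ∈ Icc δ (L - δ) ×ˢ Icc t₁ T, |U₂ z.1 z.2| ≤ C₂ := by
    refine (isCompact_Icc.prod isCompact_Icc).exists_bound_of_continuousOn
      (f := fun z : ℝ × ℝ => U₂ z.1 z.2) fun z hz => ?_
    exact (hU.continuousAt_two z.1 (hIcc hz.1) z.2 (ht₁.trans_le hz.2.1)).continuousWithinAt
  -- Exceeds both `|u|` and `|u_x|` for `t ≥ t₁` and `x` in `[δ, L - δ]`, so the local Lipschitz
  -- condition on `F` applies at this level; the final `1` makes the bounds strict.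
  set k := MU + B₀ + (C₁ / √t₁ + B₁) + 1 with hk
  have hk0 : 0 < k := by positivity
  obtain ⟨C₀, hC₀⟩ := hF.lipschitz_xt k hk0 (Icc 0 L ×ˢ Icc t₁ T)
    (isCompact_Icc.prod isCompact_Icc) fun z hz => ⟨hz.1, ht₁.trans_le hz.2.1, hz.2.2⟩
  -- The memory term reaches back to `τ = 0`, where the Lipschitz constant `C₁ / √τ + B₁` of `u` in
  -- space blows up but stays integrable over `(0, T]`; `J` is its integral.
  set J := ∫ τ, (singWeight C₁ (1 / 2) T τ + singWeight B₁ 0 T τ) with hJ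
  have hJ0 : 0 ≤ J := integral_nonneg fun τ =>
    add_nonneg (singWeight_nonneg hC₁0) (singWeight_nonneg hB₁0)
  refine ⟨(|C₀| + |βF| * (C₁ / √t₁ + B₁ + |C₂|) + a * (C₁ / √t₁ + B₁) + b * J) * √L + |βF| * C₃,
    by positivity, fun x hx y hy t ht => ?_⟩
  have htI : t ∈ Ioc 0 T := ⟨ht₁.trans_le ht.1, ht.2⟩
  have hd := abs_nonneg (y - x)
  -- Lipschitz bounds for the ingredients
  have hUlip : ∀ τ ∈ Ioc 0 T, |U y τ - U x τ| ≤ C₁ / √τ * |y - x| := fun τ hτ =>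
    abs_sub_le_of_hasDerivAt (fun z hz => hU.hasDerivAt z (hIcc hz) τ hτ.1)
      (fun z hz => hC₁ z hz τ hτ) x hx y hy
  have hU₁lip : |U₁ y t - U₁ x t| ≤ |C₂| * |y - x| :=
    abs_sub_le_of_hasDerivAt (fun z hz => hU.hasDerivAt_one z (hIcc hz) t htI.1)
      (fun z hz => (hC₂ (z, t) ⟨hz, ht⟩).trans (le_abs_self _)) x hx y hy
  have hvlip : ∀ τ ∈ Icc 0 T, |volPot ε 0 f y τ - volPot ε 0 f x τ| ≤ B₁ * |y - x| := fun τ hτ =>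
    abs_sub_le_of_hasDerivAt (fun z _ => hasDerivAt_volPot hε hf z τ)
      (fun z _ => hB₁ z τ hτ) x hx y hy
  have hulip : ∀ τ ∈ Ioc 0 T, |U y τ + volPot ε 0 f y τ - (U x τ + volPot ε 0 f x τ)| ≤
      (C₁ / √τ + B₁) * |y - x| := by
    intro τ hτ
    have h1 := hUlip τ hτ
    have h2 := hvlip τ ⟨hτ.1.le, hτ.2⟩
    rw [add_sub_add_comm, add_mul]
    exact (abs_add_le _ _).trans (add_le_add h1 h2)
  have hsq : √t₁ ≤ √t := Real.sqrt_le_sqrt ht.1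
  have hst₁ : 0 < √t₁ := Real.sqrt_pos.mpr ht₁
  have hCt : C₁ / √t ≤ C₁ / √t₁ := by gcongr
  have hu : |U y t + volPot ε 0 f y t - (U x t + volPot ε 0 f x t)| ≤
      (C₁ / √t₁ + B₁) * |y - x| := (hulip t htI).trans (by gcongr)
  have hq : |U₁ y t + volPot ε 1 f y t - (U₁ x t + volPot ε 1 f x t)| ≤
      |C₂| * |y - x| + C₃ * √|y - x| := by
    rw [add_sub_add_comm]
    exact (abs_add_le _ _).trans (add_le_add hU₁lip (hC₃ t ht.2 y x))
  -- the nonlinearity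
  have hku : |U y t + volPot ε 0 f y t| < k := by
    have h1 := hMU y t
    have h2 := hB₀ y t ⟨htI.1.le, htI.2⟩
    have h3 := abs_add_le (U y t) (volPot ε 0 f y t)
    have h4 : 0 ≤ C₁ / √t₁ + B₁ := by positivity
    linarith
  have hkq : |U₁ y t + volPot ε 1 f y t| < k := by
    have h1 := hC₁ y hy t htI
    have h2 := hB₁ y t ⟨htI.1.le, htI.2⟩
    have h3 := abs_add_le (U₁ y t) (volPot ε 1 f y t)
    linarith
  have hF1 : |F y t (U y t + volPot ε 0 f y t) (U₁ y t + volPot ε 1 f y t)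
      - F x t (U y t + volPot ε 0 f y t) (U₁ y t + volPot ε 1 f y t)| ≤ |C₀| * |y - x| := by
    have hy' := hIcc hy
    have hx' := hIcc hx
    have h1 := hC₀ (y, t) ⟨⟨hy'.1.le, hy'.2.le⟩, ht⟩ (x, t) ⟨⟨hx'.1.le, hx'.2.le⟩, ht⟩ _ _ hku hkq
    simp only [sub_self, abs_zero, add_zero] at h1
    exact h1.trans (by gcongr; exact le_abs_self _)
  have hF2 : |F x t (U y t + volPot ε 0 f y t) (U₁ y t + volPot ε 1 f y t)
      - F x t (U x t + volPot ε 0 f x t) (U₁ x t + volPot ε 1 f x t)| ≤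
      |βF| * ((C₁ / √t₁ + B₁) * |y - x| + (|C₂| * |y - x| + C₃ * √|y - x|)) := by
    have hx' := hIcc hx
    refine (hβF x ⟨hx'.1.le, hx'.2.le⟩ t htI _ _ _ _).trans ?_
    gcongr
    exact le_abs_self _
  have hmem : |b * ∫ τ in (0 : ℝ)..t, Real.exp (-β * (t - τ)) *
      (U y τ + volPot ε 0 f y τ - (U x τ + volPot ε 0 f x τ))| ≤ b * (J * |y - x|) := by
    rw [abs_mul, abs_of_pos hb]
    gcongr
    exact abs_memory_sub_le hβ hC₁0 hB₁0 hd htI fun τ hτ =>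
      hulip τ ⟨hτ.1, hτ.2.trans htI.2⟩
  have hau : |a * (U y t + volPot ε 0 f y t - (U x t + volPot ε 0 f x t))| ≤
      a * ((C₁ / √t₁ + B₁) * |y - x|) := by
    rw [abs_mul, abs_of_pos ha]
    gcongr
  have hvc := continuous_volPot hε hf zero_le_one
  have hsub : (∫ τ in (0 : ℝ)..t, Real.exp (-β * (t - τ)) *
      (U y τ + volPot ε 0 f y τ - (U x τ + volPot ε 0 f x τ))) =
      (∫ τ in (0 : ℝ)..t, Real.exp (-β * (t - τ)) * (U y τ + volPot ε 0 f y τ)) -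
      ∫ τ in (0 : ℝ)..t, Real.exp (-β * (t - τ)) * (U x τ + volPot ε 0 f x τ) := by
    rw [← intervalIntegral.integral_sub (intervalIntegrable_memory hU hvc (hIcc hy) htI)
      (intervalIntegrable_memory hU hvc (hIcc hx) htI)]
    simp only [mul_sub]
  rw [hsub] at hmem
  have hsplit : ∀ A A' A'' u u' I I' : ℝ, A - a * u - b * I - (A'' - a * u' - b * I')
      = (A - A') + (A' - A'') - a * (u - u') - b * (I - I') := by intros; ring
  unfold sourceTerm
  rw [hsplit _ (F x t (U y t + volPot ε 0 f y t) (U₁ y t + volPot ε 1 f y t))]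
  refine (abs_sub _ _).trans ((add_le_add ((abs_sub _ _).trans
    (add_le_add ((abs_add_le _ _).trans (add_le_add hF1 hF2)) hau)) hmem).trans ?_)
  have hyx : |y - x| ≤ √L * √|y - x| := by
    refine abs_le_sqrt_mul_sqrt (abs_le.mpr ⟨?_, ?_⟩)
    · linarith [hx.1, hx.2, hy.1, hy.2]
    · linarith [hx.1, hx.2, hy.1, hy.2]
  calc _ = (|C₀| + |βF| * (C₁ / √t₁ + B₁ + |C₂|) + a * (C₁ / √t₁ + B₁) + b * J) * |y - x|
        + |βF| * C₃ * √|y - x| := by ring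
    _ ≤ (|C₀| + |βF| * (C₁ / √t₁ + B₁ + |C₂|) + a * (C₁ / √t₁ + B₁) + b * J) * (√L * √|y - x|)
        + |βF| * C₃ * √|y - x| := by gcongr
    _ = _ := by ring

/-- Interior regularity of the volume potential of the fixed point source. -/
lemma volPot_regularity (hε : 0 < ε) (ha : 0 < a) (hb : 0 < b) (hβ : 0 < β) (hL : 0 < L)
    (hF : HypothesesA L T F) (hU : IsHeatSolution ε L T u₀ g₁ g₂ U U₁ U₂)
    (hf : IsSource M f)
    (hfeq : f = oddExt L T (sourceTerm a b β F U U₁ (volPot ε 0 f) (volPot ε 1 f)))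
    {x t : ℝ} (hx : x ∈ Ioo 0 L) (ht : t ∈ Ioc 0 T) :
    HasDerivAt (fun y => volPot ε 1 f y t) (volPot ε 2 f x t) x ∧
      ContinuousAt (fun z : ℝ × ℝ => volPot ε 2 f z.1 z.2) (x, t) ∧
      HasDerivAt (fun s => volPot ε 0 f x s) (ε * volPot ε 2 f x t + f t x) t := by
  -- A quarter of the distance to the sides: `x` lies in `(2δ, L - 2δ)`, and the Hölder bound holds
  -- on the larger interval `[δ, L - δ]`, as `oddExt_holder` requires.
  set δ := min x (L - x) / 4 with hδdef
  have hm : 0 < min x (L - x) := lt_min hx.1 (sub_pos.mpr hx.2)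
  have hδ : 0 < δ := by positivity
  have hxδ : x ∈ Ioo (2 * δ) (L - 2 * δ) := by
    have h1 := min_le_left x (L - x)
    have h2 := min_le_right x (L - x)
    constructor <;> linarith
  have ht₁ : 0 < t / 2 := half_pos ht.1
  have ht₁T : t / 2 ≤ T := by linarith [ht.2]
  have htt : t / 2 < t := by linarith
  obtain ⟨H, hH0, hH⟩ := sourceTerm_holder hε ha hb hβ hL hF hU hf hδ ht₁
  have hM := hf.nonneg
  have hhol := oddExt_holder hL (hfeq ▸ hf) hδ ht₁ ht₁T hH0 hH
  rw [← hfeq] at hhol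
  have hK : 0 ≤ H + 2 * M / √δ := by positivity
  exact ⟨hasDerivAt_volPot_one hε hf hK hhol hxδ htt,
    continuousAt_volPot_two hε hf hK hhol hxδ htt,
    hasDerivAt_volPot_time hε hf hK hhol hxδ htt ht₁.le⟩

end regularity

/-- The solution is `U + v` with `v` the potential of the fixed point source. The function `U`
carries all data and corner behaviour, because `v` is continuous everywhere and vanishes initially
and, by oddness of the source, on both sides. -/
theorem exists_isRegularSolution {ε a b β L T : ℝ} (hε : 0 < ε) (ha : 0 < a) (hb : 0 < b)
    (hβ : 0 < β) (hL : 0 < L) (hT : 0 < T) {F : ℝ → ℝ → ℝ → ℝ → ℝ} (hF : HypothesesA L T F)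
    {u₀ g₁ g₂ : ℝ → ℝ} (hu₀ : ContinuousOn u₀ (Icc 0 L))
    (hg₁ : ContinuousOn g₁ (Icc 0 T)) (hg₂ : ContinuousOn g₂ (Icc 0 T)) :
    ∃ u : ℝ → ℝ → ℝ, IsRegularSolution ε a b β L T F u₀ g₁ g₂ u := by
  obtain ⟨U, U₁, U₂, hU⟩ := exists_isHeatSolution hε hL hT hu₀ hg₁ hg₂
  obtain ⟨M, f, hf, hfeq⟩ := exists_mild_solution hε ha hb hβ hL hT hF hU
  have hvc := continuous_volPot hε hf zero_le_one
  have hpc := continuous_volPot hε hf le_rfl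
  have hv0 : ∀ x, volPot ε 0 f x 0 = 0 := fun x => volPot_of_nonpos hε hf 0 x le_rfl
  have hvl : ∀ t, volPot ε 0 f 0 t = 0 := volPot_eq_zero_of_odd fun s y => by
    rw [hfeq]; exact oddExt_odd_zero s y
  have hvr : ∀ t, volPot ε 0 f L t = 0 := volPot_eq_zero_of_odd fun s y => by
    rw [hfeq]; exact oddExt_odd_right hL s y
  have hreg := fun {x t : ℝ} (hx : x ∈ Ioo 0 L) (ht : t ∈ Ioc 0 T) =>
    volPot_regularity hε ha hb hβ hL hF hU hf hfeq hx ht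
  refine ⟨fun x t => U x t + volPot ε 0 f x t, ?_⟩
  constructor
  case bounded =>
    obtain ⟨MU, hMU⟩ := hU.bounded
    obtain ⟨B, -, hB⟩ := exists_abs_volPot_le hε hf zero_le_one T
    exact ⟨MU + B, fun x _ t ht => (abs_add_le _ _).trans
      (add_le_add (hMU x t) (hB x t ⟨ht.1.le, ht.2⟩))⟩
  case continuousOn => exact hU.continuousOn.add hvc.continuousOn
  case corner_left => exact fun h => (hU.corner_left h).add hvc.continuousWithinAt
  case corner_right => exact fun h => (hU.corner_right h).add hvc.continuousWithinAt
  case initial =>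
    intro x hx
    simp only [hv0, add_zero]
    exact hU.initial x hx
  case boundary_left =>
    intro t ht
    simp only [hvl, add_zero]
    exact hU.boundary_left t ht
  case boundary_right =>
    intro t ht
    simp only [hvr, add_zero]
    exact hU.boundary_right t ht
  case equation =>
    have hsrc : ∀ x ∈ Ioo 0 L, ∀ t ∈ Ioc 0 T, f t x =
        sourceTerm a b β F U U₁ (volPot ε 0 f) (volPot ε 1 f) x t := by
      intro x hx t ht
      conv_lhs => rw [hfeq]
      rw [oddExt_of_mem hL _ ht.1 hx, min_eq_left ht.2]
    have hsc : ContinuousOn (fun z : ℝ × ℝ => f z.2 z.1) (Ioo 0 L ×ˢ Ioc 0 T) := by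
      obtain ⟨B, -, hB⟩ := exists_abs_volPot_le hε hf zero_le_one T
      exact (continuousOn_sourceTerm (a := a) (b := b) hβ hF hU hvc hpc ⟨B, hB⟩).congr
        fun z hz => hsrc z.1 hz.1 z.2 hz.2
    have hU₂c : ContinuousOn (fun z : ℝ × ℝ => U₂ z.1 z.2) (Ioo 0 L ×ˢ Ioc 0 T) := fun z hz =>
      (hU.continuousAt_two z.1 hz.1 z.2 hz.2.1).continuousWithinAt
    have hV₂c : ContinuousOn (fun z : ℝ × ℝ => volPot ε 2 f z.1 z.2) (Ioo 0 L ×ˢ Ioc 0 T) :=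
      fun z hz => (hreg hz.1 hz.2).2.1.continuousWithinAt
    refine ⟨fun x t => U₁ x t + volPot ε 1 f x t, fun x t => U₂ x t + volPot ε 2 f x t,
      fun x t => ε * U₂ x t + (ε * volPot ε 2 f x t + f t x), ?_, hU₂c.add hV₂c,
      (continuousOn_const.mul hU₂c).add ((continuousOn_const.mul hV₂c).add hsc),
      fun x hx t ht => ⟨?_, ?_, ?_, ?_⟩⟩
    · exact fun z hz => ((hU.continuousAt_one z.1 hz.1 z.2 hz.2.1).add
        hpc.continuousAt).continuousWithinAt
    · exact (hU.hasDerivAt x hx t ht.1).add (hasDerivAt_volPot hε hf x t)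
    · exact (hU.hasDerivAt_one x hx t ht.1).add (hreg hx ht).1
    · exact ((hU.hasDerivAt_time x hx t ht.1).add (hreg hx ht).2.2).hasDerivWithinAt
    · beta_reduce
      rw [hsrc x hx t ht, sourceTerm]
      ring

theorem theorem3 (ε a b β L T : ℝ) (hε : 0 < ε) (ha : 0 < a) (hb : 0 < b) (hβ : 0 < β)
    (hL : 0 < L) (hT : 0 < T) (F : ℝ → ℝ → ℝ → ℝ → ℝ) (hF : HypothesesA L T F)
    (u₀ g₁ g₂ : ℝ → ℝ) (hu₀ : ContinuousOn u₀ (Icc 0 L))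
    (hg₁ : ContinuousOn g₁ (Icc 0 T)) (hg₂ : ContinuousOn g₂ (Icc 0 T)) :
    ∃ u : ℝ → ℝ → ℝ, IsRegularSolution ε a b β L T F u₀ g₁ g₂ u ∧
      ∀ v : ℝ → ℝ → ℝ, IsRegularSolution ε a b β L T F u₀ g₁ g₂ v →
        ∀ x ∈ Icc 0 L, ∀ t ∈ Icc 0 T, v x t = u x t := by
  obtain ⟨u, hu⟩ := exists_isRegularSolution hε ha hb hβ hL hT hF hu₀ hg₁ hg₂
  exact ⟨u, hu, fun v hv => IsRegularSolution.eq hε ha hb hβ hL hT hF hu hv⟩
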